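/- Let $r\ge 1$, let $\zeta$ be a primitive $r$-th root of unity, put $\zeta_p=\zeta^{p-1}$ for $1\le p\le r$, and let $q\in\mathbb C^*$ be not a root of unity. The affine Yokonuma–Hecke algebra $\widehat Y_{r,n}=\widehat Y_{r,n}(q)$ is the $\mathbb C$-algebra generated by $t_1,\dots,t_n,g_1,\dots,g_{n-1},X_1^{\pm1}$ with the relations $g_ig_j=g_jg_i$ ($|i-j|\ge2$), $g_ig_{i+1}g_i=g_{i+1}g_ig_{i+1}$, $t_it_j=t_jt_i$, $g_it_j=t_{s_i(j)}g_i$, $t_i^r=1$, $g_i^2=1+(q-q^{-1})e_ig_i$ with $e_i=\frac1r\sum_{s=0}^{r-1}t_i^st_{i+1}^{-s}$, $X_1X_1^{-1}=X_1^{-1}X_1=1$, $g_1X_1g_1X_1=X_1g_1X_1g_1$, $g_iX_1=X_1g_i$ ($i\ge2$), $t_jX_1=X_1t_j$. Put $X_{i+1}=g_iX_ig_i$. Fix $L\in\mathbb C$ with $e^{L}=q^2$, write $q^{2x}=e^{Lx}$, and fix a set $D\subset\mathbb C$ with $D+\mathbb Z=D$ on which $x\mapsto q^{2x}$ is injective (for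 real $q>1$ one may take $L=\ln(q^2)$ and $D=\mathbb R+i[0,2\pi/\ln(q^2))$). A placed $r$-skew shape $(c,\lambda/\mu)$ with $n$ boxes is an $r$-tuple of skew shapes (each regarded up to translation in the plane), with $n$ boxes in all, together with a function $c$ from its boxes to $D$ such that for any boxes $x,y$ of the same component: if $y$ lies on a diagonal further to the northeast than $x$ and $c(y)-c(x)\in\mathbb Z$, then $c(y)\ge c(x)$; $c(y)=c(x)+1$ iff $y$ lies on the diagonal next to that of $x$ towards the northeast; $c(y)=c(x)$ iff $x,y$ lie on the same diagonal. The module $\widehat Y^{(c,\lambda/\mu)}$ has basis $w_T$, $T$ running over the standard tableaux of shape $\lambda/\mu$; if $T|j$ is the box of $T$ containing $j$ and $p(T|j)$ the index of its component, then $t_jw_T=\zeta_{p(T|j)}w_T$, $X_jw_T=q^{2c(T|j)}w_T$, $g_iw_T=w_{s_iT}$ if $p(T|i)\ne p(T|i+1)$, and otherwise $$g_iw_T=\frac{q^{2c(T|i+1)}(q-q^{-1})}{q^{2c(T|i+1)}-q^{2c(T|i)}}\,w_T+\frac{q^{2c(T|i+1)+1}-q^{2c(T|i)-1}}{q^{2c(T|i+1)}-q^{2c(T|i)}}\,w_{s_iT},$$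 where $w_{s_iT}=0$ if $s_iT$ is not standard. Let $n=k+l$, and let $(a,\theta)$, $(b,\varphi)$ be placed $r$-skew shapes with $k$ and $l$ boxes all of whose components $\theta^{(p)},\varphi^{(p)}$ are non-empty. Let $u_p$ be the last (most northeastern) box of $\theta^{(p)}$ and $v_p$ the first (most southwestern) box of $\varphi^{(p)}$ in the numbering of boxes along diagonals from southwest to northeast, and assume $a(u_p)+1=b(v_p)$ for $1\le p\le r$. Let $\theta^{(p)}*_{\mathrm v}\varphi^{(p)}$ (resp. $\theta^{(p)}*_{\mathrm h}\varphi^{(p)}$) be the skew shape obtained by placing $\theta^{(p)}$ and $\varphi^{(p)}$ so that $v_p$ is immediately above (resp. immediately to the right of) $u_p$. For $w\in\{\mathrm v,\mathrm h\}^r$ let $(\theta*\varphi)_w=(\theta^{(1)}*_{w_1}\varphi^{(1)},\dots,\theta^{(r)}*_{w_r}\varphi^{(r)})$, with the content function $c$ that is $a$ on the boxes of $\theta$ and $b$ on those of $\varphi$; assume that $(c,(\theta*\varphi)_w)$ is again a placed $r$-skew shape for every $w$ (this is automatic if, for each $p$, all contents of $\theta^{(p)}$ lie in one coset of $\mathbb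 Z$ and so do those of $\varphi^{(p)}$). Then the modules $\widehat Y^{(c,(\theta*\varphi)_w)}$ are calibrated (they have a finite basis of simultaneous eigenvectors of all $X_i$, with non-zero eigenvalues, and all $t_i$, with eigenvalues among $\zeta_1,\dots,\zeta_r$) and, in the Grothendieck group of finite dimensional $\widehat Y_{r,n}$-modules, $$\mathrm{Ind}_{\widehat Y_{r,k}\otimes\widehat Y_{r,l}}^{\widehat Y_{r,n}}\bigl(\widehat Y^{(a,\theta)}\otimes\widehat Y^{(b,\varphi)}\bigr)=\sum_{w\in\{\mathrm v,\mathrm h\}^r}\widehat Y^{(c,(\theta*\varphi)_w)};$$ precisely, the induced module has a filtration by submodules of length $2^r$ whose successive quotients are, in some order, the modules $\widehat Y^{(c,(\theta*\varphi)_w)}$, $w\in\{\mathrm v,\mathrm h\}^r$, each exactly once. Here $\widehat Y_{r,k}\otimes\widehat Y_{r,l}$ is mapped to $\widehat Y_{r,n}$ by sending the generators $t_j,g_i,X_1^{\pm1}$ of the first factor to $t_j,g_i,X_1^{\pm1}$ and those of the second factor to $t_{k+j},g_{k+i},X_{k+1}^{\pm1}$. -/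

import Mathlib

namespace AffineYokonumaHecke

open scoped TensorProduct

/-! ### The affine Yokonuma--Hecke algebra -/

/-- The generators `t₁, …, tₙ`, `g₁, …, gₙ₋₁`, `X₁`, `X₁⁻¹`.  Indices start at `0` in the code, so
`g i` is the generator attached to the transposition of the positions `i` and `i + 1`. -/
inductive Gen (n : ℕ) : Type
  | t (i : Fin n)
  | g (i : ℕ) (h : i + 1 < n)
  | X (h : 0 < n)
  | Xinv (h : 0 < n)

/-- `(1 / r) ∑_{s=0}^{r-1} a ^ s b ^ {-s}` for elements with `a ^ r = b ^ r = 1`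
(so that `b ^ {-s} = b ^ {r-s}`). -/
noncomputable def idem (r : ℕ) {A : Type*} [Ring A] [Algebra ℂ A] (a b : A) : A :=
  (1 / (r : ℂ)) • ∑ s ∈ Finset.range r, a ^ s * b ^ (r - s)

/-- The simple transposition `s_i` exchanging the positions `i` and `i + 1`. -/
def sw {n : ℕ} (i : ℕ) (h : i + 1 < n) : Equiv.Perm (Fin n) :=
  Equiv.swap ⟨i, Nat.lt_of_succ_lt h⟩ ⟨i + 1, h⟩

/-- A family of elements of an algebra `A` satisfying the defining relations of the affine
Yokonuma--Hecke algebra. -/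
structure Family (r n : ℕ) (q : ℂ) (A : Type*) [Ring A] [Algebra ℂ A] where
  t : Fin n → A
  g : (i : ℕ) → i + 1 < n → A
  X : 0 < n → A
  Xinv : 0 < n → A
  g_comm : ∀ i j hi hj, i + 2 ≤ j → g i hi * g j hj = g j hj * g i hi
  braid : ∀ i (h : i + 2 < n),
    g i (Nat.lt_of_succ_lt h) * g (i + 1) h * g i (Nat.lt_of_succ_lt h)
      = g (i + 1) h * g i (Nat.lt_of_succ_lt h) * g (i + 1) h
  t_comm : ∀ i j, t i * t j = t j * t i
  g_t : ∀ i h j, g i h * t j = t (sw i h j) * g i h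
  t_pow : ∀ i, t i ^ r = 1
  quad : ∀ i h, g i h * g i h = 1 + (q - q⁻¹) •
    (idem r (t ⟨i, Nat.lt_of_succ_lt h⟩) (t ⟨i + 1, h⟩) * g i h)
  X_Xinv : ∀ h, X h * Xinv h = 1
  Xinv_X : ∀ h, Xinv h * X h = 1
  gXgX : ∀ (h0 : 0 < n) (h : 0 + 1 < n),
    g 0 h * X h0 * g 0 h * X h0 = X h0 * g 0 h * X h0 * g 0 h
  g_X : ∀ i (h0 : 0 < n) (h : i + 1 < n), 1 ≤ i → g i h * X h0 = X h0 * g i h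
  t_X : ∀ j h, t j * X h = X h * t j

/-- The defining relations, inside the free algebra on the generators. -/
inductive Rel (r n : ℕ) (q : ℂ) : FreeAlgebra ℂ (Gen n) → FreeAlgebra ℂ (Gen n) → Prop
  | g_comm (i j hi hj) (hij : i + 2 ≤ j) :
      Rel r n q (.ι ℂ (.g i hi) * .ι ℂ (.g j hj)) (.ι ℂ (.g j hj) * .ι ℂ (.g i hi))
  | braid (i) (h' : i + 1 < n) (h : i + 1 + 1 < n) :
      Rel r n q (.ι ℂ (.g i h') * .ι ℂ (.g (i + 1) h) * .ι ℂ (.g i h'))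
        (.ι ℂ (.g (i + 1) h) * .ι ℂ (.g i h') * .ι ℂ (.g (i + 1) h))
  | t_comm (i j) : Rel r n q (.ι ℂ (.t i) * .ι ℂ (.t j)) (.ι ℂ (.t j) * .ι ℂ (.t i))
  | g_t (i h j) :
      Rel r n q (.ι ℂ (.g i h) * .ι ℂ (.t j)) (.ι ℂ (.t (sw i h j)) * .ι ℂ (.g i h))
  | t_pow (i) : Rel r n q (.ι ℂ (.t i) ^ r) 1
  | quad (i) (h : i + 1 < n) : Rel r n q (.ι ℂ (.g i h) * .ι ℂ (.g i h))
      (1 + (q - q⁻¹) • (idem r (.ι ℂ (.t ⟨i, Nat.lt_of_succ_lt h⟩)) (.ι ℂ (.t ⟨i + 1, h⟩))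
        * .ι ℂ (.g i h)))
  | X_Xinv (h) : Rel r n q (.ι ℂ (.X h) * .ι ℂ (.Xinv h)) 1
  | Xinv_X (h) : Rel r n q (.ι ℂ (.Xinv h) * .ι ℂ (.X h)) 1
  | gXgX (h0 : 0 < n) (h : 0 + 1 < n) :
      Rel r n q (.ι ℂ (.g 0 h) * .ι ℂ (.X h0) * .ι ℂ (.g 0 h) * .ι ℂ (.X h0))
        (.ι ℂ (.X h0) * .ι ℂ (.g 0 h) * .ι ℂ (.X h0) * .ι ℂ (.g 0 h))
  | g_X (i) (h0 : 0 < n) (h : i + 1 < n) (hi : 1 ≤ i) :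
      Rel r n q (.ι ℂ (.g i h) * .ι ℂ (.X h0)) (.ι ℂ (.X h0) * .ι ℂ (.g i h))
  | t_X (j h) : Rel r n q (.ι ℂ (.t j) * .ι ℂ (.X h)) (.ι ℂ (.X h) * .ι ℂ (.t j))

/-- The affine Yokonuma--Hecke algebra `Ŷ_{r,n}(q)` over `ℂ`. -/
def Yhat (r n : ℕ) (q : ℂ) : Type := RingQuot (Rel r n q)

noncomputable instance (r n : ℕ) (q : ℂ) : Ring (Yhat r n q) :=
  inferInstanceAs (Ring (RingQuot (Rel r n q)))

noncomputable instance (r n : ℕ) (q : ℂ) : Algebra ℂ (Yhat r n q) :=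
  inferInstanceAs (Algebra ℂ (RingQuot (Rel r n q)))

theorem map_idem (r : ℕ) {A B : Type*} [Ring A] [Algebra ℂ A] [Ring B] [Algebra ℂ B]
    (f : A →ₐ[ℂ] B) (a b : A) : f (idem r a b) = idem r (f a) (f b) := by
  simp [idem, map_sum]

/-- The quotient map from the free algebra. -/
noncomputable def Yhat.mk (r n : ℕ) (q : ℂ) : FreeAlgebra ℂ (Gen n) →ₐ[ℂ] Yhat r n q :=
  RingQuot.mkAlgHom ℂ (Rel r n q)

theorem Yhat.mk_rel {r n : ℕ} {q : ℂ} {a b : FreeAlgebra ℂ (Gen n)} (h : Rel r n q a b) :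
    Yhat.mk r n q a = Yhat.mk r n q b := RingQuot.mkAlgHom_rel ℂ h

/-- The generators of `Ŷ_{r,n}` inside `Ŷ_{r,n}`. -/
noncomputable def Yhat.gens (r n : ℕ) (q : ℂ) : Family r n q (Yhat r n q) where
  t i := Yhat.mk r n q (.ι ℂ (.t i))
  g i h := Yhat.mk r n q (.ι ℂ (.g i h))
  X h := Yhat.mk r n q (.ι ℂ (.X h))
  Xinv h := Yhat.mk r n q (.ι ℂ (.Xinv h))
  g_comm i j hi hj hij := by simpa using Yhat.mk_rel (Rel.g_comm (r := r) (q := q) i j hi hj hij)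
  braid i h := by
    simpa using Yhat.mk_rel (Rel.braid (r := r) (q := q) i (Nat.lt_of_succ_lt h) h)
  t_comm i j := by simpa using Yhat.mk_rel (Rel.t_comm (r := r) (q := q) i j)
  g_t i h j := by simpa using Yhat.mk_rel (Rel.g_t (r := r) (q := q) i h j)
  t_pow i := by simpa using Yhat.mk_rel (Rel.t_pow (r := r) (q := q) i)
  quad i h := by simpa [map_idem] using Yhat.mk_rel (Rel.quad (r := r) (q := q) i h)
  X_Xinv h := by simpa using Yhat.mk_rel (Rel.X_Xinv (r := r) (q := q) h)
  Xinv_X h := by simpa using Yhat.mk_rel (Rel.Xinv_X (r := r) (q := q) h)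
  gXgX h0 h := by simpa using Yhat.mk_rel (Rel.gXgX (r := r) (q := q) h0 h)
  g_X i h0 h hi := by simpa using Yhat.mk_rel (Rel.g_X (r := r) (q := q) i h0 h hi)
  t_X j h := by simpa using Yhat.mk_rel (Rel.t_X (r := r) (q := q) j h)

namespace Family

variable {r n : ℕ} {q : ℂ} {A : Type*} [Ring A] [Algebra ℂ A] (F : Family r n q A)

/-- The values on the generators. -/
def onGen : Gen n → A
  | .t i => F.t i
  | .g i h => F.g i h
  | .X h => F.X h
  | .Xinv h => F.Xinv h

/-- The algebra homomorphism `Ŷ_{r,n} → A` with prescribed values on the generators. -/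
noncomputable def lift : Yhat r n q →ₐ[ℂ] A :=
  RingQuot.liftAlgHom ℂ ⟨FreeAlgebra.lift ℂ F.onGen, by
    intro a b h
    cases h with
    | g_comm i j hi hj hij => simpa [onGen] using F.g_comm i j hi hj hij
    | braid i h' h => simpa [onGen] using F.braid i h
    | t_comm i j => simpa [onGen] using F.t_comm i j
    | g_t i h j => simpa [onGen] using F.g_t i h j
    | t_pow i => simpa [onGen] using F.t_pow i
    | quad i h => simpa [onGen, map_idem] using F.quad i h
    | X_Xinv h => simpa [onGen] using F.X_Xinv h
    | Xinv_X h => simpa [onGen] using F.Xinv_X h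
    | gXgX h0 h => simpa [onGen] using F.gXgX h0 h
    | g_X i h0 h hi => simpa [onGen] using F.g_X i h0 h hi
    | t_X j h => simpa [onGen] using F.t_X j h⟩

theorem lift_mk (x : FreeAlgebra ℂ (Gen n)) :
    F.lift (Yhat.mk r n q x) = FreeAlgebra.lift ℂ F.onGen x :=
  RingQuot.liftAlgHom_mkAlgHom_apply ℂ _ _ _

@[simp] theorem lift_t (i : Fin n) : F.lift ((Yhat.gens r n q).t i) = F.t i := by
  simp [Yhat.gens, lift_mk, onGen]
@[simp] theorem lift_g (i : ℕ) (h : i + 1 < n) : F.lift ((Yhat.gens r n q).g i h) = F.g i h := by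
  simp [Yhat.gens, lift_mk, onGen]
@[simp] theorem lift_X (h : 0 < n) : F.lift ((Yhat.gens r n q).X h) = F.X h := by
  simp [Yhat.gens, lift_mk, onGen]
@[simp] theorem lift_Xinv (h : 0 < n) : F.lift ((Yhat.gens r n q).Xinv h) = F.Xinv h := by
  simp [Yhat.gens, lift_mk, onGen]

theorem lift_mem (S : Subalgebra ℂ A) (ht : ∀ i, F.t i ∈ S) (hg : ∀ i h, F.g i h ∈ S)
    (hX : ∀ h, F.X h ∈ S) (hXi : ∀ h, F.Xinv h ∈ S) (y : Yhat r n q) : F.lift y ∈ S := by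
  obtain ⟨x, rfl⟩ := RingQuot.mkAlgHom_surjective ℂ (Rel r n q) y
  change F.lift (Yhat.mk r n q x) ∈ S
  rw [lift_mk]
  induction x using FreeAlgebra.induction with
  | grade0 c => simp
  | grade1 x => cases x <;> simp [onGen, *]
  | mul a b ha hb => simpa using S.mul_mem ha hb
  | add a b ha hb => simpa using S.add_mem ha hb

/-- The elements `X₁, …, Xₙ`, where `X_{j+1} = g_j X_j g_j`. -/
def XX : (j : ℕ) → j < n → A
  | 0, h => F.X h
  | j + 1, h => F.g j h * XX j (Nat.lt_of_succ_lt h) * F.g j h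

/-- The inverse `g_i⁻¹ = g_i - (q - q⁻¹) e_i`. -/
noncomputable def ginv (i : ℕ) (h : i + 1 < n) : A :=
  F.g i h - (q - q⁻¹) • idem r (F.t ⟨i, Nat.lt_of_succ_lt h⟩) (F.t ⟨i + 1, h⟩)

/-- The inverses `X₁⁻¹, …, Xₙ⁻¹`. -/
noncomputable def XXinv : (j : ℕ) → j < n → A
  | 0, h => F.Xinv h
  | j + 1, h => F.ginv j h * XXinv j (Nat.lt_of_succ_lt h) * F.ginv j h

theorem idem_g (i : ℕ) (h : i + 1 < n) :
    F.g i h * idem r (F.t ⟨i, Nat.lt_of_succ_lt h⟩) (F.t ⟨i + 1, h⟩)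
      = idem r (F.t ⟨i, Nat.lt_of_succ_lt h⟩) (F.t ⟨i + 1, h⟩) * F.g i h := by
  set a := F.t ⟨i, Nat.lt_of_succ_lt h⟩
  set b := F.t ⟨i + 1, h⟩
  have hab : Commute a b := F.t_comm _ _
  have h1 : SemiconjBy (F.g i h) a b := by
    have := F.g_t i h ⟨i, Nat.lt_of_succ_lt h⟩
    simpa [sw, SemiconjBy] using this
  have h2 : SemiconjBy (F.g i h) b a := by
    have := F.g_t i h ⟨i + 1, h⟩
    simpa [sw, SemiconjBy] using this
  have ha : a ^ r = 1 := F.t_pow _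
  have hb : b ^ r = 1 := F.t_pow _
  have key : ∑ s ∈ Finset.range r, b ^ s * a ^ (r - s)
      = ∑ s ∈ Finset.range r, a ^ s * b ^ (r - s) := by
    rcases r with _ | m
    · simp
    · rw [Finset.sum_range_succ', Finset.sum_range_succ', ← Finset.sum_range_reflect]
      congr 1
      · refine Finset.sum_congr rfl fun s hs => ?_
        have hs' := Finset.mem_range.1 hs
        rw [show m - 1 - s + 1 = m + 1 - (s + 1) by omega,
          show m + 1 - (m + 1 - (s + 1)) = s + 1 by omega]
        exact ((hab.pow_pow _ _).eq).symm
      · simp [ha, hb]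
  have : SemiconjBy (F.g i h) (∑ s ∈ Finset.range r, a ^ s * b ^ (r - s))
      (∑ s ∈ Finset.range r, b ^ s * a ^ (r - s)) := by
    rw [SemiconjBy, Finset.mul_sum, Finset.sum_mul]
    exact Finset.sum_congr rfl fun s _ => ((h1.pow_right s).mul_right (h2.pow_right _)).eq
  rw [key] at this
  simp only [idem, mul_smul_comm, smul_mul_assoc]
  rw [this.eq]

theorem g_ginv (i : ℕ) (h : i + 1 < n) : F.g i h * F.ginv i h = 1 := by
  rw [ginv, mul_sub, F.quad, mul_smul_comm, idem_g]; simp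

theorem ginv_g (i : ℕ) (h : i + 1 < n) : F.ginv i h * F.g i h = 1 := by
  rw [ginv, sub_mul, F.quad, smul_mul_assoc]; simp

theorem XX_XXinv : ∀ (j : ℕ) (h : j < n), F.XX j h * F.XXinv j h = 1
  | 0, h => F.X_Xinv h
  | j + 1, h => by
    have ih := XX_XXinv j (Nat.lt_of_succ_lt h)
    rw [XX, XXinv]
    calc _ = F.g j h * (F.XX j _ * (F.g j h * F.ginv j h) * F.XXinv j _) * F.ginv j h := by
          simp only [mul_assoc]
      _ = 1 := by rw [g_ginv, mul_one, ih, mul_one, g_ginv]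

theorem XXinv_XX : ∀ (j : ℕ) (h : j < n), F.XXinv j h * F.XX j h = 1
  | 0, h => F.Xinv_X h
  | j + 1, h => by
    have ih := XXinv_XX j (Nat.lt_of_succ_lt h)
    rw [XX, XXinv]
    calc _ = F.ginv j h * (F.XXinv j _ * (F.ginv j h * F.g j h) * F.XX j _) * F.g j h := by
          simp only [mul_assoc]
      _ = 1 := by rw [ginv_g, mul_one, ih, mul_one, ginv_g]

theorem t_XX : ∀ (j : ℕ) (h : j < n) (a : Fin n), Commute (F.t a) (F.XX j h)
  | 0, h, a => F.t_X a h
  | j + 1, h, a => by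
    have h1 : SemiconjBy (F.g j h) (F.t a) (F.t (sw j h a)) := F.g_t j h a
    have h2 : SemiconjBy (F.g j h) (F.t (sw j h a)) (F.t a) := by
      have := F.g_t j h (sw j h a)
      simpa [sw, SemiconjBy] using this
    have h3 : SemiconjBy (F.XX j (Nat.lt_of_succ_lt h)) (F.t (sw j h a)) (F.t (sw j h a)) :=
      (t_XX j _ _).symm
    exact ((h2.mul_left h3).mul_left h1 : SemiconjBy _ _ _).symm

theorem gg (i j : ℕ) (hi : i + 1 < n) (hj : j + 1 < n) (hij : i + 2 ≤ j ∨ j + 2 ≤ i) :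
    Commute (F.g i hi) (F.g j hj) := by
  rcases hij with h | h
  · exact F.g_comm _ _ _ _ h
  · exact (F.g_comm _ _ _ _ h).symm

theorem g_XX_gt : ∀ (j : ℕ) (h : j < n) (i : ℕ) (hi : i + 1 < n), j < i →
    Commute (F.g i hi) (F.XX j h)
  | 0, h, i, hi, hij => F.g_X i h hi hij
  | j + 1, h, i, hi, hij => by
    have h1 := F.gg i j hi h (by omega)
    exact (h1.mul_right (g_XX_gt j _ i hi (by omega))).mul_right h1

theorem g_XX_lt : ∀ (j : ℕ) (h : j < n) (i : ℕ) (hi : i + 1 < n), i + 1 < j →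
    Commute (F.g i hi) (F.XX j h)
  | 0, h, i, hi, hij => by omega
  | 1, h, i, hi, hij => by omega
  | j + 2, h, i, hi, hij => by
    rcases Nat.lt_or_ge i j with hlt | hge
    · have h1 := F.gg i (j + 1) hi h (by omega)
      exact (h1.mul_right (g_XX_lt (j + 1) _ i hi (by omega))).mul_right h1
    · obtain rfl : i = j := by omega
      rw [XX, XX]
      set a := F.g i hi
      set b := F.g (i + 1) h
      set x := F.XX i _
      have hb : a * b * a = b * a * b := F.braid i h
      have hx : b * x = x * b := (F.g_XX_gt i _ (i + 1) h (by omega)).eq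
      change a * (b * (a * x * a) * b) = b * (a * x * a) * b * a
      calc a * (b * (a * x * a) * b) = (a * b * a) * x * a * b := by noncomm_ring
        _ = b * a * (b * x) * a * b := by rw [hb]; noncomm_ring
        _ = b * a * x * (b * a * b) := by rw [hx]; noncomm_ring
        _ = b * (a * x * a) * b * a := by rw [← hb]; noncomm_ring

theorem gXX : ∀ (j : ℕ) (h : j + 1 < n),
    F.g j h * F.XX j (Nat.lt_of_succ_lt h) * F.g j h * F.XX j (Nat.lt_of_succ_lt h)
      = F.XX j (Nat.lt_of_succ_lt h) * F.g j h * F.XX j (Nat.lt_of_succ_lt h) * F.g j h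
  | 0, h => F.gXgX _ h
  | j + 1, h => by
    have ih := gXX j (Nat.lt_of_succ_lt h)
    have hx : F.g (j + 1) h * F.XX j (Nat.lt_of_succ_lt (Nat.lt_of_succ_lt h))
      = F.XX j (Nat.lt_of_succ_lt (Nat.lt_of_succ_lt h)) * F.g (j + 1) h :=
      (F.g_XX_gt j _ (j + 1) h (by omega)).eq
    have hb : F.g j (Nat.lt_of_succ_lt h) * F.g (j + 1) h * F.g j (Nat.lt_of_succ_lt h)
      = F.g (j + 1) h * F.g j (Nat.lt_of_succ_lt h) * F.g (j + 1) h := F.braid j h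
    rw [XX]
    generalize F.g j (Nat.lt_of_succ_lt h) = a at *
    generalize F.g (j + 1) h = b at *
    generalize F.XX j (Nat.lt_of_succ_lt (Nat.lt_of_succ_lt h)) = x at *
    calc b * (a * x * a) * b * (a * x * a) = b * a * x * (a * b * a) * x * a := by simp only [mul_assoc]
      _ = b * a * (x * b) * a * (b * x) * a := by rw [hb]; noncomm_ring
      _ = (b * a * b) * x * a * x * (b * a) := by rw [← hx]; nth_rewrite 2 [hx]; noncomm_ring
      _ = a * b * (a * x * a * x) * b * a := by rw [← hb]; noncomm_ring
      _ = a * (b * x) * a * (x * (a * b * a)) := by rw [ih]; noncomm_ring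
      _ = a * x * b * a * (x * b) * a * b := by rw [hx, hb]; noncomm_ring
      _ = a * x * (b * a * b) * x * a * b := by rw [← hx]; noncomm_ring
      _ = (a * x * a) * b * (a * x * a) * b := by rw [← hb]; noncomm_ring

theorem X_XX : ∀ (j : ℕ) (h : j < n) (h0 : 0 < n), Commute (F.X h0) (F.XX j h)
  | 0, h, h0 => Commute.refl _
  | 1, h, h0 => by
    have := F.gXX 0 h
    simp only [XX] at this ⊢
    change _ * _ = _ * _
    simpa only [mul_assoc] using this.symm
  | j + 2, h, h0 => by
    have h1 : Commute (F.X h0) (F.g (j + 1) h) := (F.g_X (j + 1) h0 h (by omega)).symm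
    exact (h1.mul_right (X_XX (j + 1) _ h0)).mul_right h1

/-- The first `k` strands. -/
def left {k l : ℕ} (F : Family r (k + l) q A) : Family r k q A where
  t i := F.t (Fin.castAdd l i)
  g i h := F.g i (by omega)
  X h := F.X (by omega)
  Xinv h := F.Xinv (by omega)
  g_comm i j _ _ hij := F.g_comm i j _ _ hij
  braid i _ := F.braid i _
  t_comm _ _ := F.t_comm _ _
  g_t i h j := by
    rw [F.g_t]
    congr 2
    simp only [sw, Equiv.swap_apply_def, Fin.ext_iff, Fin.val_castAdd]
    split_ifs <;> simp
  t_pow _ := F.t_pow _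
  quad i h := F.quad i (by omega)
  X_Xinv _ := F.X_Xinv _
  Xinv_X _ := F.Xinv_X _
  gXgX _ h := F.gXgX (by omega) (by omega)
  g_X i _ _ hi := F.g_X i _ _ hi
  t_X _ _ := F.t_X _ _

/-- The last `l` strands; the role of `X₁` is played by `X_{k+1}`. -/
noncomputable def right {k l : ℕ} (F : Family r (k + l) q A) : Family r l q A where
  t i := F.t (Fin.natAdd k i)
  g i h := F.g (k + i) (by omega)
  X h := F.XX k (by omega)
  Xinv h := F.XXinv k (by omega)
  g_comm i j _ _ hij := F.g_comm _ _ _ _ (by omega)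
  braid i _ := F.braid (k + i) (by omega)
  t_comm _ _ := F.t_comm _ _
  g_t i h j := by
    rw [F.g_t]
    congr 2
    simp only [sw, Equiv.swap_apply_def, Fin.ext_iff, Fin.val_natAdd]
    split_ifs <;> first | omega | (simp; done) | (simp; omega)
  t_pow _ := F.t_pow _
  quad i h := F.quad (k + i) (by omega)
  X_Xinv _ := F.XX_XXinv _ _
  Xinv_X _ := F.XXinv_XX _ _
  gXgX _ h := F.gXX k (by omega)
  g_X i _ _ hi := (F.g_XX_gt k _ (k + i) _ (by omega)).eq
  t_X _ _ := (F.t_XX _ _ _).eq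

theorem commute_XXinv (j : ℕ) (h : j < n) {a : A} (ha : Commute a (F.XX j h)) :
    Commute a (F.XXinv j h) := by
  calc a * F.XXinv j h = F.XXinv j h * F.XX j h * a * F.XXinv j h := by rw [XXinv_XX, one_mul]
    _ = F.XXinv j h * a * (F.XX j h * F.XXinv j h) := by
        rw [mul_assoc (F.XXinv j h), ← ha.eq]; noncomm_ring
    _ = F.XXinv j h * a := by rw [XX_XXinv, mul_one]

theorem left_right_commute {k l : ℕ} (F : Family r (k + l) q A)
    (x : Yhat r k q) (y : Yhat r l q) : Commute (F.left.lift x) (F.right.lift y) := by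
  have key : ∀ b : A, (∀ i, Commute (F.left.t i) b) → (∀ i h, Commute (F.left.g i h) b) →
      (∀ h, Commute (F.left.X h) b) → ∀ x, Commute (F.left.lift x) b := by
    intro b h1 h2 h3 x
    have h := F.left.lift_mem (Subalgebra.centralizer ℂ {b})
      (fun i => by simpa [Subalgebra.mem_centralizer_iff] using (h1 i).eq.symm)
      (fun i h => by simpa [Subalgebra.mem_centralizer_iff] using (h2 i h).eq.symm)
      (fun h => by simpa [Subalgebra.mem_centralizer_iff] using (h3 h).eq.symm)
      (fun h => by
        have := (F.commute_XXinv 0 (by omega) (h3 h).symm).eq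
        rw [Subalgebra.mem_centralizer_iff]
        rintro _ rfl
        exact this) x
    exact (Subalgebra.mem_centralizer_iff ℂ |>.1 h b rfl).symm
  have hX : ∀ h, ∀ x, Commute (F.left.lift x) (F.right.X h) := fun h => key _
    (fun i => F.t_XX _ _ _)
    (fun i hi => by
      rcases Nat.lt_or_ge (i + 1) k with hlt | hge
      · exact F.g_XX_lt k _ i _ hlt
      · omega)
    (fun h' => F.X_XX _ _ _)
  have h := F.right.lift_mem (Subalgebra.centralizer ℂ {F.left.lift x})
    (fun i => by
      have := key (F.right.t i) (fun _ => F.t_comm _ _) (fun j h => by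
        have := F.g_t j (by omega) (Fin.natAdd k i)
        rw [show sw j (by omega) (Fin.natAdd k i) = Fin.natAdd k i by
          apply Equiv.swap_apply_of_ne_of_ne <;> simp [Fin.ext_iff] <;> omega] at this
        exact this) (fun h => (F.t_X _ _).symm) x
      simpa [Subalgebra.mem_centralizer_iff] using this.eq)
    (fun i h => by
      have := key (F.right.g i h) (fun j => by
        have := F.g_t (k + i) (by omega) (Fin.castAdd l j)
        rw [show sw (k + i) (by omega) (Fin.castAdd l j) = Fin.castAdd l j by
          apply Equiv.swap_apply_of_ne_of_ne <;> simp [Fin.ext_iff] <;> omega] at this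
        exact this.symm)
        (fun j hj => F.gg _ _ _ _ (by omega))
        (fun h' => (F.g_X _ _ _ (by omega)).symm) x
      simpa [Subalgebra.mem_centralizer_iff] using this.eq)
    (fun h => by simpa [Subalgebra.mem_centralizer_iff] using (hX h x).eq)
    (fun h => by
      have := (F.commute_XXinv k (by omega) (hX h x)).eq
      rw [Subalgebra.mem_centralizer_iff]
      rintro _ rfl
      exact this) y
  exact Subalgebra.mem_centralizer_iff ℂ |>.1 h _ rfl

end Family

/-- The homomorphism `Ŷ_{r,k} ⊗ Ŷ_{r,l} → Ŷ_{r,k+l}`: the first factor is generated by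
`g₁, …, g_{k-1}`, `X₁, …, X_k`, `t₁, …, t_k`, the second one by `g_{k+1}, …, g_{n-1}`,
`X_{k+1}, …, X_n`, `t_{k+1}, …, t_n`. -/
noncomputable def parabolic (r k l : ℕ) (q : ℂ) :
    Yhat r k q ⊗[ℂ] Yhat r l q →ₐ[ℂ] Yhat r (k + l) q :=
  Algebra.TensorProduct.lift (Yhat.gens r (k + l) q).left.lift (Yhat.gens r (k + l) q).right.lift
    (Yhat.gens r (k + l) q).left_right_commute


/-! ### Placed skew shapes and standard tableaux -/

/-- The contents are taken in a set `carrier ⊆ ℂ` that is stable under integer translations and on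
which `x ↦ q^{2x} = exp (x log q²)` is injective; `logq2` is the chosen value of `log q²`. -/
structure ContentDomain (q : ℂ) where
  logq2 : ℂ
  exp_logq2 : Complex.exp logq2 = q ^ 2
  carrier : Set ℂ
  add_int : ∀ x ∈ carrier, ∀ m : ℤ, x + m ∈ carrier
  injOn : Set.InjOn (fun x => Complex.exp (logq2 * x)) carrier

namespace ContentDomain

variable {q : ℂ} (C : ContentDomain q)

/-- `q^{2x}`. -/
noncomputable def qpow (x : ℂ) : ℂ := Complex.exp (C.logq2 * x)

/-- For real `q > 1`: the strip `ℝ + i[0, 2π / ln(q²))` with the real logarithm of `q²`. -/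
noncomputable def strip (q : ℝ) (hq : 1 < q) : ContentDomain (q : ℂ) where
  logq2 := (Real.log (q ^ 2) : ℂ)
  exp_logq2 := by
    rw [← Complex.ofReal_exp, Real.exp_log (by positivity)]
    push_cast
    rfl
  carrier := {x | 0 ≤ x.im ∧ x.im < 2 * Real.pi / Real.log (q ^ 2)}
  add_int := by
    intro x hx m
    simpa using hx
  injOn := by
    have hL : 0 < Real.log (q ^ 2) := Real.log_pos (by nlinarith)
    intro x hx y hy hxy
    obtain ⟨m, hm⟩ := Complex.exp_eq_exp_iff_exists_int.1 hxy
    have him := congrArg Complex.im hm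
    have hre := congrArg Complex.re hm
    simp at him hre
    obtain ⟨hx0, hx1⟩ := hx
    obtain ⟨hy0, hy1⟩ := hy
    rw [lt_div_iff₀ hL] at hx1 hy1
    have hpi := Real.pi_pos
    rw [Real.log_pow] at hx1 hy1 hL
    push_cast at hx1 hy1 hL
    have hlq : 0 < Real.log q := by linarith
    have h1 : (m : ℝ) < 1 := by
      by_contra hcon
      have : (1 : ℝ) ≤ m := not_lt.1 hcon
      nlinarith [mul_nonneg hy0 hlq.le, mul_nonneg hx0 hlq.le]
    have h2 : (-1 : ℝ) < m := by
      by_contra hcon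
      have : (m : ℝ) ≤ -1 := not_lt.1 hcon
      nlinarith [mul_nonneg hy0 hlq.le, mul_nonneg hx0 hlq.le]
    have h3 : m = 0 := by
      have h1' : m < 1 := by exact_mod_cast h1
      have h2' : -1 < m := by exact_mod_cast h2
      omega
    subst h3
    simp at him hre
    have hne : q ≠ 0 := by linarith
    apply Complex.ext
    · rcases hre with h | h
      · exact h
      · rcases h with h | h | h <;> linarith
    · rcases him with h | h
      · exact h
      · rcases h with h | h | h <;> linarith

end ContentDomain

/-- The diagonal `column - row` of a box `(row, column)`; rows are numbered downwards. -/
def diag (x : ℤ × ℤ) : ℤ := x.2 - x.1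

/-- A finite set of boxes is a skew shape if it is a translate of `λ/μ` for some Young diagrams
`μ ⊆ λ`. -/
def IsSkewShape (S : Finset (ℤ × ℤ)) : Prop :=
  ∃ (lam mu : YoungDiagram) (d : ℤ × ℤ), mu ≤ lam ∧
    S = (lam.cells \ mu.cells).image fun b : ℕ × ℕ => ((b.1 : ℤ) + d.1, (b.2 : ℤ) + d.2)

theorem IsSkewShape.mem_of_le {S : Finset (ℤ × ℤ)} (hS : IsSkewShape S) {x y z : ℤ × ℤ}
    (hx : x ∈ S) (hz : z ∈ S) (h1 : x ≤ y) (h2 : y ≤ z) : y ∈ S := by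
  obtain ⟨lam, mu, d, -, rfl⟩ := hS
  simp only [Finset.mem_image, Finset.mem_sdiff] at hx hz ⊢
  obtain ⟨a, ⟨ha1, ha2⟩, rfl⟩ := hx
  obtain ⟨c, ⟨hc1, hc2⟩, rfl⟩ := hz
  obtain ⟨h11, h12⟩ := h1
  obtain ⟨h21, h22⟩ := h2
  simp only at h11 h12 h21 h22
  refine ⟨((y.1 - d.1).toNat, (y.2 - d.2).toNat), ⟨?_, ?_⟩, ?_⟩
  · exact lam.isLowerSet (a := c) ⟨by simp only; omega, by simp only; omega⟩ hc1
  · exact fun h => ha2 (mu.isLowerSet (b := a) ⟨by simp only; omega, by simp only; omega⟩ h)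
  · ext <;> simp only <;> omega

theorem isSkewShape_of_mem_of_le {S : Finset (ℤ × ℤ)}
    (h : ∀ x ∈ S, ∀ z ∈ S, ∀ y, x ≤ y → y ≤ z → y ∈ S) : IsSkewShape S := by
  classical
  obtain ⟨d1, hd1⟩ : ∃ d, ∀ x ∈ S, d ≤ x.1 := by
    obtain ⟨d, hd⟩ := (S.image Prod.fst).bddBelow
    exact ⟨d, fun x hx => hd (by simpa using ⟨x.2, hx⟩)⟩
  obtain ⟨d2, hd2⟩ : ∃ d, ∀ x ∈ S, d ≤ x.2 := by
    obtain ⟨d, hd⟩ := (S.image Prod.snd).bddBelow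
    exact ⟨d, fun x hx => hd (by simpa using ⟨x.1, hx⟩)⟩
  let L : Finset (ℕ × ℕ) := S.biUnion fun z =>
    Finset.range ((z.1 - d1).toNat + 1) ×ˢ Finset.range ((z.2 - d2).toNat + 1)
  have hL : ∀ b : ℕ × ℕ, b ∈ L ↔ ∃ z ∈ S, (b.1 : ℤ) + d1 ≤ z.1 ∧ (b.2 : ℤ) + d2 ≤ z.2 := by
    intro b
    simp only [L, Finset.mem_biUnion, Finset.mem_product, Finset.mem_range]
    refine exists_congr fun z => and_congr_right fun hz => ?_
    have := hd1 z hz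
    have := hd2 z hz
    omega
  let U : Finset (ℕ × ℕ) := L.filter fun b => ((b.1 : ℤ) + d1, (b.2 : ℤ) + d2) ∉ S
  refine ⟨⟨L, ?_⟩, ⟨U, ?_⟩, (d1, d2), ?_, ?_⟩
  · intro a b hba ha
    obtain ⟨z, hz, h1, h2⟩ := (hL a).1 ha
    have hb1 : b.1 ≤ a.1 := hba.1
    have hb2 : b.2 ≤ a.2 := hba.2
    exact (hL b).2 ⟨z, hz, by omega, by omega⟩
  · intro a b hba ha
    have ha' := Finset.mem_filter.1 (Finset.mem_coe.1 ha)
    obtain ⟨z, hz, h1, h2⟩ := (hL a).1 ha'.1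
    have hb1 : b.1 ≤ a.1 := hba.1
    have hb2 : b.2 ≤ a.2 := hba.2
    refine Finset.mem_coe.2 (Finset.mem_filter.2 ⟨(hL b).2 ⟨z, hz, by omega, by omega⟩, ?_⟩)
    intro hb
    exact ha'.2 (h _ hb z hz _ ⟨by simp only; omega, by simp only; omega⟩ ⟨h1, h2⟩)
  · exact Finset.filter_subset _ _
  · ext x
    simp only [Finset.mem_image, Finset.mem_sdiff, U, Finset.mem_filter, not_and, not_not]
    constructor
    · intro hx
      have h1 := hd1 x hx
      have h2 := hd2 x hx
      refine ⟨((x.1 - d1).toNat, (x.2 - d2).toNat), ⟨?_, fun _ => ?_⟩, ?_⟩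
      · exact (hL _).2 ⟨x, hx, by simp only; omega, by simp only; omega⟩
      · convert hx using 1
        ext <;> simp only <;> omega
      · ext <;> simp only <;> omega
    · rintro ⟨b, ⟨hb, hb'⟩, rfl⟩
      exact hb' hb

/-- `c` is a content function on the boxes of the skew shape `S` (its values elsewhere are
irrelevant).  If one box lies on a diagonal further to the northeast than another one, then it has
the larger label in the numbering of the boxes along diagonals from southwest to northeast; two
boxes on the same diagonal have equal contents, by `eq_iff`. -/
structure IsContent {q : ℂ} (C : ContentDomain q) (S : Finset (ℤ × ℤ)) (c : ℤ × ℤ → ℂ) : Prop where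
  mem : ∀ x ∈ S, c x ∈ C.carrier
  mono : ∀ x ∈ S, ∀ y ∈ S, diag x < diag y → ∀ m : ℤ, c y - c x = m → 0 ≤ m
  adj_iff : ∀ x ∈ S, ∀ y ∈ S, (c y = c x + 1 ↔ diag y = diag x + 1)
  eq_iff : ∀ x ∈ S, ∀ y ∈ S, (c y = c x ↔ diag y = diag x)

/-- A placed `r`-skew shape with `n` boxes: an `r`-tuple of skew shapes, each with a content
function. -/
structure PlacedShape {q : ℂ} (C : ContentDomain q) (r n : ℕ) where
  shape : Fin r → Finset (ℤ × ℤ)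
  isSkew : ∀ p, IsSkewShape (shape p)
  card : ∑ p, (shape p).card = n
  content : Fin r → ℤ × ℤ → ℂ
  isContent : ∀ p, IsContent C (shape p) (content p)

namespace PlacedShape

variable {q : ℂ} {C : ContentDomain q} {r n : ℕ} (P : PlacedShape C r n)

/-- The boxes of all components. -/
abbrev Box : Type := {b : Fin r × (ℤ × ℤ) // b.2 ∈ P.shape b.1}

/-- The component containing a box. -/
def comp (x : P.Box) : Fin r := x.1.1

/-- `q^{2 c(x)}` for a box `x`. -/
noncomputable def val (x : P.Box) : ℂ := C.qpow (P.content x.1.1 x.1.2)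

/-- `x` precedes `y` in a row (from left to right) or in a column (from top to bottom). -/
def Before (x y : P.Box) : Prop :=
  x.1.1 = y.1.1 ∧ ((x.1.2.1 = y.1.2.1 ∧ x.1.2.2 < y.1.2.2) ∨
    (x.1.2.2 = y.1.2.2 ∧ x.1.2.1 < y.1.2.1))

/-- A labelling of the boxes by `n` labels (numbered from `0` in the code) is standard if the labels
increase along the rows and down the columns. -/
def IsStd (T : P.Box ≃ Fin n) : Prop := ∀ x y, P.Before x y → T x < T y

/-- The standard tableaux. -/
abbrev Std : Type := {T : P.Box ≃ Fin n // P.IsStd T}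

/-- The tableau `s_i T`. -/
def act (i : ℕ) (h : i + 1 < n) (T : P.Box ≃ Fin n) : P.Box ≃ Fin n := T.trans (sw i h)

open Classical in
/-- The basis vector `w_T`, with `w_T = 0` if the labelling `T` is not standard. -/
noncomputable def w (T : P.Box ≃ Fin n) : P.Std →₀ ℂ :=
  if h : P.IsStd T then Finsupp.single ⟨T, h⟩ 1 else 0

/-- The coefficient of `w_T` in `g_i w_T`, for `x` and `y` the boxes of `T` containing `i` and
`i + 1`. -/
noncomputable def cA (x y : P.Box) : ℂ :=
  if P.comp x = P.comp y then P.val y * (q - q⁻¹) / (P.val y - P.val x) else 0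

/-- The coefficient of `w_{s_i T}` in `g_i w_T`. -/
noncomputable def cB (x y : P.Box) : ℂ :=
  if P.comp x = P.comp y then (q * P.val y - q⁻¹ * P.val x) / (P.val y - P.val x) else 1

/-- The operator `w_T ↦ ζ_{p(T|j)} w_T`, where `ζ_p` is `ζ ^ p` for `p = 0, …, r - 1`. -/
noncomputable def tOp (ζ : ℂ) (j : Fin n) : Module.End ℂ (P.Std →₀ ℂ) :=
  Finsupp.linearCombination ℂ fun T => ζ ^ (P.comp (T.1.symm j) : ℕ) • P.w T.1

/-- The operator `w_T ↦ q^{2 c(T|j)} w_T`. -/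
noncomputable def xOp (j : Fin n) : Module.End ℂ (P.Std →₀ ℂ) :=
  Finsupp.linearCombination ℂ fun T => P.val (T.1.symm j) • P.w T.1

/-- The operator `w_T ↦ q^{-2 c(T|j)} w_T`. -/
noncomputable def xinvOp (j : Fin n) : Module.End ℂ (P.Std →₀ ℂ) :=
  Finsupp.linearCombination ℂ fun T => (P.val (T.1.symm j))⁻¹ • P.w T.1

/-- The operator by which `g_i` acts. -/
noncomputable def gOp (i : ℕ) (h : i + 1 < n) : Module.End ℂ (P.Std →₀ ℂ) :=
  Finsupp.linearCombination ℂ fun T =>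
    P.cA (T.1.symm ⟨i, Nat.lt_of_succ_lt h⟩) (T.1.symm ⟨i + 1, h⟩) • P.w T.1 +
    P.cB (T.1.symm ⟨i, Nat.lt_of_succ_lt h⟩) (T.1.symm ⟨i + 1, h⟩) • P.w (P.act i h T.1)

theorem w_of_std {T : P.Box ≃ Fin n} (h : P.IsStd T) : P.w T = Finsupp.single ⟨T, h⟩ 1 :=
  dif_pos h

theorem w_of_not {T : P.Box ≃ Fin n} (h : ¬ P.IsStd T) : P.w T = 0 := dif_neg h

theorem end_ext {f g : Module.End ℂ (P.Std →₀ ℂ)}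
    (h : ∀ T, P.IsStd T → f (P.w T) = g (P.w T)) : f = g := by
  refine Finsupp.lhom_ext' fun T => LinearMap.ext_ring ?_
  have := h T.1 T.2
  rw [P.w_of_std T.2] at this
  exact this

theorem tOp_w (ζ : ℂ) (j : Fin n) (T) :
    P.tOp ζ j (P.w T) = ζ ^ (P.comp (T.symm j) : ℕ) • P.w T := by
  by_cases h : P.IsStd T
  · conv_lhs => rw [P.w_of_std h, tOp, Finsupp.linearCombination_single, one_smul]
  · simp [P.w_of_not h]

theorem xOp_w (j : Fin n) (T) : P.xOp j (P.w T) = P.val (T.symm j) • P.w T := by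
  by_cases h : P.IsStd T
  · conv_lhs => rw [P.w_of_std h, xOp, Finsupp.linearCombination_single, one_smul]
  · simp [P.w_of_not h]

theorem xinvOp_w (j : Fin n) (T) : P.xinvOp j (P.w T) = (P.val (T.symm j))⁻¹ • P.w T := by
  by_cases h : P.IsStd T
  · conv_lhs => rw [P.w_of_std h, xinvOp, Finsupp.linearCombination_single, one_smul]
  · simp [P.w_of_not h]

theorem gOp_w (i : ℕ) (h : i + 1 < n) {T} (hT : P.IsStd T) : P.gOp i h (P.w T) =
    P.cA (T.symm ⟨i, Nat.lt_of_succ_lt h⟩) (T.symm ⟨i + 1, h⟩) • P.w T +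
    P.cB (T.symm ⟨i, Nat.lt_of_succ_lt h⟩) (T.symm ⟨i + 1, h⟩) • P.w (P.act i h T) := by
  conv_lhs => rw [P.w_of_std hT, gOp, Finsupp.linearCombination_single, one_smul]

theorem val_ne_zero (x : P.Box) : P.val x ≠ 0 := Complex.exp_ne_zero _

theorem q_ne_zero (C : ContentDomain q) : q ≠ 0 := by
  rintro rfl
  exact Complex.exp_ne_zero _ (C.exp_logq2.trans (by simp))

theorem Before.trans_val {x y : P.Box} (hxy : P.comp x = P.comp y)
    (h : diag y.1.2 = diag x.1.2 + 1) : P.val y = q ^ 2 * P.val x := by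
  obtain ⟨⟨p, x⟩, hx⟩ := x
  obtain ⟨⟨p', y⟩, hy⟩ := y
  obtain rfl : p = p' := hxy
  have := ((P.isContent p).adj_iff x hx y hy).2 h
  simp only [val, ContentDomain.qpow]
  rw [this, mul_add, mul_one, Complex.exp_add, C.exp_logq2, mul_comm]

theorem diag_eq_of_val_eq {x y : P.Box} (hxy : P.comp x = P.comp y) (h : P.val x = P.val y) :
    diag x.1.2 = diag y.1.2 := by
  obtain ⟨⟨p, x⟩, hx⟩ := x
  obtain ⟨⟨p', y⟩, hy⟩ := y
  obtain rfl : p = p' := hxy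
  have hc := (P.isContent p)
  exact (hc.eq_iff y hy x hx).1 (C.injOn (hc.mem x hx) (hc.mem y hy) h)

theorem far_of_diag_eq {T : P.Box ≃ Fin n} (hT : P.IsStd T) {x y : P.Box}
    (hxy : P.comp x = P.comp y) (hne : x ≠ y) (h : diag x.1.2 = diag y.1.2) :
    (T x : ℕ) + 3 ≤ T y ∨ (T y : ℕ) + 3 ≤ T x := by
  have key : ∀ x y : P.Box, P.comp x = P.comp y → x.1.2.1 < y.1.2.1 → diag x.1.2 = diag y.1.2 →
      (T x : ℕ) + 3 ≤ T y := by
    intro x y hxy hlt h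
    have hle : x.1.2.2 < y.1.2.2 := by simp only [diag] at h; omega
    have hy' : y.1.2 ∈ P.shape x.1.1 := by rw [show x.1.1 = y.1.1 from hxy]; exact y.2
    let u : P.Box := ⟨(x.1.1, (x.1.2.1, y.1.2.2)), (P.isSkew _).mem_of_le x.2 hy'
      ⟨le_rfl, hle.le⟩ ⟨hlt.le, le_rfl⟩⟩
    let v : P.Box := ⟨(x.1.1, (y.1.2.1, x.1.2.2)), (P.isSkew _).mem_of_le x.2 hy'
      ⟨hlt.le, le_rfl⟩ ⟨le_rfl, hle.le⟩⟩
    have h1 : T x < T u := hT _ _ ⟨rfl, Or.inl ⟨rfl, hle⟩⟩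
    have h2 : T x < T v := hT _ _ ⟨rfl, Or.inr ⟨rfl, hlt⟩⟩
    have h3 : T u < T y := hT _ _ ⟨hxy, Or.inr ⟨rfl, hlt⟩⟩
    have h4 : T v < T y := hT _ _ ⟨hxy, Or.inl ⟨rfl, hle⟩⟩
    have h5 : T u ≠ T v := by
      intro h
      have h' := congrArg (fun b : P.Box => b.1.2.1) (T.injective h)
      simp only [u, v] at h'
      omega
    rw [Fin.lt_def] at h1 h2 h3 h4
    rw [Ne, Fin.ext_iff] at h5
    omega
  rcases lt_trichotomy x.1.2.1 y.1.2.1 with hlt | heq | hlt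
  · exact Or.inl (key x y hxy hlt h)
  · exfalso
    apply hne
    apply Subtype.ext
    apply Prod.ext hxy
    apply Prod.ext heq
    simp only [diag] at h
    omega
  · exact Or.inr (key y x hxy.symm hlt h.symm)

theorem val_ne {T : P.Box ≃ Fin n} (hT : P.IsStd T) {x y : P.Box}
    (hxy : P.comp x = P.comp y) (hne : x ≠ y) (h1 : (T x : ℕ) < T y + 3) (h2 : (T y : ℕ) < T x + 3) :
    P.val x ≠ P.val y := fun h => by
  rcases P.far_of_diag_eq hT hxy hne (P.diag_eq_of_val_eq hxy h) with h | h <;> omega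

theorem val_symm_ne {T : P.Box ≃ Fin n} (hT : P.IsStd T) {i j : Fin n}
    (hxy : P.comp (T.symm i) = P.comp (T.symm j)) (hne : i ≠ j)
    (h1 : (i : ℕ) < j + 3) (h2 : (j : ℕ) < i + 3) : P.val (T.symm i) ≠ P.val (T.symm j) :=
  P.val_ne hT hxy (by simpa using hne) (by simpa using h1) (by simpa using h2)

theorem before_of_not {T : P.Box ≃ Fin n} (hT : P.IsStd T) {i : ℕ} {h : i + 1 < n}
    (hs : ¬ P.IsStd (P.act i h T)) :
    P.Before (T.symm ⟨i, Nat.lt_of_succ_lt h⟩) (T.symm ⟨i + 1, h⟩) := by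
  simp only [IsStd, not_forall] at hs
  obtain ⟨x, y, hxy, hn⟩ := hs
  have h1 := hT x y hxy
  have : T x = ⟨i, Nat.lt_of_succ_lt h⟩ ∧ T y = ⟨i + 1, h⟩ := by
    simp only [act, Equiv.trans_apply, sw, Equiv.swap_apply_def, Fin.ext_iff, Fin.lt_def] at hn h1 ⊢
    split_ifs at hn <;> simp at hn <;> omega
  rw [← this.1, ← this.2]
  simpa using hxy

theorem cB_mul_cB {T : P.Box ≃ Fin n} (hT : P.IsStd T) {i : ℕ} {h : i + 1 < n}
    (hs : ¬ P.IsStd (P.act i h T)) :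
    P.cB (T.symm ⟨i, Nat.lt_of_succ_lt h⟩) (T.symm ⟨i + 1, h⟩) *
      P.cB (T.symm ⟨i + 1, h⟩) (T.symm ⟨i, Nat.lt_of_succ_lt h⟩) = 0 := by
  have hb := P.before_of_not hT hs
  have hq := q_ne_zero C
  set x := T.symm ⟨i, Nat.lt_of_succ_lt h⟩ with hx
  set y := T.symm ⟨i + 1, h⟩ with hy
  have hTx : T x = ⟨i, Nat.lt_of_succ_lt h⟩ := by simp [hx]
  have hTy : T y = ⟨i + 1, h⟩ := by simp [hy]
  have hcomp : P.comp x = P.comp y := hb.1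
  have hy' : y.1.2 ∈ P.shape x.1.1 := by rw [show x.1.1 = y.1.1 from hcomp]; exact y.2
  have hno : ∀ z : P.Box, T x < T z → T z < T y → False := by
    intro z h1 h2
    rw [hTx, Fin.lt_def] at h1
    rw [hTy, Fin.lt_def] at h2
    simp only at h1 h2
    omega
  have hd : diag y.1.2 = diag x.1.2 + 1 ∨ diag x.1.2 = diag y.1.2 + 1 := by
    rcases hb.2 with ⟨h1, h2⟩ | ⟨h1, h2⟩
    · left
      by_contra hcon
      have hgap : x.1.2.2 + 1 < y.1.2.2 := by simp only [diag] at hcon; omega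
      let u : P.Box := ⟨(x.1.1, (x.1.2.1, x.1.2.2 + 1)), (P.isSkew _).mem_of_le x.2 hy'
        ⟨le_rfl, by simp only; omega⟩ ⟨h1.le, hgap.le⟩⟩
      exact hno u (hT _ _ ⟨rfl, Or.inl ⟨rfl, by simp only [u]; omega⟩⟩)
        (hT _ _ ⟨hcomp, Or.inl ⟨h1, hgap⟩⟩)
    · right
      by_contra hcon
      have hgap : x.1.2.1 + 1 < y.1.2.1 := by simp only [diag] at hcon; omega
      let u : P.Box := ⟨(x.1.1, (x.1.2.1 + 1, x.1.2.2)), (P.isSkew _).mem_of_le x.2 hy'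
        ⟨by simp only; omega, le_rfl⟩ ⟨hgap.le, h1.le⟩⟩
      exact hno u (hT _ _ ⟨rfl, Or.inr ⟨rfl, by simp only [u]; omega⟩⟩)
        (hT _ _ ⟨hcomp, Or.inr ⟨h1, hgap⟩⟩)
  simp only [cB, hcomp, if_true]
  rcases hd with hd | hd
  · rw [Before.trans_val P hcomp hd]
    have : q * P.val x - q⁻¹ * (q ^ 2 * P.val x) = 0 := by field_simp; ring
    rw [this]; simp
  · rw [Before.trans_val P hcomp.symm hd]
    have : q * P.val y - q⁻¹ * (q ^ 2 * P.val y) = 0 := by field_simp; ring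
    rw [this]; simp

theorem not_std_trans {T : P.Box ≃ Fin n} (hT : P.IsStd T) {σ τ : Equiv.Perm (Fin n)}
    (hστ : ∀ a b, a < b → ¬ σ a < σ b → ¬ τ a < τ b) (h : ¬ P.IsStd (T.trans σ)) :
    ¬ P.IsStd (T.trans τ) := by
  simp only [IsStd, not_forall] at h ⊢
  obtain ⟨x, y, hxy, hn⟩ := h
  exact ⟨x, y, hxy, hστ _ _ (hT x y hxy) hn⟩

theorem sw_val (i : ℕ) (h : i + 1 < n) (a : Fin n) :
    (sw i h a : ℕ) = if (a : ℕ) = i then i + 1 else if (a : ℕ) = i + 1 then i else a := by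
  simp only [sw, Equiv.swap_apply_def, Fin.ext_iff]
  split_ifs <;> rfl

theorem sw_cases (i : ℕ) (h : i + 1 < n) (a : Fin n) :
    ((a : ℕ) = i ∧ (sw i h a : ℕ) = i + 1) ∨ ((a : ℕ) = i + 1 ∧ (sw i h a : ℕ) = i) ∨
      ((a : ℕ) ≠ i ∧ (a : ℕ) ≠ i + 1 ∧ (sw i h a : ℕ) = a) := by
  rw [sw_val]; split_ifs <;> omega

theorem act_act (i : ℕ) (h : i + 1 < n) (T) : P.act i h (P.act i h T) = T := by
  ext x; simp [act, sw]

theorem act_symm (i : ℕ) (h : i + 1 < n) (T) (j : Fin n) :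
    (P.act i h T).symm j = T.symm (sw i h j) := by
  simp [act, sw]

theorem rule {T : P.Box ≃ Fin n} (hT : P.IsStd T) (i j : ℕ) (h : i + 1 < n) (h' : j + 1 < n) :
    P.cB (T.symm ⟨i, Nat.lt_of_succ_lt h⟩) (T.symm ⟨i + 1, h⟩) •
      P.gOp j h' (P.w (P.act i h T)) =
    P.cB (T.symm ⟨i, Nat.lt_of_succ_lt h⟩) (T.symm ⟨i + 1, h⟩) •
      (P.cA ((P.act i h T).symm ⟨j, Nat.lt_of_succ_lt h'⟩) ((P.act i h T).symm ⟨j + 1, h'⟩) •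
        P.w (P.act i h T) +
      P.cB ((P.act i h T).symm ⟨j, Nat.lt_of_succ_lt h'⟩) ((P.act i h T).symm ⟨j + 1, h'⟩) •
        P.w (P.act j h' (P.act i h T))) := by
  by_cases hs : P.IsStd (P.act i h T)
  · rw [P.gOp_w j h' hs]
  · rw [P.w_of_not hs]
    simp only [map_zero, smul_zero, zero_add]
    rcases eq_or_ne i j with rfl | hij
    · have := P.cB_mul_cB hT hs
      simp only [act_symm, sw, Equiv.swap_apply_left, Equiv.swap_apply_right]
      rw [smul_smul, this, zero_smul]
    · have : ¬ P.IsStd (P.act j h' (P.act i h T)) := by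
        refine P.not_std_trans (σ := sw i h) (τ := (sw i h).trans (sw j h')) hT ?_ hs
        intro a b hab hn
        simp only [Equiv.trans_apply, sw_val, Fin.lt_def] at hab hn ⊢
        split_ifs at hn ⊢ <;> omega
      rw [P.w_of_not this]
      simp

theorem rule2 {T : P.Box ≃ Fin n} (hT : P.IsStd T) (i j : ℕ) (h : i + 1 < n) (h' : j + 1 < n)
    (hij : i = j + 1 ∨ j = i + 1) :
    (P.cB (T.symm ⟨i, Nat.lt_of_succ_lt h⟩) (T.symm ⟨i + 1, h⟩) *
      P.cB ((P.act i h T).symm ⟨j, Nat.lt_of_succ_lt h'⟩) ((P.act i h T).symm ⟨j + 1, h'⟩)) •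
      P.gOp i h (P.w (P.act j h' (P.act i h T))) =
    (P.cB (T.symm ⟨i, Nat.lt_of_succ_lt h⟩) (T.symm ⟨i + 1, h⟩) *
      P.cB ((P.act i h T).symm ⟨j, Nat.lt_of_succ_lt h'⟩) ((P.act i h T).symm ⟨j + 1, h'⟩)) •
      (P.cA ((P.act j h' (P.act i h T)).symm ⟨i, Nat.lt_of_succ_lt h⟩)
        ((P.act j h' (P.act i h T)).symm ⟨i + 1, h⟩) • P.w (P.act j h' (P.act i h T)) +
      P.cB ((P.act j h' (P.act i h T)).symm ⟨i, Nat.lt_of_succ_lt h⟩)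
        ((P.act j h' (P.act i h T)).symm ⟨i + 1, h⟩) •
        P.w (P.act i h (P.act j h' (P.act i h T)))) := by
  by_cases hs : P.IsStd (P.act j h' (P.act i h T))
  · rw [P.gOp_w i h hs]
  · have : ¬ P.IsStd (P.act i h (P.act j h' (P.act i h T))) := by
      refine P.not_std_trans (σ := (sw i h).trans (sw j h'))
        (τ := ((sw i h).trans (sw j h')).trans (sw i h)) hT ?_ hs
      intro a b hab hn
      simp only [Equiv.trans_apply, Fin.lt_def] at hab hn ⊢
      have h1 := sw_cases i h a
      have h2 := sw_cases j h' (sw i h a)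
      have h3 := sw_cases i h (sw j h' (sw i h a))
      have h4 := sw_cases i h b
      have h5 := sw_cases j h' (sw i h b)
      have h6 := sw_cases i h (sw j h' (sw i h b))
      generalize (sw i h (sw j h' (sw i h a)) : ℕ) = a3 at *
      generalize (sw i h (sw j h' (sw i h b)) : ℕ) = b3 at *
      generalize (sw j h' (sw i h a) : ℕ) = a2 at *
      generalize (sw j h' (sw i h b) : ℕ) = b2 at *
      generalize (sw i h a : ℕ) = a1 at *
      generalize (sw i h b : ℕ) = b1 at *
      clear hs
      grind
    rw [P.w_of_not hs, P.w_of_not this]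
    simp

theorem xx_gOp (i : ℕ) (h : i + 1 < n) :
    P.gOp i h * P.xOp ⟨i, Nat.lt_of_succ_lt h⟩ * P.gOp i h = P.xOp ⟨i + 1, h⟩ := by
  refine P.end_ext fun T hT => ?_
  have hr := P.rule hT i i h h
  simp only [Module.End.mul_apply, P.gOp_w i h hT, map_add, map_smul, xOp_w, act_act, act_symm, sw,
    Equiv.swap_apply_left, Equiv.swap_apply_right] at hr ⊢
  rw [smul_comm (P.cB _ _) (P.val _) (P.gOp i h _), hr]
  have hne := fun hp => P.val_symm_ne hT (i := ⟨i, Nat.lt_of_succ_lt h⟩) (j := ⟨i + 1, h⟩) hp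
    (by simp) (by simp only; omega) (by simp only; omega)
  have hx := P.val_ne_zero (T.symm ⟨i, Nat.lt_of_succ_lt h⟩)
  have hy := P.val_ne_zero (T.symm ⟨i + 1, h⟩)
  generalize T.symm ⟨i, Nat.lt_of_succ_lt h⟩ = x at *
  generalize T.symm ⟨i + 1, h⟩ = y at *
  have hq := q_ne_zero C
  have h1 : P.cA x y * P.val x * P.cA x y + P.val y * P.cB x y * P.cB y x = P.val y := by
    simp only [cA, cB]
    by_cases hp : P.comp x = P.comp y
    · have hne' := hne hp
      have e1 := sub_ne_zero.2 hne'
      have e2 := sub_ne_zero.2 hne'.symm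
      simp only [hp, if_true]
      field_simp
      ring
    · simp [hp, Ne.symm hp]
  have h2 : P.cA x y * P.val x * P.cB x y + P.val y * P.cB x y * P.cA y x = 0 := by
    simp only [cA, cB]
    by_cases hp : P.comp x = P.comp y
    · have hne' := hne hp
      have e1 := sub_ne_zero.2 hne'
      have e2 := sub_ne_zero.2 hne'.symm
      simp only [hp, if_true]
      field_simp
      ring
    · simp [hp, Ne.symm hp]
  linear_combination (norm := module) h1 • P.w T + h2 • P.w (P.act i h T)

theorem xOp_comm (i j : Fin n) : P.xOp i * P.xOp j = P.xOp j * P.xOp i := by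
  refine P.end_ext fun T hT => ?_
  simp only [Module.End.mul_apply, xOp_w, map_smul, smul_smul, mul_comm]

theorem gOp_xOp (i : ℕ) (h : i + 1 < n) (j : Fin n) (hj : sw i h j = j) :
    P.gOp i h * P.xOp j = P.xOp j * P.gOp i h := by
  refine P.end_ext fun T hT => ?_
  simp only [Module.End.mul_apply, xOp_w, map_smul, P.gOp_w i h hT, map_add, act_symm, hj]
  module

theorem gOp_tOp (ζ : ℂ) (i : ℕ) (h : i + 1 < n) (j : Fin n) :
    P.gOp i h * P.tOp ζ j = P.tOp ζ (sw i h j) * P.gOp i h := by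
  refine P.end_ext fun T hT => ?_
  have hs : sw i h (sw i h j) = j := by simp [sw]
  simp only [Module.End.mul_apply, tOp_w, map_smul, P.gOp_w i h hT, map_add, act_symm, hs]
  have key : P.cA (T.symm ⟨i, Nat.lt_of_succ_lt h⟩) (T.symm ⟨i + 1, h⟩) = 0 ∨
      P.comp (T.symm (sw i h j)) = P.comp (T.symm j) := by
    by_cases hp : P.comp (T.symm ⟨i, Nat.lt_of_succ_lt h⟩) = P.comp (T.symm ⟨i + 1, h⟩)
    · right
      simp only [sw, Equiv.swap_apply_def]
      split_ifs with h1 h2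
      · rw [h1, hp]
      · rw [h2, hp]
      · rfl
    · left
      simp [cA, hp]
  rcases key with h0 | h0 <;> rw [h0] <;> module

theorem sum_zeta {r : ℕ} [NeZero r] {ζ : ℂ} (hζ : IsPrimitiveRoot ζ r) (a b : Fin r) :
    (1 / (r : ℂ)) * ∑ s ∈ Finset.range r, (ζ ^ (a : ℕ)) ^ s * (ζ ^ (b : ℕ)) ^ (r - s)
      = if a = b then 1 else 0 := by
  have hr : (r : ℂ) ≠ 0 := Nat.cast_ne_zero.2 (NeZero.ne r)
  have hz : ζ ≠ 0 := hζ.ne_zero (NeZero.ne r)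
  have hpow : ∀ c : ℕ, (ζ ^ c) ^ r = 1 := fun c => by rw [pow_right_comm, hζ.pow_eq_one, one_pow]
  have h1 : ∀ s ∈ Finset.range r, (ζ ^ (a : ℕ)) ^ s * (ζ ^ (b : ℕ)) ^ (r - s)
      = (ζ ^ (a : ℕ) / ζ ^ (b : ℕ)) ^ s := by
    intro s hs
    rw [pow_sub₀ _ (pow_ne_zero _ hz) (Finset.mem_range.1 hs).le, hpow, div_pow, one_mul,
      div_eq_mul_inv]
  rw [Finset.sum_congr rfl h1]
  split_ifs with hab
  · subst hab
    rw [div_self (pow_ne_zero _ hz)]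
    simp [hr]
  · have hne : ζ ^ (a : ℕ) / ζ ^ (b : ℕ) ≠ 1 := by
      intro h
      rw [div_eq_one_iff_eq (pow_ne_zero _ hz)] at h
      exact hab (Fin.ext (hζ.pow_inj a.2 b.2 h))
    rw [geom_sum_eq hne, div_pow, hpow, hpow]
    simp

theorem tOp_pow_w (ζ : ℂ) (j : Fin n) (s : ℕ) (T) :
    (P.tOp ζ j ^ s) (P.w T) = (ζ ^ (P.comp (T.symm j) : ℕ)) ^ s • P.w T := by
  induction s with
  | zero => simp
  | succ s ih => rw [pow_succ', Module.End.mul_apply, ih, map_smul, tOp_w, smul_smul, pow_succ]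

theorem idem_w [NeZero r] {ζ : ℂ} (hζ : IsPrimitiveRoot ζ r) (i j : Fin n) (T) :
    idem r (P.tOp ζ i) (P.tOp ζ j) (P.w T)
      = (if P.comp (T.symm i) = P.comp (T.symm j) then 1 else 0 : ℂ) • P.w T := by
  rw [← sum_zeta hζ, mul_smul, Finset.sum_smul]
  simp only [idem, LinearMap.smul_apply, LinearMap.sum_apply, Module.End.mul_apply, tOp_pow_w,
    map_smul, smul_smul]
  congr 1
  exact Finset.sum_congr rfl fun s _ => by rw [mul_comm]

theorem quad_gOp [NeZero r] {ζ : ℂ} (hζ : IsPrimitiveRoot ζ r) (i : ℕ) (h : i + 1 < n) :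
    P.gOp i h * P.gOp i h = 1 + (q - q⁻¹) •
      (idem r (P.tOp ζ ⟨i, Nat.lt_of_succ_lt h⟩) (P.tOp ζ ⟨i + 1, h⟩) * P.gOp i h) := by
  refine P.end_ext fun T hT => ?_
  have hr := P.rule hT i i h h
  simp only [Module.End.mul_apply, LinearMap.add_apply, LinearMap.smul_apply, Module.End.one_apply,
    P.gOp_w i h hT, map_add, map_smul, P.idem_w hζ, act_act, act_symm, sw,
    Equiv.swap_apply_left, Equiv.swap_apply_right] at hr ⊢
  rw [hr]
  have hne := fun hp => P.val_symm_ne hT (i := ⟨i, Nat.lt_of_succ_lt h⟩) (j := ⟨i + 1, h⟩) hp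
    (by simp) (by simp only; omega) (by simp only; omega)
  generalize T.symm ⟨i, Nat.lt_of_succ_lt h⟩ = x at *
  generalize T.symm ⟨i + 1, h⟩ = y at *
  have hq := q_ne_zero C
  have h1 : P.cA x y * P.cA x y + P.cB x y * P.cB y x = 1 + (q - q⁻¹) * (P.cA x y *
      (if P.comp x = P.comp y then 1 else 0)) := by
    simp only [cA, cB]
    by_cases hp : P.comp x = P.comp y
    · have hne' := hne hp
      have e1 := sub_ne_zero.2 hne'
      have e2 := sub_ne_zero.2 hne'.symm
      simp only [hp, if_true]
      field_simp
      ring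
    · simp [hp, Ne.symm hp]
  have h2 : P.cA x y * P.cB x y + P.cB x y * P.cA y x = (q - q⁻¹) * (P.cB x y *
      (if P.comp y = P.comp x then 1 else 0)) := by
    simp only [cA, cB]
    by_cases hp : P.comp x = P.comp y
    · have hne' := hne hp
      have e1 := sub_ne_zero.2 hne'
      have e2 := sub_ne_zero.2 hne'.symm
      simp only [hp, if_true]
      field_simp
      ring
    · simp [hp, Ne.symm hp]
  linear_combination (norm := module) h1 • P.w T + h2 • P.w (P.act i h T)

theorem gOp_far (i j : ℕ) (h : i + 1 < n) (h' : j + 1 < n) (hij : i + 2 ≤ j) :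
    P.gOp i h * P.gOp j h' = P.gOp j h' * P.gOp i h := by
  refine P.end_ext fun T hT => ?_
  have hr := P.rule hT i j h h'
  have hr' := P.rule hT j i h' h
  have e1 : sw i h ⟨j, Nat.lt_of_succ_lt h'⟩ = ⟨j, Nat.lt_of_succ_lt h'⟩ := by
    ext; rw [sw_val]; simp only; split_ifs <;> omega
  have e2 : sw i h ⟨j + 1, h'⟩ = ⟨j + 1, h'⟩ := by
    ext; rw [sw_val]; simp only; split_ifs <;> omega
  have e3 : sw j h' ⟨i, Nat.lt_of_succ_lt h⟩ = ⟨i, Nat.lt_of_succ_lt h⟩ := by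
    ext; rw [sw_val]; simp only; split_ifs <;> omega
  have e4 : sw j h' ⟨i + 1, h⟩ = ⟨i + 1, h⟩ := by
    ext; rw [sw_val]; simp only; split_ifs <;> omega
  have e5 : P.act j h' (P.act i h T) = P.act i h (P.act j h' T) := by
    ext x
    simp only [act, Equiv.trans_apply, sw_val]
    split_ifs <;> omega
  simp only [Module.End.mul_apply, P.gOp_w i h hT, P.gOp_w j h' hT, map_add, map_smul, act_symm,
    e1, e2, e3, e4, e5] at hr hr' ⊢
  rw [hr, hr']
  module

theorem gOp_braid (i : ℕ) (h' : i + 1 < n) (h : i + 1 + 1 < n) :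
    P.gOp i h' * P.gOp (i + 1) h * P.gOp i h' = P.gOp (i + 1) h * P.gOp i h' * P.gOp (i + 1) h := by
  refine P.end_ext fun T hT => ?_
  have r1 := P.rule hT i i h' h'
  have r2 := P.rule hT i (i + 1) h' h
  have r3 := P.rule hT (i + 1) i h h'
  have r4 := P.rule hT (i + 1) (i + 1) h h
  have r5 := P.rule2 hT i (i + 1) h' h (by omega)
  have r6 := P.rule2 hT (i + 1) i h h' (by omega)
  have e1 : sw i h' ⟨i, Nat.lt_of_succ_lt h'⟩ = ⟨i + 1, h'⟩ := by simp [sw]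
  have e2 : sw i h' ⟨i + 1, h'⟩ = ⟨i, Nat.lt_of_succ_lt h'⟩ := by simp [sw]
  have e3 : sw i h' ⟨i + 1 + 1, h⟩ = ⟨i + 1 + 1, h⟩ := by
    ext; rw [sw_val]; simp only; split_ifs <;> omega
  have e4 : sw (i + 1) h ⟨i, Nat.lt_of_succ_lt h'⟩ = ⟨i, Nat.lt_of_succ_lt h'⟩ := by
    ext; rw [sw_val]; simp only; split_ifs <;> omega
  have e5 : sw (i + 1) h ⟨i + 1, h'⟩ = ⟨i + 1 + 1, h⟩ := by simp [sw]
  have e6 : sw (i + 1) h ⟨i + 1 + 1, h⟩ = ⟨i + 1, h'⟩ := by simp [sw]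
  have e7 : P.act i h' (P.act (i + 1) h (P.act i h' T))
      = P.act (i + 1) h (P.act i h' (P.act (i + 1) h T)) := by
    ext x
    simp only [act, Equiv.trans_apply]
    have h1 := sw_cases i h' (T x)
    have h2 := sw_cases (i + 1) h (sw i h' (T x))
    have h3 := sw_cases i h' (sw (i + 1) h (sw i h' (T x)))
    have h4 := sw_cases (i + 1) h (T x)
    have h5 := sw_cases i h' (sw (i + 1) h (T x))
    have h6 := sw_cases (i + 1) h (sw i h' (sw (i + 1) h (T x)))
    omega
  have n1 := fun hp => P.val_symm_ne hT (i := ⟨i, Nat.lt_of_succ_lt h'⟩) (j := ⟨i + 1, h'⟩) hp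
    (by simp) (by simp only; omega) (by simp only; omega)
  have n2 := fun hp => P.val_symm_ne hT (i := ⟨i + 1, h'⟩) (j := ⟨i + 1 + 1, h⟩) hp
    (by rw [Ne, Fin.mk.injEq]; omega) (by simp only; omega) (by simp only; omega)
  have n3 := fun hp => P.val_symm_ne hT (i := ⟨i, Nat.lt_of_succ_lt h'⟩) (j := ⟨i + 1 + 1, h⟩) hp
    (by rw [Ne, Fin.mk.injEq]; omega) (by simp only; omega) (by simp only; omega)
  simp only [Module.End.mul_apply, P.gOp_w i h' hT, P.gOp_w (i + 1) h hT, map_add, map_smul,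
    act_symm, act_act, e1, e2, e3, e4, e5, e6] at r1 r2 r3 r4 r5 r6 ⊢
  rw [e7] at r5
  have r2' := congrArg (P.gOp i h') r2
  have r3' := congrArg (P.gOp (i + 1) h) r3
  simp only [map_add, map_smul] at r2' r3'
  generalize P.w (P.act (i + 1) h (P.act i h' (P.act (i + 1) h T))) = w121 at *
  generalize P.w (P.act (i + 1) h (P.act i h' T)) = w12 at *
  generalize P.w (P.act i h' (P.act (i + 1) h T)) = w21 at *
  generalize P.w (P.act i h' T) = w1 at *
  generalize P.w (P.act (i + 1) h T) = w2 at *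
  generalize P.gOp i h' = G1 at *
  generalize P.gOp (i + 1) h = G2 at *
  generalize P.w T = w0 at *
  generalize T.symm ⟨i, Nat.lt_of_succ_lt h'⟩ = x at *
  generalize T.symm ⟨i + 1, h'⟩ = y at *
  generalize T.symm ⟨i + 1 + 1, h⟩ = z at *
  have hq := q_ne_zero C
  have s0 : P.cA x y * P.cA y z * P.cA x y + P.cB x y * P.cA x z * P.cB y x
      = P.cA y z * P.cA x y * P.cA y z + P.cB y z * P.cA x z * P.cB z y := by
    simp only [cA, cB]
    by_cases h1 : P.comp x = P.comp y
    · have d1 := sub_ne_zero.2 (n1 h1)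
      have d1' := sub_ne_zero.2 (n1 h1).symm
      by_cases h2 : P.comp y = P.comp z
      · have d2 := sub_ne_zero.2 (n2 h2)
        have d2' := sub_ne_zero.2 (n2 h2).symm
        have d3 := sub_ne_zero.2 (n3 (h1.trans h2))
        have d3' := sub_ne_zero.2 (n3 (h1.trans h2)).symm
        simp only [h1, h2, if_true]
        field_simp
        ring
      · simp [h1, h2, Ne.symm h2]
    · by_cases h2 : P.comp y = P.comp z
      · simp [h1, ← h2, Ne.symm h1]
      · simp [h1, h2, Ne.symm h1, Ne.symm h2]
  have s1 : P.cA x y * P.cA y z * P.cB x y + P.cB x y * P.cA x z * P.cA y x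
      = P.cA y z * P.cB x y * P.cA x z := by
    simp only [cA, cB]
    by_cases h1 : P.comp x = P.comp y
    · have d1 := sub_ne_zero.2 (n1 h1)
      have d1' := sub_ne_zero.2 (n1 h1).symm
      by_cases h2 : P.comp y = P.comp z
      · have d2 := sub_ne_zero.2 (n2 h2)
        have d2' := sub_ne_zero.2 (n2 h2).symm
        have d3 := sub_ne_zero.2 (n3 (h1.trans h2))
        have d3' := sub_ne_zero.2 (n3 (h1.trans h2)).symm
        simp only [h1, h2, if_true]
        field_simp
        ring
      · simp [h1, h2, Ne.symm h2]
    · by_cases h2 : P.comp y = P.comp z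
      · simp [h1, ← h2, Ne.symm h1]
      · simp [h1, h2, Ne.symm h1, Ne.symm h2]
  have s2 : P.cA x y * P.cB y z * P.cA x z
      = P.cA y z * P.cA x y * P.cB y z + P.cB y z * P.cA x z * P.cA z y := by
    simp only [cA, cB]
    by_cases h1 : P.comp x = P.comp y
    · have d1 := sub_ne_zero.2 (n1 h1)
      have d1' := sub_ne_zero.2 (n1 h1).symm
      by_cases h2 : P.comp y = P.comp z
      · have d2 := sub_ne_zero.2 (n2 h2)
        have d2' := sub_ne_zero.2 (n2 h2).symm
        have d3 := sub_ne_zero.2 (n3 (h1.trans h2))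
        have d3' := sub_ne_zero.2 (n3 (h1.trans h2)).symm
        simp only [h1, h2, if_true]
        field_simp
        ring
      · simp [h1, h2, Ne.symm h2]
    · by_cases h2 : P.comp y = P.comp z
      · simp [h1, ← h2, Ne.symm h1]
      · simp [h1, h2, Ne.symm h1, Ne.symm h2]
  linear_combination (norm := module) P.cA x y • r3 + r2' + P.cA x z • r1 + r5 - P.cA y z • r2 - r3' -
    P.cA x z • r4 - r6 + s0 • w0 + s1 • w1 + s2 • w2

/-- The operators by which the generators of `Ŷ_{r,n}` act on the span of the `w_T`. -/
noncomputable def ops [NeZero r] {ζ : ℂ} (hζ : IsPrimitiveRoot ζ r) :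
    Family r n q (Module.End ℂ (P.Std →₀ ℂ)) where
  t j := P.tOp ζ j
  g i h := P.gOp i h
  X h := P.xOp ⟨0, h⟩
  Xinv h := P.xinvOp ⟨0, h⟩
  g_comm i j hi hj hij := P.gOp_far i j hi hj hij
  braid i h := P.gOp_braid i _ h
  t_comm i j := by
    refine P.end_ext fun T hT => ?_
    simp only [Module.End.mul_apply, tOp_w, map_smul, smul_smul, mul_comm]
  g_t i h j := P.gOp_tOp ζ i h j
  t_pow j := by
    refine P.end_ext fun T hT => ?_
    rw [tOp_pow_w, ← pow_mul, mul_comm, pow_mul, hζ.pow_eq_one]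
    simp
  quad i h := P.quad_gOp hζ i h
  X_Xinv h := by
    refine P.end_ext fun T hT => ?_
    simp [xOp_w, xinvOp_w, smul_smul, P.val_ne_zero]
  Xinv_X h := by
    refine P.end_ext fun T hT => ?_
    simp [xOp_w, xinvOp_w, smul_smul, P.val_ne_zero]
  gXgX h0 h := by
    have e := P.xx_gOp 0 h
    have c := P.xOp_comm ⟨0 + 1, h⟩ ⟨0, h0⟩
    rw [← e] at c
    simpa only [mul_assoc] using c
  g_X i h0 h hi := P.gOp_xOp i h _ (by
    apply Equiv.swap_apply_of_ne_of_ne <;> rw [Ne, Fin.mk.injEq] <;> omega)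
  t_X j h := by
    refine P.end_ext fun T hT => ?_
    simp only [Module.End.mul_apply, tOp_w, xOp_w, map_smul, smul_smul, mul_comm]

theorem ops_XX [NeZero r] {ζ : ℂ} (hζ : IsPrimitiveRoot ζ r) :
    ∀ (j : ℕ) (h : j < n), (P.ops hζ).XX j h = P.xOp ⟨j, h⟩
  | 0, h => rfl
  | j + 1, h => by
    rw [Family.XX, ops_XX hζ j]
    exact P.xx_gOp j h

/-- The representation `Ŷ_{r,n} → End(⊕_T ℂ w_T)`. -/
noncomputable def rep [NeZero r] {ζ : ℂ} (hζ : IsPrimitiveRoot ζ r) :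
    Yhat r n q →ₐ[ℂ] Module.End ℂ (P.Std →₀ ℂ) := (P.ops hζ).lift

end PlacedShape

/-- The calibrated module `Ŷ^{(c, λ/μ)}`: the vector space with basis `w_T`, `T` a standard
tableau, on which the generators act by `t_j w_T = ζ_{p(T|j)} w_T`, `X_j w_T = q^{2 c(T|j)} w_T` and
the seminormal formulas for `g_i`. -/
def CalMod {q : ℂ} {C : ContentDomain q} {r n : ℕ} [NeZero r] {ζ : ℂ} (_hζ : IsPrimitiveRoot ζ r)
    (P : PlacedShape C r n) : Type := P.Std →₀ ℂ

namespace CalMod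

variable {q : ℂ} {C : ContentDomain q} {r n : ℕ} [NeZero r] {ζ : ℂ} (hζ : IsPrimitiveRoot ζ r)
  (P : PlacedShape C r n)

noncomputable instance : AddCommGroup (CalMod hζ P) := inferInstanceAs (AddCommGroup (P.Std →₀ ℂ))

noncomputable instance : Module ℂ (CalMod hζ P) := inferInstanceAs (Module ℂ (P.Std →₀ ℂ))

noncomputable instance : Module (Yhat r n q) (CalMod hζ P) :=
  Module.compHom (P.Std →₀ ℂ) (P.rep hζ).toRingHom

theorem smul_def (a : Yhat r n q) (v : CalMod hζ P) :
    a • v = (P.rep hζ a : (P.Std →₀ ℂ) →ₗ[ℂ] (P.Std →₀ ℂ)) v := rfl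

instance : IsScalarTower ℂ (Yhat r n q) (CalMod hζ P) where
  smul_assoc c a v := by
    rw [smul_def, smul_def, map_smul]
    rfl

/-- The vector `w_T` (zero if the labelling `T` is not standard). -/
noncomputable def vec (T : P.Box ≃ Fin n) : CalMod hζ P := P.w T

theorem t_smul_vec (T : P.Box ≃ Fin n) (j : Fin n) :
    (Yhat.gens r n q).t j • vec hζ P T = ζ ^ (P.comp (T.symm j) : ℕ) • vec hζ P T := by
  rw [smul_def, show P.rep hζ ((Yhat.gens r n q).t j) = P.tOp ζ j from Family.lift_t _ j]
  exact P.tOp_w ζ j T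

theorem XX_smul_vec (T : P.Box ≃ Fin n) (j : Fin n) :
    (Yhat.gens r n q).XX j j.2 • vec hζ P T
      = C.qpow (P.content (T.symm j).1.1 (T.symm j).1.2) • vec hζ P T := by
  have key : ∀ (j : ℕ) (h : j < n),
      P.rep hζ ((Yhat.gens r n q).XX j h) = (P.ops hζ).XX j h := by
    intro j
    induction j with
    | zero => intro h; exact Family.lift_X _ h
    | succ j ih =>
      intro h
      simp only [Family.XX, map_mul, ih]
      rw [show P.rep hζ ((Yhat.gens r n q).g j h) = (P.ops hζ).g j h from Family.lift_g _ j h]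
  rw [smul_def, key, P.ops_XX]
  exact P.xOp_w j T

theorem g_smul_vec (T : P.Box ≃ Fin n) (hT : P.IsStd T) (i : ℕ) (h : i + 1 < n) :
    (Yhat.gens r n q).g i h • vec hζ P T =
      P.cA (T.symm ⟨i, Nat.lt_of_succ_lt h⟩) (T.symm ⟨i + 1, h⟩) • vec hζ P T +
      P.cB (T.symm ⟨i, Nat.lt_of_succ_lt h⟩) (T.symm ⟨i + 1, h⟩) • vec hζ P (P.act i h T) := by
  rw [smul_def, show P.rep hζ ((Yhat.gens r n q).g i h) = P.gOp i h from Family.lift_g _ i h]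
  exact P.gOp_w i h hT

end CalMod

/-- A finite dimensional `Ŷ_{r,n}`-module is calibrated if it has a basis of simultaneous
eigenvectors for `X₁, …, Xₙ` (with eigenvalues in `ℂ*`) and `t₁, …, tₙ` (with eigenvalues among the
powers of `ζ`). -/
def IsCalibrated (r n : ℕ) (q ζ : ℂ) (M : Type) [AddCommGroup M] [Module ℂ M]
    [Module (Yhat r n q) M] : Prop :=
  ∃ (ι : Type) (_ : Finite ι) (b : Module.Basis ι ℂ M), ∀ (a : ι) (i : Fin n),
    (∃ ν : ℂ, ν ≠ 0 ∧ (Yhat.gens r n q).XX i i.2 • b a = ν • b a) ∧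
    ∃ j : Fin r, (Yhat.gens r n q).t i • b a = ζ ^ (j : ℕ) • b a

/-! ### Induction -/

section Induction

variable {A B : Type} [Ring A] [Algebra ℂ A] [Ring B] [Algebra ℂ B]

/-- The relations `a β ⊗ m = a ⊗ β m` (`β ∈ B`). -/
noncomputable def inducedRel (f : B →ₐ[ℂ] A) {M : Type} [AddCommGroup M] [Module ℂ M]
    (ρ : B →ₐ[ℂ] Module.End ℂ M) : Submodule A (A ⊗[ℂ] M) :=
  Submodule.span A {x | ∃ (a : A) (β : B) (m : M), x = (a * f β) ⊗ₜ[ℂ] m - a ⊗ₜ[ℂ] (ρ β m)}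

/-- The induced module `A ⊗_B M` of a representation `ρ : B → End M` along `f : B → A`. -/
abbrev Induced (f : B →ₐ[ℂ] A) {M : Type} [AddCommGroup M] [Module ℂ M]
    (ρ : B →ₐ[ℂ] Module.End ℂ M) : Type := (A ⊗[ℂ] M) ⧸ inducedRel f ρ

/-- The representation of `A ⊗ B` on the outer tensor product `M ⊗ N`. -/
noncomputable def outerRep (M N : Type) [AddCommGroup M] [Module ℂ M] [Module A M]
    [IsScalarTower ℂ A M] [AddCommGroup N] [Module ℂ N] [Module B N] [IsScalarTower ℂ B N] :
    A ⊗[ℂ] B →ₐ[ℂ] Module.End ℂ (M ⊗[ℂ] N) :=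
  (Module.endTensorEndAlgHom (R := ℂ) (S := ℂ) (A := ℂ) (M := M) (N := N)).comp
    (Algebra.TensorProduct.map (Algebra.lsmul ℂ ℂ M) (Algebra.lsmul ℂ ℂ N))

end Induction

/-- The class of `M` in the Grothendieck group is `∑ i, [N i]`, in the following concrete form: `M`
has a finite filtration by submodules whose successive quotients are the modules `N i`, each of them
occurring exactly once, in some order. -/
def HasFactors (A : Type) [Ring A] (M : Type) [AddCommGroup M] [Module A M] {ι : Type} [Fintype ι]
    (N : ι → Type) [∀ i, AddCommGroup (N i)] [∀ i, Module A (N i)] : Prop :=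
  ∃ (e : Fin (Fintype.card ι) ≃ ι) (F : Fin (Fintype.card ι + 1) → Submodule A M),
    F 0 = ⊥ ∧ F (Fin.last _) = ⊤ ∧ Monotone F ∧
    ∀ i, Nonempty ((F i.succ ⧸ (F i.castSucc).submoduleOf (F i.succ)) ≃ₗ[A] N (e i))

/-! ### Gluing -/

/-- The box `x` of `S` is on the last (most northeastern) diagonal of `S`, that is, it has the
largest label. -/
def IsLastBox (S : Finset (ℤ × ℤ)) (x : ℤ × ℤ) : Prop := x ∈ S ∧ ∀ y ∈ S, diag y ≤ diag x

/-- The box `x` of `S` is on the first (most southwestern) diagonal of `S`, that is, it has the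
smallest label. -/
def IsFirstBox (S : Finset (ℤ × ℤ)) (x : ℤ × ℤ) : Prop := x ∈ S ∧ ∀ y ∈ S, diag x ≤ diag y

/-- The two ways of gluing. -/
inductive Dir : Type
  | vert
  | horiz

instance : DecidableEq Dir
  | .vert, .vert => isTrue rfl
  | .vert, .horiz => isFalse (by simp)
  | .horiz, .vert => isFalse (by simp)
  | .horiz, .horiz => isTrue rfl

instance : Fintype Dir := ⟨{.vert, .horiz}, fun d => by cases d <;> simp⟩

/-- The position, relative to a box, of the box immediately above it, respectively immediately to
the right of it. -/
def Dir.step : Dir → ℤ × ℤ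
  | .vert => (-1, 0)
  | .horiz => (0, 1)

/-- `S ∗_d S'`: the shape `S'` is translated so that its box `v` comes to lie immediately above
(`d = vert`), respectively to the right of (`d = horiz`), the box `u` of `S`. -/
def glueShape (S S' : Finset (ℤ × ℤ)) (u v : ℤ × ℤ) (d : Dir) : Finset (ℤ × ℤ) :=
  S ∪ S'.image fun y => y + (u + d.step - v)

/-- The content function on `S ∗_d S'` that is `a` on the boxes of `S` and `b` on those of `S'`. -/
def glueContent (S : Finset (ℤ × ℤ)) (a b : ℤ × ℤ → ℂ) (u v : ℤ × ℤ) (d : Dir) : ℤ × ℤ → ℂ :=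
  fun x => if x ∈ S then a x else b (x - (u + d.step - v))

theorem diag_add (x y : ℤ × ℤ) : diag (x + y) = diag x + diag y := by
  simp [diag]; ring

theorem diag_sub (x y : ℤ × ℤ) : diag (x - y) = diag x - diag y := by
  simp [diag]; ring

theorem diag_step (d : Dir) : diag d.step = 1 := by cases d <;> rfl

section Glue

variable {S S' : Finset (ℤ × ℤ)} {u v : ℤ × ℤ}

theorem IsLastBox.corner (hS : IsSkewShape S) (hu : IsLastBox S u) {x : ℤ × ℤ} (hx : x ∈ S) :
    u.1 ≤ x.1 ∧ x.2 ≤ u.2 := by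
  have hd := hu.2 x hx
  simp only [diag] at hd
  constructor
  · by_contra hcon
    have hlt : x.1 < u.1 := not_le.1 hcon
    have := hu.2 (x.1, u.2) (hS.mem_of_le hx hu.1 ⟨le_rfl, by simp only; omega⟩ ⟨hlt.le, le_rfl⟩)
    simp only [diag] at this
    omega
  · by_contra hcon
    have hlt : u.2 < x.2 := not_le.1 hcon
    have := hu.2 (u.1, x.2) (hS.mem_of_le hu.1 hx ⟨le_rfl, hlt.le⟩ ⟨by simp only; omega, le_rfl⟩)
    simp only [diag] at this
    omega

theorem IsFirstBox.corner (hS : IsSkewShape S') (hv : IsFirstBox S' v) {x : ℤ × ℤ} (hx : x ∈ S') :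
    x.1 ≤ v.1 ∧ v.2 ≤ x.2 := by
  have hd := hv.2 x hx
  simp only [diag] at hd
  constructor
  · by_contra hcon
    have hlt : v.1 < x.1 := not_le.1 hcon
    have := hv.2 (x.1, v.2) (hS.mem_of_le hv.1 hx ⟨hlt.le, le_rfl⟩ ⟨le_rfl, by simp only; omega⟩)
    simp only [diag] at this
    omega
  · by_contra hcon
    have hlt : x.2 < v.2 := not_le.1 hcon
    have := hv.2 (v.1, x.2) (hS.mem_of_le hx hv.1 ⟨by simp only; omega, le_rfl⟩ ⟨le_rfl, hlt.le⟩)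
    simp only [diag] at this
    omega

theorem glueShape_disjoint (hu : IsLastBox S u) (hv : IsFirstBox S' v) (d : Dir) :
    Disjoint S (S'.image fun y => y + (u + d.step - v)) := by
  rw [Finset.disjoint_left]
  intro x hx hx'
  obtain ⟨y, hy, rfl⟩ := Finset.mem_image.1 hx'
  have h1 := hu.2 _ hx
  have h2 := hv.2 y hy
  rw [diag_add, diag_sub, diag_add, diag_step] at h1
  omega

theorem glueShape_card (hu : IsLastBox S u) (hv : IsFirstBox S' v) (d : Dir) :
    (glueShape S S' u v d).card = S.card + S'.card := by
  rw [glueShape, Finset.card_union_of_disjoint (glueShape_disjoint hu hv d),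
    Finset.card_image_of_injective _ (add_left_injective _)]

theorem glueShape_isSkew (hS : IsSkewShape S) (hS' : IsSkewShape S') (hu : IsLastBox S u)
    (hv : IsFirstBox S' v) (d : Dir) : IsSkewShape (glueShape S S' u v d) := by
  apply isSkewShape_of_mem_of_le
  intro x hx z hz y hxy hyz
  have hxy1 : x.1 ≤ y.1 := hxy.1
  have hxy2 : x.2 ≤ y.2 := hxy.2
  have hyz1 : y.1 ≤ z.1 := hyz.1
  have hyz2 : y.2 ≤ z.2 := hyz.2
  simp only [glueShape, Finset.mem_union, Finset.mem_image] at hx hz ⊢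
  have key : y - (u + d.step - v) ∈ S' → y ∈ S ∨ ∃ a ∈ S', a + (u + d.step - v) = y :=
    fun h => Or.inr ⟨_, h, by abel⟩
  rcases hx with hx | ⟨a, ha, rfl⟩ <;> rcases hz with hz | ⟨b, hb, rfl⟩
  · exact Or.inl (hS.mem_of_le hx hz hxy hyz)
  · have h1 := hu.corner hS hx
    have h2 := hv.corner hS' hb
    cases d
    · simp only [Dir.step, Prod.fst_add, Prod.snd_add, Prod.fst_sub, Prod.snd_sub] at hyz1 hyz2
      omega
    · simp only [Dir.step, Prod.fst_add, Prod.snd_add, Prod.fst_sub, Prod.snd_sub] at hyz1 hyz2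
      rcases le_or_gt y.2 u.2 with hle | hgt
      · exact Or.inl (hS.mem_of_le hx hu.1 hxy ⟨by omega, hle⟩)
      · apply key
        refine hS'.mem_of_le hv.1 hb ⟨?_, ?_⟩ ⟨?_, ?_⟩ <;>
          simp only [Dir.step, Prod.fst_add, Prod.snd_add, Prod.fst_sub, Prod.snd_sub] <;> omega
  · have h1 := hv.corner hS' ha
    have h2 := hu.corner hS hz
    cases d <;>
      simp only [Dir.step, Prod.fst_add, Prod.snd_add, Prod.fst_sub, Prod.snd_sub] at hxy1 hxy2
    · rcases le_or_gt u.1 y.1 with hle | hgt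
      · exact Or.inl (hS.mem_of_le hu.1 hz ⟨hle, by omega⟩ hyz)
      · apply key
        refine hS'.mem_of_le ha hv.1 ⟨?_, ?_⟩ ⟨?_, ?_⟩ <;>
          simp only [Dir.step, Prod.fst_add, Prod.snd_add, Prod.fst_sub, Prod.snd_sub] <;> omega
    · omega
  · apply key
    refine hS'.mem_of_le ha hb ⟨?_, ?_⟩ ⟨?_, ?_⟩ <;>
      simp only [Prod.fst_add, Prod.snd_add, Prod.fst_sub, Prod.snd_sub] at * <;> omega

end Glue

/-- The placed `r`-skew shape `(θ^{(1)} ∗_{w_1} φ^{(1)}, …, θ^{(r)} ∗_{w_r} φ^{(r)})`, where `u p`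
is the last box of `θ^{(p)}` and `v p` the first box of `φ^{(p)}`. -/
def PlacedShape.glue {q : ℂ} {C : ContentDomain q} {r k l : ℕ} (θ : PlacedShape C r k)
    (φ : PlacedShape C r l) {u v : Fin r → ℤ × ℤ} (hu : ∀ p, IsLastBox (θ.shape p) (u p))
    (hv : ∀ p, IsFirstBox (φ.shape p) (v p)) (w : Fin r → Dir)
    (hw : ∀ p, IsContent C (glueShape (θ.shape p) (φ.shape p) (u p) (v p) (w p))
      (glueContent (θ.shape p) (θ.content p) (φ.content p) (u p) (v p) (w p))) :
    PlacedShape C r (k + l) where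
  shape p := glueShape (θ.shape p) (φ.shape p) (u p) (v p) (w p)
  isSkew p := glueShape_isSkew (θ.isSkew p) (φ.isSkew p) (hu p) (hv p) (w p)
  card := by
    simp only [fun p => glueShape_card (hu p) (hv p) (w p), Finset.sum_add_distrib, θ.card, φ.card]
  content p := glueContent (θ.shape p) (θ.content p) (φ.content p) (u p) (v p) (w p)
  isContent := hw

end AffineYokonumaHecke

/-!
For labellings of the boxes of `θ` and `φ` together (by `1, …, k + l`) that are standard on each of
the two shapes, with boxes of different shapes not compared, the seminormal formulas still make
sense: the gluing directions `GluePair.dir` read off from such a labelling (horizontal at `p` if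
`u_p` gets a smaller label than `v_p`) exhibit it as a standard tableau of exactly one glued shape
`(θ ∗ φ)_w` (`GluePair.isStd_glue_iff`), whose contents exclude poles. The labellings thus span a
module `V` (`GluePair.datum`, `SeminormalDatum.Mod`), and both halves of the theorem are statements
about `V`.

* *`V` is filtered by the glued modules.* As `b(v_p) = a(u_p) + 1`, the coefficient of the swap that
  moves `v_p` past `u_p` vanishes (`GluePair.swapCoeff_first_last`), so that the generators can turn
  a direction from horizontal to vertical, but never back. Enumerating the direction tuples
  compatibly with this order gives a filtration of `V`, and the part of `V` with directions `w` is
  `Ŷ^{(c, (θ ∗ φ)_w)}`, formula by formula (`GluePair.hasFactors_datum`).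

* *`V` is the induced module.* By Frobenius reciprocity, `w_{T₁} ⊗ w_{T₂} ↦ w_T`, where `T` labels
  first `θ` by `T₁` and then `φ` by `T₂`, extends to a homomorphism from the induced module to `V`.
  It is onto, because the swap coefficient that moves a box of `θ` past a box of `φ` never vanishes
  (`GluePair.swapCoeff_ne_zero`, `GluePair.vec_mem_of_initial`). On the other hand, the induced
  module is spanned by the vectors `g_σ ⊗ (w_{T₁} ⊗ w_{T₂})` with `σ` a minimal coset representative
  (`GluePair.shuffleVec`); these are indexed by the same labellings as the basis of `V`
  (`GluePair.shuffleSpan_eq_top`). Comparing dimensions shows that the homomorphism is bijective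
  (`GluePair.indLift_bijective`), without any basis theorem for `Ŷ_{r,n}`.
-/

/-! ### Generators and intertwiners -/

namespace AffineYokonumaHecke

open scoped TensorProduct

section Generators

variable {r n : ℕ} {q : ℂ}

theorem Yhat.lift_gens (y : Yhat r n q) : (Yhat.gens r n q).lift y = y := by
  obtain ⟨x, rfl⟩ := RingQuot.mkAlgHom_surjective ℂ (Rel r n q) y
  change (Yhat.gens r n q).lift (Yhat.mk r n q x) = Yhat.mk r n q x
  rw [Family.lift_mk]
  refine DFunLike.congr_fun (FreeAlgebra.hom_ext ?_) x
  funext a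
  cases a <;> simp [Family.onGen, Yhat.gens]

theorem Family.lift_XX {A : Type*} [Ring A] [Algebra ℂ A] (F : Family r n q A) :
    ∀ (j : ℕ) (h : j < n), F.lift ((Yhat.gens r n q).XX j h) = F.XX j h
  | 0, h => F.lift_X h
  | j + 1, h => by simp only [Family.XX, map_mul, F.lift_XX j, lift_g]

theorem Family.left_XX {k l : ℕ} {A : Type*} [Ring A] [Algebra ℂ A] (F : Family r (k + l) q A) :
    ∀ (j : ℕ) (h : j < k), F.left.XX j h = F.XX j (by omega)
  | 0, _ => rfl
  | j + 1, h => by simp only [Family.XX, F.left_XX j]; rfl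

theorem Family.right_XX {k l : ℕ} {A : Type*} [Ring A] [Algebra ℂ A] (F : Family r (k + l) q A) :
    ∀ (j : ℕ) (h : j < l), F.right.XX j h = F.XX (k + j) (by omega)
  | 0, _ => rfl
  | j + 1, h => by
    have := F.right_XX j (Nat.lt_of_succ_lt h)
    rw [Family.XX, this]
    rfl

/-- A linear map that commutes with the actions of `t_j`, `g_i` and `X₁` is equivariant for the
whole algebra; the target may carry the action through any family of generators. -/
theorem Family.intertwine {A : Type*} [Ring A] [Algebra ℂ A] (F : Family r n q A)
    {M N : Type*} [AddCommGroup M] [Module ℂ M] [Module (Yhat r n q) M]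
    [IsScalarTower ℂ (Yhat r n q) M] [AddCommGroup N] [Module ℂ N] [Module A N]
    [IsScalarTower ℂ A N] (L : M →ₗ[ℂ] N)
    (ht : ∀ j m, L ((Yhat.gens r n q).t j • m) = F.t j • L m)
    (hg : ∀ i h m, L ((Yhat.gens r n q).g i h • m) = F.g i h • L m)
    (hX : ∀ h m, L ((Yhat.gens r n q).X h • m) = F.X h • L m) (y : Yhat r n q) (m : M) :
    L (y • m) = F.lift y • L m := by
  let S : Subalgebra ℂ (Yhat r n q) :=
    { carrier := {y | ∀ m, L (y • m) = F.lift y • L m}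
      mul_mem' := fun {a b} ha hb m => by rw [mul_smul, ha, hb, map_mul, mul_smul]
      add_mem' := fun {a b} ha hb m => by rw [add_smul, map_add, ha, hb, map_add, add_smul]
      algebraMap_mem' := fun c m => by
        rw [AlgHom.commutes, algebraMap_smul, algebraMap_smul, map_smul] }
  have h := (Yhat.gens r n q).lift_mem S (fun j m => by rw [F.lift_t]; exact ht j m)
    (fun i h m => by rw [F.lift_g]; exact hg i h m) (fun h m => by rw [F.lift_X]; exact hX h m)
    (fun h m => by
      have h1 := hX h ((Yhat.gens r n q).Xinv h • m)
      rw [smul_smul, (Yhat.gens r n q).X_Xinv, one_smul] at h1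
      rw [F.lift_Xinv, h1, smul_smul, F.Xinv_X, one_smul]) y
  rw [Yhat.lift_gens] at h
  exact h m

/-- The elements of an algebra that map a subspace of a module into itself. -/
def stabilizer (A : Type*) {M : Type*} [Ring A] [Algebra ℂ A] [AddCommGroup M] [Module ℂ M]
    [Module A M] [IsScalarTower ℂ A M] (W : Submodule ℂ M) : Subalgebra ℂ A where
  carrier := {a | ∀ x ∈ W, a • x ∈ W}
  mul_mem' {a b} ha hb x hx := by rw [mul_smul]; exact ha _ (hb _ hx)
  add_mem' {a b} ha hb x hx := by rw [add_smul]; exact W.add_mem (ha _ hx) (hb _ hx)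
  algebraMap_mem' c x hx := by rw [algebraMap_smul]; exact W.smul_mem c hx

theorem mem_stabilizer {A M : Type*} [Ring A] [Algebra ℂ A] [AddCommGroup M] [Module ℂ M]
    [Module A M] [IsScalarTower ℂ A M] {W : Submodule ℂ M} {a : A} :
    a ∈ stabilizer A W ↔ ∀ x ∈ W, a • x ∈ W := Iff.rfl

/-- A finite dimensional subspace stable under `t_j`, `g_i` and `X₁` is a submodule: the injective
operator `X₁` maps it onto itself, so that it is stable under `X₁⁻¹` as well. -/
theorem Yhat.smul_mem_of_gens {M : Type*} [AddCommGroup M] [Module ℂ M] [Module (Yhat r n q) M]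
    [IsScalarTower ℂ (Yhat r n q) M] (W : Submodule ℂ M) [FiniteDimensional ℂ W]
    (ht : ∀ j, (Yhat.gens r n q).t j ∈ stabilizer _ W)
    (hg : ∀ i h, (Yhat.gens r n q).g i h ∈ stabilizer _ W)
    (hX : ∀ h, (Yhat.gens r n q).X h ∈ stabilizer _ W) (y : Yhat r n q) {x : M} (hx : x ∈ W) :
    y • x ∈ W := by
  have h := (Yhat.gens r n q).lift_mem (stabilizer _ W) ht hg hX (fun h x hx => by
    let f : W →ₗ[ℂ] W := ((Algebra.lsmul ℂ ℂ M) ((Yhat.gens r n q).X h)).restrict (hX h)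
    have hf : Function.Injective f := fun a b hab => by
      have h1 : (Yhat.gens r n q).X h • (a : M) = (Yhat.gens r n q).X h • (b : M) :=
        congrArg Subtype.val hab
      have h2 := congrArg ((Yhat.gens r n q).Xinv h • ·) h1
      simp only [smul_smul, (Yhat.gens r n q).Xinv_X, one_smul] at h2
      exact Subtype.ext h2
    obtain ⟨a, ha⟩ := (LinearMap.injective_iff_surjective.1 hf) ⟨x, hx⟩
    have h1 : (Yhat.gens r n q).X h • (a : M) = x := congrArg Subtype.val ha
    rw [← h1, smul_smul, (Yhat.gens r n q).Xinv_X, one_smul]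
    exact a.2) y
  rw [Yhat.lift_gens] at h
  exact h x hx

end Generators

section Boxes

variable {q : ℂ} {C : ContentDomain q} {r n : ℕ} (P : PlacedShape C r n)

/-- The boxes, sorted by components. -/
def PlacedShape.boxEquiv : P.Box ≃ Σ p, {x : ℤ × ℤ // x ∈ P.shape p} where
  toFun b := ⟨b.1.1, b.1.2, b.2⟩
  invFun b := ⟨(b.1, b.2.1), b.2.2⟩
  left_inv _ := rfl
  right_inv _ := rfl

instance PlacedShape.finite_box : Finite P.Box := Finite.of_equiv _ P.boxEquiv.symm

theorem PlacedShape.card_box : Nat.card P.Box = n := by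
  rw [Nat.card_congr P.boxEquiv, Nat.card_sigma]
  exact (by simp : _ = ∑ p, (P.shape p).card).trans P.card

end Boxes

namespace CalMod

variable {q : ℂ} {C : ContentDomain q} {r n : ℕ} [NeZero r] {ζ : ℂ} (hζ : IsPrimitiveRoot ζ r)
  (P : PlacedShape C r n)

/-- The basis of the vectors `w_T`, `T` a standard tableau. -/
noncomputable def basis : Module.Basis P.Std ℂ (CalMod hζ P) :=
  (Finsupp.basisSingleOne : Module.Basis P.Std ℂ (P.Std →₀ ℂ))

theorem basis_apply (T : P.Std) : basis hζ P T = vec hζ P T.1 :=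
  (congrFun Finsupp.coe_basisSingleOne T).trans (P.w_of_std T.2).symm

theorem isCalibrated : IsCalibrated r n q ζ (CalMod hζ P) := by
  refine ⟨P.Std, inferInstance, basis hζ P,
    fun T i => ⟨⟨P.val (T.1.symm i), P.val_ne_zero _, ?_⟩, P.comp (T.1.symm i), ?_⟩⟩
  · rw [basis_apply]; exact XX_smul_vec hζ P T.1 i
  · rw [basis_apply]; exact t_smul_vec hζ P T.1 i

end CalMod

end AffineYokonumaHecke

/-! ### Seminormal representations from abstract data -/

namespace AffineYokonumaHecke

section Coefficients

variable {r : ℕ} (q : ℂ) {β : Type*} (comp : β → Fin r) (val : β → ℂ)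

/-- The off-diagonal coefficient of the seminormal form, for boxes `x` and `y` with components
`comp` and eigenvalues `val`. -/
noncomputable def swapCoeff (x y : β) : ℂ :=
  if comp x = comp y then (q * val y - q⁻¹ * val x) / (val y - val x) else 1

end Coefficients

/-- What the seminormal formulas need in order to define a representation of `Ŷ_{r,n}`: boxes with
components and eigenvalues, and a relation `Before` whose monotone labellings are the standard ones.
The formulas have no poles at labels that interact in a braid relation, and a swap that leads out of
the standard labellings carries the coefficient zero in one of the two directions. -/
structure SeminormalDatum (r n : ℕ) (q : ℂ) where
  Box : Type
  comp : Box → Fin r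
  val : Box → ℂ
  Before : Box → Box → Prop
  q_ne_zero : q ≠ 0
  val_ne_zero : ∀ x, val x ≠ 0
  val_symm_ne : ∀ {T : Box ≃ Fin n}, (∀ x y, Before x y → T x < T y) → ∀ {i j : Fin n},
    comp (T.symm i) = comp (T.symm j) → i ≠ j → (i : ℕ) < j + 3 → (j : ℕ) < i + 3 →
    val (T.symm i) ≠ val (T.symm j)
  coeff_mul_eq_zero : ∀ {T : Box ≃ Fin n}, (∀ x y, Before x y → T x < T y) →
    ∀ {i : ℕ} {h : i + 1 < n}, ¬ (∀ x y, Before x y → T.trans (sw i h) x < T.trans (sw i h) y) →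
    swapCoeff q comp val (T.symm ⟨i, Nat.lt_of_succ_lt h⟩) (T.symm ⟨i + 1, h⟩) *
      swapCoeff q comp val (T.symm ⟨i + 1, h⟩) (T.symm ⟨i, Nat.lt_of_succ_lt h⟩) = 0

namespace SeminormalDatum

variable {q : ℂ} {r n : ℕ} (D : SeminormalDatum r n q)

/-- The coefficient of `w_T` in `g_i w_T`, for `x` and `y` the boxes of `T` labelled `i` and
`i + 1`. -/
noncomputable def cA (x y : D.Box) : ℂ :=
  if D.comp x = D.comp y then D.val y * (q - q⁻¹) / (D.val y - D.val x) else 0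

/-- The coefficient of `w_{s_i T}` in `g_i w_T`. -/
noncomputable def cB (x y : D.Box) : ℂ := swapCoeff q D.comp D.val x y

/-- A labelling of the boxes by `n` labels (numbered from `0` in the code) is standard if it is
monotone for the relation `Before`. -/
def IsStd (T : D.Box ≃ Fin n) : Prop := ∀ x y, D.Before x y → T x < T y

/-- The standard tableaux. -/
abbrev Std : Type := {T : D.Box ≃ Fin n // D.IsStd T}

/-- The tableau `s_i T`. -/
def act (i : ℕ) (h : i + 1 < n) (T : D.Box ≃ Fin n) : D.Box ≃ Fin n := T.trans (sw i h)

open Classical in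
/-- The basis vector `w_T`, with `w_T = 0` if the labelling `T` is not standard. -/
noncomputable def w (T : D.Box ≃ Fin n) : D.Std →₀ ℂ :=
  if h : D.IsStd T then Finsupp.single ⟨T, h⟩ 1 else 0

/-- The operator `w_T ↦ ζ_{p(T|j)} w_T`, where `ζ_p` is `ζ ^ p` for `p = 0, …, r - 1`. -/
noncomputable def tOp (ζ : ℂ) (j : Fin n) : Module.End ℂ (D.Std →₀ ℂ) :=
  Finsupp.linearCombination ℂ fun T => ζ ^ (D.comp (T.1.symm j) : ℕ) • D.w T.1

/-- The operator `w_T ↦ q^{2 c(T|j)} w_T`. -/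
noncomputable def xOp (j : Fin n) : Module.End ℂ (D.Std →₀ ℂ) :=
  Finsupp.linearCombination ℂ fun T => D.val (T.1.symm j) • D.w T.1

/-- The operator `w_T ↦ q^{-2 c(T|j)} w_T`. -/
noncomputable def xinvOp (j : Fin n) : Module.End ℂ (D.Std →₀ ℂ) :=
  Finsupp.linearCombination ℂ fun T => (D.val (T.1.symm j))⁻¹ • D.w T.1

/-- The operator by which `g_i` acts. -/
noncomputable def gOp (i : ℕ) (h : i + 1 < n) : Module.End ℂ (D.Std →₀ ℂ) :=
  Finsupp.linearCombination ℂ fun T =>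
    D.cA (T.1.symm ⟨i, Nat.lt_of_succ_lt h⟩) (T.1.symm ⟨i + 1, h⟩) • D.w T.1 +
    D.cB (T.1.symm ⟨i, Nat.lt_of_succ_lt h⟩) (T.1.symm ⟨i + 1, h⟩) • D.w (D.act i h T.1)

theorem w_of_std {T : D.Box ≃ Fin n} (h : D.IsStd T) : D.w T = Finsupp.single ⟨T, h⟩ 1 :=
  dif_pos h

theorem w_of_not {T : D.Box ≃ Fin n} (h : ¬ D.IsStd T) : D.w T = 0 := dif_neg h

theorem end_ext {f g : Module.End ℂ (D.Std →₀ ℂ)}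
    (h : ∀ T, D.IsStd T → f (D.w T) = g (D.w T)) : f = g := by
  refine Finsupp.lhom_ext' fun T => LinearMap.ext_ring ?_
  have := h T.1 T.2
  rw [D.w_of_std T.2] at this
  exact this

theorem tOp_w (ζ : ℂ) (j : Fin n) (T) :
    D.tOp ζ j (D.w T) = ζ ^ (D.comp (T.symm j) : ℕ) • D.w T := by
  by_cases h : D.IsStd T
  · conv_lhs => rw [D.w_of_std h, tOp, Finsupp.linearCombination_single, one_smul]
  · simp [D.w_of_not h]

theorem xOp_w (j : Fin n) (T) : D.xOp j (D.w T) = D.val (T.symm j) • D.w T := by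
  by_cases h : D.IsStd T
  · conv_lhs => rw [D.w_of_std h, xOp, Finsupp.linearCombination_single, one_smul]
  · simp [D.w_of_not h]

theorem xinvOp_w (j : Fin n) (T) : D.xinvOp j (D.w T) = (D.val (T.symm j))⁻¹ • D.w T := by
  by_cases h : D.IsStd T
  · conv_lhs => rw [D.w_of_std h, xinvOp, Finsupp.linearCombination_single, one_smul]
  · simp [D.w_of_not h]

theorem gOp_w (i : ℕ) (h : i + 1 < n) {T} (hT : D.IsStd T) : D.gOp i h (D.w T) =
    D.cA (T.symm ⟨i, Nat.lt_of_succ_lt h⟩) (T.symm ⟨i + 1, h⟩) • D.w T +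
    D.cB (T.symm ⟨i, Nat.lt_of_succ_lt h⟩) (T.symm ⟨i + 1, h⟩) • D.w (D.act i h T) := by
  conv_lhs => rw [D.w_of_std hT, gOp, Finsupp.linearCombination_single, one_smul]

theorem cB_mul_cB {T : D.Box ≃ Fin n} (hT : D.IsStd T) {i : ℕ} {h : i + 1 < n}
    (hs : ¬ D.IsStd (D.act i h T)) :
    D.cB (T.symm ⟨i, Nat.lt_of_succ_lt h⟩) (T.symm ⟨i + 1, h⟩) *
      D.cB (T.symm ⟨i + 1, h⟩) (T.symm ⟨i, Nat.lt_of_succ_lt h⟩) = 0 :=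
  D.coeff_mul_eq_zero hT hs

theorem not_std_trans {T : D.Box ≃ Fin n} (hT : D.IsStd T) {σ τ : Equiv.Perm (Fin n)}
    (hστ : ∀ a b, a < b → ¬ σ a < σ b → ¬ τ a < τ b) (h : ¬ D.IsStd (T.trans σ)) :
    ¬ D.IsStd (T.trans τ) := by
  simp only [IsStd, not_forall] at h ⊢
  obtain ⟨x, y, hxy, hn⟩ := h
  exact ⟨x, y, hxy, hστ _ _ (hT x y hxy) hn⟩

theorem act_act (i : ℕ) (h : i + 1 < n) (T) : D.act i h (D.act i h T) = T := by
  ext x; simp [act, sw]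

theorem act_symm (i : ℕ) (h : i + 1 < n) (T) (j : Fin n) :
    (D.act i h T).symm j = T.symm (sw i h j) := by
  simp [act, sw]

/-- The formula for `g_j w_{s_i T}` holds even if `s_i T` is not standard, once it is multiplied by
the coefficient with which `w_{s_i T}` occurs in `g_i w_T`. -/
theorem rule {T : D.Box ≃ Fin n} (hT : D.IsStd T) (i j : ℕ) (h : i + 1 < n) (h' : j + 1 < n) :
    D.cB (T.symm ⟨i, Nat.lt_of_succ_lt h⟩) (T.symm ⟨i + 1, h⟩) •
      D.gOp j h' (D.w (D.act i h T)) =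
    D.cB (T.symm ⟨i, Nat.lt_of_succ_lt h⟩) (T.symm ⟨i + 1, h⟩) •
      (D.cA ((D.act i h T).symm ⟨j, Nat.lt_of_succ_lt h'⟩) ((D.act i h T).symm ⟨j + 1, h'⟩) •
        D.w (D.act i h T) +
      D.cB ((D.act i h T).symm ⟨j, Nat.lt_of_succ_lt h'⟩) ((D.act i h T).symm ⟨j + 1, h'⟩) •
        D.w (D.act j h' (D.act i h T))) := by
  by_cases hs : D.IsStd (D.act i h T)
  · rw [D.gOp_w j h' hs]
  · rw [D.w_of_not hs]
    simp only [map_zero, smul_zero, zero_add]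
    rcases eq_or_ne i j with rfl | hij
    · have := D.cB_mul_cB hT hs
      simp only [act_symm, sw, Equiv.swap_apply_left, Equiv.swap_apply_right]
      rw [smul_smul, this, zero_smul]
    · have : ¬ D.IsStd (D.act j h' (D.act i h T)) := by
        refine D.not_std_trans (σ := sw i h) (τ := (sw i h).trans (sw j h')) hT ?_ hs
        intro a b hab hn
        simp only [Equiv.trans_apply, PlacedShape.sw_val, Fin.lt_def] at hab hn ⊢
        split_ifs at hn ⊢ <;> omega
      rw [D.w_of_not this]
      simp

/-- The same for `g_i w_{s_j s_i T}`, as needed for the braid relation. -/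
theorem rule2 {T : D.Box ≃ Fin n} (hT : D.IsStd T) (i j : ℕ) (h : i + 1 < n) (h' : j + 1 < n)
    (hij : i = j + 1 ∨ j = i + 1) :
    (D.cB (T.symm ⟨i, Nat.lt_of_succ_lt h⟩) (T.symm ⟨i + 1, h⟩) *
      D.cB ((D.act i h T).symm ⟨j, Nat.lt_of_succ_lt h'⟩) ((D.act i h T).symm ⟨j + 1, h'⟩)) •
      D.gOp i h (D.w (D.act j h' (D.act i h T))) =
    (D.cB (T.symm ⟨i, Nat.lt_of_succ_lt h⟩) (T.symm ⟨i + 1, h⟩) *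
      D.cB ((D.act i h T).symm ⟨j, Nat.lt_of_succ_lt h'⟩) ((D.act i h T).symm ⟨j + 1, h'⟩)) •
      (D.cA ((D.act j h' (D.act i h T)).symm ⟨i, Nat.lt_of_succ_lt h⟩)
        ((D.act j h' (D.act i h T)).symm ⟨i + 1, h⟩) • D.w (D.act j h' (D.act i h T)) +
      D.cB ((D.act j h' (D.act i h T)).symm ⟨i, Nat.lt_of_succ_lt h⟩)
        ((D.act j h' (D.act i h T)).symm ⟨i + 1, h⟩) •
        D.w (D.act i h (D.act j h' (D.act i h T)))) := by
  by_cases hs : D.IsStd (D.act j h' (D.act i h T))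
  · rw [D.gOp_w i h hs]
  · have : ¬ D.IsStd (D.act i h (D.act j h' (D.act i h T))) := by
      refine D.not_std_trans (σ := (sw i h).trans (sw j h'))
        (τ := ((sw i h).trans (sw j h')).trans (sw i h)) hT ?_ hs
      intro a b hab hn
      simp only [Equiv.trans_apply, Fin.lt_def] at hab hn ⊢
      have h1 := PlacedShape.sw_cases i h a
      have h2 := PlacedShape.sw_cases j h' (sw i h a)
      have h3 := PlacedShape.sw_cases i h (sw j h' (sw i h a))
      have h4 := PlacedShape.sw_cases i h b
      have h5 := PlacedShape.sw_cases j h' (sw i h b)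
      have h6 := PlacedShape.sw_cases i h (sw j h' (sw i h b))
      generalize (sw i h (sw j h' (sw i h a)) : ℕ) = a3 at *
      generalize (sw i h (sw j h' (sw i h b)) : ℕ) = b3 at *
      generalize (sw j h' (sw i h a) : ℕ) = a2 at *
      generalize (sw j h' (sw i h b) : ℕ) = b2 at *
      generalize (sw i h a : ℕ) = a1 at *
      generalize (sw i h b : ℕ) = b1 at *
      clear hs
      grind
    rw [D.w_of_not hs, D.w_of_not this]
    simp

theorem xx_gOp (i : ℕ) (h : i + 1 < n) :
    D.gOp i h * D.xOp ⟨i, Nat.lt_of_succ_lt h⟩ * D.gOp i h = D.xOp ⟨i + 1, h⟩ := by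
  refine D.end_ext fun T hT => ?_
  have hr := D.rule hT i i h h
  simp only [Module.End.mul_apply, D.gOp_w i h hT, map_add, map_smul, xOp_w, act_act, act_symm, sw,
    Equiv.swap_apply_left, Equiv.swap_apply_right] at hr ⊢
  rw [smul_comm (D.cB _ _) (D.val _) (D.gOp i h _), hr]
  have hne := fun hp => D.val_symm_ne hT (i := ⟨i, Nat.lt_of_succ_lt h⟩) (j := ⟨i + 1, h⟩) hp
    (by simp) (by simp only; omega) (by simp only; omega)
  have hx := D.val_ne_zero (T.symm ⟨i, Nat.lt_of_succ_lt h⟩)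
  have hy := D.val_ne_zero (T.symm ⟨i + 1, h⟩)
  generalize T.symm ⟨i, Nat.lt_of_succ_lt h⟩ = x at *
  generalize T.symm ⟨i + 1, h⟩ = y at *
  have hq := D.q_ne_zero
  have h1 : D.cA x y * D.val x * D.cA x y + D.val y * D.cB x y * D.cB y x = D.val y := by
    simp only [cA, cB, swapCoeff]
    by_cases hp : D.comp x = D.comp y
    · have hne' := hne hp
      have e1 := sub_ne_zero.2 hne'
      have e2 := sub_ne_zero.2 hne'.symm
      simp only [hp, if_true]
      field_simp
      ring
    · simp [hp, Ne.symm hp]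
  have h2 : D.cA x y * D.val x * D.cB x y + D.val y * D.cB x y * D.cA y x = 0 := by
    simp only [cA, cB, swapCoeff]
    by_cases hp : D.comp x = D.comp y
    · have hne' := hne hp
      have e1 := sub_ne_zero.2 hne'
      have e2 := sub_ne_zero.2 hne'.symm
      simp only [hp, if_true]
      field_simp
      ring
    · simp [hp, Ne.symm hp]
  linear_combination (norm := module) h1 • D.w T + h2 • D.w (D.act i h T)

theorem xOp_comm (i j : Fin n) : D.xOp i * D.xOp j = D.xOp j * D.xOp i := by
  refine D.end_ext fun T hT => ?_
  simp only [Module.End.mul_apply, xOp_w, map_smul, smul_smul, mul_comm]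

theorem gOp_xOp (i : ℕ) (h : i + 1 < n) (j : Fin n) (hj : sw i h j = j) :
    D.gOp i h * D.xOp j = D.xOp j * D.gOp i h := by
  refine D.end_ext fun T hT => ?_
  simp only [Module.End.mul_apply, xOp_w, map_smul, D.gOp_w i h hT, map_add, act_symm, hj]
  module

theorem gOp_tOp (ζ : ℂ) (i : ℕ) (h : i + 1 < n) (j : Fin n) :
    D.gOp i h * D.tOp ζ j = D.tOp ζ (sw i h j) * D.gOp i h := by
  refine D.end_ext fun T hT => ?_
  have hs : sw i h (sw i h j) = j := by simp [sw]
  simp only [Module.End.mul_apply, tOp_w, map_smul, D.gOp_w i h hT, map_add, act_symm, hs]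
  have key : D.cA (T.symm ⟨i, Nat.lt_of_succ_lt h⟩) (T.symm ⟨i + 1, h⟩) = 0 ∨
      D.comp (T.symm (sw i h j)) = D.comp (T.symm j) := by
    by_cases hp : D.comp (T.symm ⟨i, Nat.lt_of_succ_lt h⟩) = D.comp (T.symm ⟨i + 1, h⟩)
    · right
      simp only [sw, Equiv.swap_apply_def]
      split_ifs with h1 h2
      · rw [h1, hp]
      · rw [h2, hp]
      · rfl
    · left
      simp [cA, hp]
  rcases key with h0 | h0 <;> rw [h0] <;> module

theorem tOp_pow_w (ζ : ℂ) (j : Fin n) (s : ℕ) (T) :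
    (D.tOp ζ j ^ s) (D.w T) = (ζ ^ (D.comp (T.symm j) : ℕ)) ^ s • D.w T := by
  induction s with
  | zero => simp
  | succ s ih => rw [pow_succ', Module.End.mul_apply, ih, map_smul, tOp_w, smul_smul, pow_succ]

theorem idem_w [NeZero r] {ζ : ℂ} (hζ : IsPrimitiveRoot ζ r) (i j : Fin n) (T) :
    idem r (D.tOp ζ i) (D.tOp ζ j) (D.w T)
      = (if D.comp (T.symm i) = D.comp (T.symm j) then 1 else 0 : ℂ) • D.w T := by
  rw [← PlacedShape.sum_zeta hζ, mul_smul, Finset.sum_smul]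
  simp only [idem, LinearMap.smul_apply, LinearMap.sum_apply, Module.End.mul_apply, tOp_pow_w,
    map_smul, smul_smul]
  congr 1
  exact Finset.sum_congr rfl fun s _ => by rw [mul_comm]

theorem quad_gOp [NeZero r] {ζ : ℂ} (hζ : IsPrimitiveRoot ζ r) (i : ℕ) (h : i + 1 < n) :
    D.gOp i h * D.gOp i h = 1 + (q - q⁻¹) •
      (idem r (D.tOp ζ ⟨i, Nat.lt_of_succ_lt h⟩) (D.tOp ζ ⟨i + 1, h⟩) * D.gOp i h) := by
  refine D.end_ext fun T hT => ?_
  have hr := D.rule hT i i h h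
  simp only [Module.End.mul_apply, LinearMap.add_apply, LinearMap.smul_apply, Module.End.one_apply,
    D.gOp_w i h hT, map_add, map_smul, D.idem_w hζ, act_act, act_symm, sw,
    Equiv.swap_apply_left, Equiv.swap_apply_right] at hr ⊢
  rw [hr]
  have hne := fun hp => D.val_symm_ne hT (i := ⟨i, Nat.lt_of_succ_lt h⟩) (j := ⟨i + 1, h⟩) hp
    (by simp) (by simp only; omega) (by simp only; omega)
  generalize T.symm ⟨i, Nat.lt_of_succ_lt h⟩ = x at *
  generalize T.symm ⟨i + 1, h⟩ = y at *
  have hq := D.q_ne_zero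
  have h1 : D.cA x y * D.cA x y + D.cB x y * D.cB y x = 1 + (q - q⁻¹) * (D.cA x y *
      (if D.comp x = D.comp y then 1 else 0)) := by
    simp only [cA, cB, swapCoeff]
    by_cases hp : D.comp x = D.comp y
    · have hne' := hne hp
      have e1 := sub_ne_zero.2 hne'
      have e2 := sub_ne_zero.2 hne'.symm
      simp only [hp, if_true]
      field_simp
      ring
    · simp [hp, Ne.symm hp]
  have h2 : D.cA x y * D.cB x y + D.cB x y * D.cA y x = (q - q⁻¹) * (D.cB x y *
      (if D.comp y = D.comp x then 1 else 0)) := by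
    simp only [cA, cB, swapCoeff]
    by_cases hp : D.comp x = D.comp y
    · have hne' := hne hp
      have e1 := sub_ne_zero.2 hne'
      have e2 := sub_ne_zero.2 hne'.symm
      simp only [hp, if_true]
      field_simp
      ring
    · simp [hp, Ne.symm hp]
  linear_combination (norm := module) h1 • D.w T + h2 • D.w (D.act i h T)

theorem gOp_far (i j : ℕ) (h : i + 1 < n) (h' : j + 1 < n) (hij : i + 2 ≤ j) :
    D.gOp i h * D.gOp j h' = D.gOp j h' * D.gOp i h := by
  refine D.end_ext fun T hT => ?_
  have hr := D.rule hT i j h h'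
  have hr' := D.rule hT j i h' h
  have e1 : sw i h ⟨j, Nat.lt_of_succ_lt h'⟩ = ⟨j, Nat.lt_of_succ_lt h'⟩ := by
    ext; rw [PlacedShape.sw_val]; simp only; split_ifs <;> omega
  have e2 : sw i h ⟨j + 1, h'⟩ = ⟨j + 1, h'⟩ := by
    ext; rw [PlacedShape.sw_val]; simp only; split_ifs <;> omega
  have e3 : sw j h' ⟨i, Nat.lt_of_succ_lt h⟩ = ⟨i, Nat.lt_of_succ_lt h⟩ := by
    ext; rw [PlacedShape.sw_val]; simp only; split_ifs <;> omega
  have e4 : sw j h' ⟨i + 1, h⟩ = ⟨i + 1, h⟩ := by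
    ext; rw [PlacedShape.sw_val]; simp only; split_ifs <;> omega
  have e5 : D.act j h' (D.act i h T) = D.act i h (D.act j h' T) := by
    ext x
    simp only [act, Equiv.trans_apply, PlacedShape.sw_val]
    split_ifs <;> omega
  simp only [Module.End.mul_apply, D.gOp_w i h hT, D.gOp_w j h' hT, map_add, map_smul, act_symm,
    e1, e2, e3, e4, e5] at hr hr' ⊢
  rw [hr, hr']
  module

theorem gOp_braid (i : ℕ) (h' : i + 1 < n) (h : i + 1 + 1 < n) :
    D.gOp i h' * D.gOp (i + 1) h * D.gOp i h' = D.gOp (i + 1) h * D.gOp i h' * D.gOp (i + 1) h := by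
  refine D.end_ext fun T hT => ?_
  have r1 := D.rule hT i i h' h'
  have r2 := D.rule hT i (i + 1) h' h
  have r3 := D.rule hT (i + 1) i h h'
  have r4 := D.rule hT (i + 1) (i + 1) h h
  have r5 := D.rule2 hT i (i + 1) h' h (by omega)
  have r6 := D.rule2 hT (i + 1) i h h' (by omega)
  have e1 : sw i h' ⟨i, Nat.lt_of_succ_lt h'⟩ = ⟨i + 1, h'⟩ := by simp [sw]
  have e2 : sw i h' ⟨i + 1, h'⟩ = ⟨i, Nat.lt_of_succ_lt h'⟩ := by simp [sw]
  have e3 : sw i h' ⟨i + 1 + 1, h⟩ = ⟨i + 1 + 1, h⟩ := by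
    ext; rw [PlacedShape.sw_val]; simp only; split_ifs <;> omega
  have e4 : sw (i + 1) h ⟨i, Nat.lt_of_succ_lt h'⟩ = ⟨i, Nat.lt_of_succ_lt h'⟩ := by
    ext; rw [PlacedShape.sw_val]; simp only; split_ifs <;> omega
  have e5 : sw (i + 1) h ⟨i + 1, h'⟩ = ⟨i + 1 + 1, h⟩ := by simp [sw]
  have e6 : sw (i + 1) h ⟨i + 1 + 1, h⟩ = ⟨i + 1, h'⟩ := by simp [sw]
  have e7 : D.act i h' (D.act (i + 1) h (D.act i h' T))
      = D.act (i + 1) h (D.act i h' (D.act (i + 1) h T)) := by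
    ext x
    simp only [act, Equiv.trans_apply]
    have h1 := PlacedShape.sw_cases i h' (T x)
    have h2 := PlacedShape.sw_cases (i + 1) h (sw i h' (T x))
    have h3 := PlacedShape.sw_cases i h' (sw (i + 1) h (sw i h' (T x)))
    have h4 := PlacedShape.sw_cases (i + 1) h (T x)
    have h5 := PlacedShape.sw_cases i h' (sw (i + 1) h (T x))
    have h6 := PlacedShape.sw_cases (i + 1) h (sw i h' (sw (i + 1) h (T x)))
    omega
  have n1 := fun hp => D.val_symm_ne hT (i := ⟨i, Nat.lt_of_succ_lt h'⟩) (j := ⟨i + 1, h'⟩) hp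
    (by simp) (by simp only; omega) (by simp only; omega)
  have n2 := fun hp => D.val_symm_ne hT (i := ⟨i + 1, h'⟩) (j := ⟨i + 1 + 1, h⟩) hp
    (by rw [Ne, Fin.mk.injEq]; omega) (by simp only; omega) (by simp only; omega)
  have n3 := fun hp => D.val_symm_ne hT (i := ⟨i, Nat.lt_of_succ_lt h'⟩) (j := ⟨i + 1 + 1, h⟩) hp
    (by rw [Ne, Fin.mk.injEq]; omega) (by simp only; omega) (by simp only; omega)
  simp only [Module.End.mul_apply, D.gOp_w i h' hT, D.gOp_w (i + 1) h hT, map_add, map_smul,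
    act_symm, act_act, e1, e2, e3, e4, e5, e6] at r1 r2 r3 r4 r5 r6 ⊢
  rw [e7] at r5
  have r2' := congrArg (D.gOp i h') r2
  have r3' := congrArg (D.gOp (i + 1) h) r3
  simp only [map_add, map_smul] at r2' r3'
  generalize D.w (D.act (i + 1) h (D.act i h' (D.act (i + 1) h T))) = w121 at *
  generalize D.w (D.act (i + 1) h (D.act i h' T)) = w12 at *
  generalize D.w (D.act i h' (D.act (i + 1) h T)) = w21 at *
  generalize D.w (D.act i h' T) = w1 at *
  generalize D.w (D.act (i + 1) h T) = w2 at *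
  generalize D.gOp i h' = G1 at *
  generalize D.gOp (i + 1) h = G2 at *
  generalize D.w T = w0 at *
  generalize T.symm ⟨i, Nat.lt_of_succ_lt h'⟩ = x at *
  generalize T.symm ⟨i + 1, h'⟩ = y at *
  generalize T.symm ⟨i + 1 + 1, h⟩ = z at *
  have hq := D.q_ne_zero
  -- what remains after the applications of the rules is a comparison of the coefficients of `w_T`,
  -- `w_{s_i T}` and `w_{s_{i+1} T}`
  have s0 : D.cA x y * D.cA y z * D.cA x y + D.cB x y * D.cA x z * D.cB y x
      = D.cA y z * D.cA x y * D.cA y z + D.cB y z * D.cA x z * D.cB z y := by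
    simp only [cA, cB, swapCoeff]
    by_cases h1 : D.comp x = D.comp y
    · have d1 := sub_ne_zero.2 (n1 h1)
      have d1' := sub_ne_zero.2 (n1 h1).symm
      by_cases h2 : D.comp y = D.comp z
      · have d2 := sub_ne_zero.2 (n2 h2)
        have d2' := sub_ne_zero.2 (n2 h2).symm
        have d3 := sub_ne_zero.2 (n3 (h1.trans h2))
        have d3' := sub_ne_zero.2 (n3 (h1.trans h2)).symm
        simp only [h1, h2, if_true]
        field_simp
        ring
      · simp [h1, h2, Ne.symm h2]
    · by_cases h2 : D.comp y = D.comp z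
      · simp [h1, ← h2, Ne.symm h1]
      · simp [h1, h2, Ne.symm h1, Ne.symm h2]
  have s1 : D.cA x y * D.cA y z * D.cB x y + D.cB x y * D.cA x z * D.cA y x
      = D.cA y z * D.cB x y * D.cA x z := by
    simp only [cA, cB, swapCoeff]
    by_cases h1 : D.comp x = D.comp y
    · have d1 := sub_ne_zero.2 (n1 h1)
      have d1' := sub_ne_zero.2 (n1 h1).symm
      by_cases h2 : D.comp y = D.comp z
      · have d2 := sub_ne_zero.2 (n2 h2)
        have d2' := sub_ne_zero.2 (n2 h2).symm
        have d3 := sub_ne_zero.2 (n3 (h1.trans h2))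
        have d3' := sub_ne_zero.2 (n3 (h1.trans h2)).symm
        simp only [h1, h2, if_true]
        field_simp
        ring
      · simp [h1, h2]
    · by_cases h2 : D.comp y = D.comp z
      · simp [h1, ← h2, Ne.symm h1]
      · simp [h1, h2, Ne.symm h1]
  have s2 : D.cA x y * D.cB y z * D.cA x z
      = D.cA y z * D.cA x y * D.cB y z + D.cB y z * D.cA x z * D.cA z y := by
    simp only [cA, cB, swapCoeff]
    by_cases h1 : D.comp x = D.comp y
    · have d1 := sub_ne_zero.2 (n1 h1)
      have d1' := sub_ne_zero.2 (n1 h1).symm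
      by_cases h2 : D.comp y = D.comp z
      · have d2 := sub_ne_zero.2 (n2 h2)
        have d2' := sub_ne_zero.2 (n2 h2).symm
        have d3 := sub_ne_zero.2 (n3 (h1.trans h2))
        have d3' := sub_ne_zero.2 (n3 (h1.trans h2)).symm
        simp only [h1, h2, if_true]
        field_simp
        ring
      · simp [h1, h2, Ne.symm h2]
    · by_cases h2 : D.comp y = D.comp z
      · simp [h1, ← h2]
      · simp [h1, h2, Ne.symm h2]
  linear_combination (norm := module) D.cA x y • r3 + r2' + D.cA x z • r1 + r5 -
    D.cA y z • r2 - r3' - D.cA x z • r4 - r6 + s0 • w0 + s1 • w1 + s2 • w2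

/-- The operators by which the generators of `Ŷ_{r,n}` act on the span of the `w_T`. -/
noncomputable def ops [NeZero r] {ζ : ℂ} (hζ : IsPrimitiveRoot ζ r) :
    Family r n q (Module.End ℂ (D.Std →₀ ℂ)) where
  t j := D.tOp ζ j
  g i h := D.gOp i h
  X h := D.xOp ⟨0, h⟩
  Xinv h := D.xinvOp ⟨0, h⟩
  g_comm i j hi hj hij := D.gOp_far i j hi hj hij
  braid i h := D.gOp_braid i _ h
  t_comm i j := by
    refine D.end_ext fun T hT => ?_
    simp only [Module.End.mul_apply, tOp_w, map_smul, smul_smul, mul_comm]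
  g_t i h j := D.gOp_tOp ζ i h j
  t_pow j := by
    refine D.end_ext fun T hT => ?_
    rw [tOp_pow_w, ← pow_mul, mul_comm, pow_mul, hζ.pow_eq_one]
    simp
  quad i h := D.quad_gOp hζ i h
  X_Xinv h := by
    refine D.end_ext fun T hT => ?_
    simp [xOp_w, xinvOp_w, smul_smul, D.val_ne_zero]
  Xinv_X h := by
    refine D.end_ext fun T hT => ?_
    simp [xOp_w, xinvOp_w, smul_smul, D.val_ne_zero]
  gXgX h0 h := by
    have e := D.xx_gOp 0 h
    have c := D.xOp_comm ⟨0 + 1, h⟩ ⟨0, h0⟩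
    rw [← e] at c
    simpa only [mul_assoc] using c
  g_X i h0 h hi := D.gOp_xOp i h _ (by
    apply Equiv.swap_apply_of_ne_of_ne <;> rw [Ne, Fin.mk.injEq] <;> omega)
  t_X j h := by
    refine D.end_ext fun T hT => ?_
    simp only [Module.End.mul_apply, tOp_w, xOp_w, map_smul, smul_smul, mul_comm]

theorem ops_XX [NeZero r] {ζ : ℂ} (hζ : IsPrimitiveRoot ζ r) :
    ∀ (j : ℕ) (h : j < n), (D.ops hζ).XX j h = D.xOp ⟨j, h⟩
  | 0, h => rfl
  | j + 1, h => by
    rw [Family.XX, ops_XX hζ j]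
    exact D.xx_gOp j h

/-- The representation `Ŷ_{r,n} → End(⊕_T ℂ w_T)`. -/
noncomputable def rep [NeZero r] {ζ : ℂ} (hζ : IsPrimitiveRoot ζ r) :
    Yhat r n q →ₐ[ℂ] Module.End ℂ (D.Std →₀ ℂ) := (D.ops hζ).lift

/-- The space with basis `w_T`, `T` a standard labelling, as a module over `Ŷ_{r,n}`. -/
def Mod [NeZero r] {ζ : ℂ} (_hζ : IsPrimitiveRoot ζ r) : Type := D.Std →₀ ℂ

namespace Mod

variable [NeZero r] {ζ : ℂ} (hζ : IsPrimitiveRoot ζ r)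

noncomputable instance : AddCommGroup (D.Mod hζ) := inferInstanceAs (AddCommGroup (D.Std →₀ ℂ))

noncomputable instance : Module ℂ (D.Mod hζ) := inferInstanceAs (Module ℂ (D.Std →₀ ℂ))

noncomputable instance : Module (Yhat r n q) (D.Mod hζ) :=
  Module.compHom (D.Std →₀ ℂ) (D.rep hζ).toRingHom

theorem smul_def (a : Yhat r n q) (v : D.Mod hζ) :
    a • v = (D.rep hζ a : (D.Std →₀ ℂ) →ₗ[ℂ] (D.Std →₀ ℂ)) v := rfl

instance : IsScalarTower ℂ (Yhat r n q) (D.Mod hζ) where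
  smul_assoc c a v := by
    rw [smul_def, smul_def, map_smul]
    rfl

/-- The vector `w_T` (zero if the labelling `T` is not standard). -/
noncomputable def vec (T : D.Box ≃ Fin n) : D.Mod hζ := D.w T

/-- The basis of the vectors `w_T`, `T` a standard labelling. -/
noncomputable def basis : Module.Basis D.Std ℂ (D.Mod hζ) :=
  (Finsupp.basisSingleOne : Module.Basis D.Std ℂ (D.Std →₀ ℂ))

theorem basis_apply (T : D.Std) : basis D hζ T = vec D hζ T.1 :=
  (congrFun Finsupp.coe_basisSingleOne T).trans (D.w_of_std T.2).symm

theorem vec_of_not {T : D.Box ≃ Fin n} (h : ¬ D.IsStd T) : vec D hζ T = 0 := D.w_of_not h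

theorem t_smul_vec (T : D.Box ≃ Fin n) (j : Fin n) :
    (Yhat.gens r n q).t j • vec D hζ T = ζ ^ (D.comp (T.symm j) : ℕ) • vec D hζ T := by
  rw [smul_def, show D.rep hζ ((Yhat.gens r n q).t j) = D.tOp ζ j from Family.lift_t _ j]
  exact D.tOp_w ζ j T

theorem XX_smul_vec (T : D.Box ≃ Fin n) (j : ℕ) (h : j < n) :
    (Yhat.gens r n q).XX j h • vec D hζ T = D.val (T.symm ⟨j, h⟩) • vec D hζ T := by
  rw [smul_def, rep, Family.lift_XX, D.ops_XX]
  exact D.xOp_w ⟨j, h⟩ T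

theorem g_smul_vec {T : D.Box ≃ Fin n} (hT : D.IsStd T) (i : ℕ) (h : i + 1 < n) :
    (Yhat.gens r n q).g i h • vec D hζ T =
      D.cA (T.symm ⟨i, Nat.lt_of_succ_lt h⟩) (T.symm ⟨i + 1, h⟩) • vec D hζ T +
      D.cB (T.symm ⟨i, Nat.lt_of_succ_lt h⟩) (T.symm ⟨i + 1, h⟩) • vec D hζ (D.act i h T) := by
  rw [smul_def, show D.rep hζ ((Yhat.gens r n q).g i h) = D.gOp i h from Family.lift_g _ i h]
  exact D.gOp_w i h hT

end Mod

end SeminormalDatum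

end AffineYokonumaHecke

/-! ### The two placed shapes and their gluings -/

namespace AffineYokonumaHecke

/-- Two placed `r`-skew shapes with marked last boxes `u p` and first boxes `v p`, all of whose
gluings at the marked boxes are placed `r`-skew shapes. -/
structure GluePair {q : ℂ} (C : ContentDomain q) (r k l : ℕ) where
  θ : PlacedShape C r k
  φ : PlacedShape C r l
  u : Fin r → ℤ × ℤ
  v : Fin r → ℤ × ℤ
  hu : ∀ p, IsLastBox (θ.shape p) (u p)
  hv : ∀ p, IsFirstBox (φ.shape p) (v p)
  junction : ∀ p, θ.content p (u p) + 1 = φ.content p (v p)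
  isContent : ∀ (d : Dir) (p : Fin r),
    IsContent C (glueShape (θ.shape p) (φ.shape p) (u p) (v p) d)
      (glueContent (θ.shape p) (θ.content p) (φ.content p) (u p) (v p) d)

namespace GluePair

variable {q : ℂ} {C : ContentDomain q} {r k l : ℕ} (G : GluePair C r k l)

/-- The placed shape glued in the directions `w`. -/
def glue (w : Fin r → Dir) : PlacedShape C r (k + l) :=
  G.θ.glue G.φ G.hu G.hv w fun p => G.isContent (w p) p

/-- The boxes of both shapes. -/
abbrev Box : Type := G.θ.Box ⊕ G.φ.Box

/-- The component containing a box. -/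
def comp : G.Box → Fin r := Sum.elim G.θ.comp G.φ.comp

/-- `q^{2 c(x)}` for a box `x`. -/
noncomputable def val : G.Box → ℂ := Sum.elim G.θ.val G.φ.val

/-- `x` precedes `y` in a row or a column of one of the two shapes; boxes of different shapes are
not compared. -/
def Before : G.Box → G.Box → Prop := Sum.LiftRel G.θ.Before G.φ.Before

/-- The labellings of the boxes of both shapes that are standard on either shape. -/
def IsStd (T : G.Box ≃ Fin (k + l)) : Prop := ∀ x y, G.Before x y → T x < T y

/-- The last box of `θ^{(p)}`. -/
def last (p : Fin r) : G.Box := .inl ⟨(p, G.u p), (G.hu p).1⟩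

/-- The first box of `φ^{(p)}`. -/
def first (p : Fin r) : G.Box := .inr ⟨(p, G.v p), (G.hv p).1⟩

/-- The place of a box in the glued shape. -/
def place (w : Fin r → Dir) : G.Box → (G.glue w).Box
  | .inl x => ⟨x.1, Finset.mem_union_left _ x.2⟩
  | .inr y => ⟨(y.1.1, y.1.2 + (G.u y.1.1 + (w y.1.1).step - G.v y.1.1)),
      Finset.mem_union_right _ (Finset.mem_image_of_mem _ y.2)⟩

variable (w : Fin r → Dir)

theorem add_shift_notMem {p : Fin r} {y : ℤ × ℤ} (hy : y ∈ G.φ.shape p) (d : Dir) :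
    y + (G.u p + d.step - G.v p) ∉ G.θ.shape p := fun h =>
  (Finset.disjoint_left.1 (glueShape_disjoint (G.hu p) (G.hv p) d)) h
    (Finset.mem_image_of_mem (fun y => y + (G.u p + d.step - G.v p)) hy)

theorem place_bijective : Function.Bijective (G.place w) := by
  constructor
  · rintro (⟨⟨p, x⟩, hx⟩ | ⟨⟨p, x⟩, hx⟩) (⟨⟨p', y⟩, hy⟩ | ⟨⟨p', y⟩, hy⟩) h <;>
      obtain ⟨h1, h2⟩ := Prod.mk.inj (congrArg Subtype.val h) <;>
      obtain rfl := h1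
    · obtain rfl := h2
      rfl
    · exact (G.add_shift_notMem hy _ (h2 ▸ hx)).elim
    · exact (G.add_shift_notMem hx _ (h2 ▸ hy)).elim
    · obtain rfl := add_right_cancel h2
      rfl
  · rintro ⟨⟨p, x⟩, hx⟩
    rcases Finset.mem_union.1 hx with h | h
    · exact ⟨.inl ⟨(p, x), h⟩, rfl⟩
    · obtain ⟨y, hy, h2⟩ := Finset.mem_image.1 h
      exact ⟨.inr ⟨(p, y), hy⟩, Subtype.ext (Prod.ext rfl h2)⟩

/-- The boxes of both shapes are the boxes of the glued shape. -/
noncomputable def placeEquiv : G.Box ≃ (G.glue w).Box :=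
  Equiv.ofBijective _ (G.place_bijective w)

theorem comp_place (x : G.Box) : (G.glue w).comp (G.place w x) = G.comp x := by
  cases x <;> rfl

theorem content_place_inl (x : G.θ.Box) :
    (G.glue w).content (G.place w (.inl x)).1.1 (G.place w (.inl x)).1.2 =
      G.θ.content x.1.1 x.1.2 :=
  if_pos x.2

theorem content_place_inr (y : G.φ.Box) :
    (G.glue w).content (G.place w (.inr y)).1.1 (G.place w (.inr y)).1.2 =
      G.φ.content y.1.1 y.1.2 :=
  (if_neg (G.add_shift_notMem y.2 _)).trans
    (congrArg (G.φ.content y.1.1) (add_sub_cancel_right _ _))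

theorem val_place (x : G.Box) : (G.glue w).val (G.place w x) = G.val x := by
  cases x with
  | inl x => exact congrArg C.qpow (G.content_place_inl w x)
  | inr y => exact congrArg C.qpow (G.content_place_inr w y)

theorem cB_place (x y : G.Box) :
    (G.glue w).cB (G.place w x) (G.place w y) = swapCoeff q G.comp G.val x y := by
  simp only [PlacedShape.cB, swapCoeff, comp_place, val_place]

theorem cA_place (x y : G.Box) : (G.glue w).cA (G.place w x) (G.place w y) =
    if G.comp x = G.comp y then G.val y * (q - q⁻¹) / (G.val y - G.val x) else 0 := by
  simp only [PlacedShape.cA, comp_place, val_place]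

theorem before_place_inl_inl (x y : G.θ.Box) :
    (G.glue w).Before (G.place w (.inl x)) (G.place w (.inl y)) ↔ G.θ.Before x y := Iff.rfl

theorem before_place_inr_inr (x y : G.φ.Box) :
    (G.glue w).Before (G.place w (.inr x)) (G.place w (.inr y)) ↔ G.φ.Before x y := by
  obtain ⟨⟨p, x⟩, hx⟩ := x
  obtain ⟨⟨p', y⟩, hy⟩ := y
  simp only [PlacedShape.Before, place, Prod.fst_add, Prod.snd_add]
  refine and_congr_right ?_
  rintro rfl
  simp

/-- A box of `φ` to the right of a box of `θ` in a row of the glued shape: this row contains the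
junction, which is horizontal. -/
theorem before_place_inl_inr {x : G.θ.Box} {y : G.φ.Box}
    (h : (G.glue w).Before (G.place w (.inl x)) (G.place w (.inr y))) :
    x.1.1 = y.1.1 ∧ w x.1.1 = .horiz ∧ x.1.2.1 = (G.u x.1.1).1 ∧ y.1.2.1 = (G.v x.1.1).1 := by
  obtain ⟨⟨p, x⟩, hx⟩ := x
  obtain ⟨⟨p', y⟩, hy⟩ := y
  simp only [PlacedShape.Before, place, Prod.fst_add, Prod.snd_add, Prod.fst_sub,
    Prod.snd_sub] at h
  obtain ⟨rfl, h⟩ := h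
  have h1 := (G.hu p).corner (G.θ.isSkew p) hx
  have h2 := (G.hv p).corner (G.φ.isSkew p) hy
  dsimp only at *
  cases hd : w p <;> simp only [hd, Dir.step] at h
  · omega
  · refine ⟨rfl, rfl, ?_, ?_⟩ <;> omega

/-- A box of `φ` above a box of `θ` in a column of the glued shape: this column contains the
junction, which is vertical. -/
theorem before_place_inr_inl {x : G.θ.Box} {y : G.φ.Box}
    (h : (G.glue w).Before (G.place w (.inr y)) (G.place w (.inl x))) :
    x.1.1 = y.1.1 ∧ w x.1.1 = .vert ∧ x.1.2.2 = (G.u x.1.1).2 ∧ y.1.2.2 = (G.v x.1.1).2 := by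
  obtain ⟨⟨p, x⟩, hx⟩ := x
  obtain ⟨⟨p', y⟩, hy⟩ := y
  simp only [PlacedShape.Before, place, Prod.fst_add, Prod.snd_add, Prod.fst_sub,
    Prod.snd_sub] at h
  obtain ⟨rfl, h⟩ := h
  have h1 := (G.hu p').corner (G.θ.isSkew p') hx
  have h2 := (G.hv p').corner (G.φ.isSkew p') hy
  dsimp only at *
  cases hd : w p' <;> simp only [hd, Dir.step] at h
  · refine ⟨rfl, rfl, ?_, ?_⟩ <;> omega
  · omega

open Classical in
/-- The gluing directions read off a labelling: the last box of `θ^{(p)}` and the first box of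
`φ^{(p)}` are glued horizontally if the former has the smaller label. -/
noncomputable def dir (T : G.Box ≃ Fin (k + l)) (p : Fin r) : Dir :=
  if T (G.last p) < T (G.first p) then .horiz else .vert

theorem dir_eq_horiz {T : G.Box ≃ Fin (k + l)} {p : Fin r} :
    G.dir T p = .horiz ↔ T (G.last p) < T (G.first p) := by
  unfold dir; split_ifs with h <;> simp [h]

theorem dir_eq_vert {T : G.Box ≃ Fin (k + l)} {p : Fin r} :
    G.dir T p = .vert ↔ T (G.first p) < T (G.last p) := by
  have : T (G.first p) ≠ T (G.last p) := fun h => Sum.inr_ne_inl (T.injective h)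
  unfold dir
  split_ifs with h
  · simp [h.le]
  · simp [lt_of_le_of_ne (not_lt.1 h) this]

/-- The standard tableaux of the shape glued in the directions `w` are the labellings that are
standard on both shapes and have directions `w`. -/
theorem isStd_glue_iff {T : G.Box ≃ Fin (k + l)} :
    (G.glue w).IsStd ((G.placeEquiv w).symm.trans T) ↔ G.IsStd T ∧ G.dir T = w := by
  have key : (G.glue w).IsStd ((G.placeEquiv w).symm.trans T) ↔
      ∀ x y, (G.glue w).Before (G.place w x) (G.place w y) → T x < T y := by
    have hs : ∀ x, (G.placeEquiv w).symm (G.place w x) = x :=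
      fun x => (G.placeEquiv w).symm_apply_apply x
    constructor
    · intro h x y hxy
      have := h _ _ hxy
      simpa only [Equiv.trans_apply, hs] using this
    · intro h x y hxy
      obtain ⟨x, rfl⟩ := (G.place_bijective w).2 x
      obtain ⟨y, rfl⟩ := (G.place_bijective w).2 y
      simpa only [Equiv.trans_apply, hs] using h _ _ hxy
  rw [key]
  constructor
  · intro h
    refine ⟨?_, ?_⟩
    · rintro _ _ (⟨h1⟩ | ⟨h1⟩)
      · exact h _ _ ((G.before_place_inl_inl w _ _).2 h1)
      · exact h _ _ ((G.before_place_inr_inr w _ _).2 h1)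
    · funext p
      cases hd : w p
      · refine G.dir_eq_vert.2 (h _ _ ⟨rfl, Or.inr ?_⟩)
        simp [last, first, place, hd, Dir.step]
      · refine G.dir_eq_horiz.2 (h _ _ ⟨rfl, Or.inl ?_⟩)
        simp [last, first, place, hd, Dir.step]
  · rintro ⟨h, hw⟩
    -- labels increase from a box to the end of its row or column
    have le : ∀ {x y : G.Box}, G.Before x y ∨ x = y → T x ≤ T y := by
      rintro x y (hxy | rfl)
      · exact (h _ _ hxy).le
      · exact le_rfl
    rintro (x | x) (y | y) hxy
    · exact h _ _ (.inl ((G.before_place_inl_inl w _ _).1 hxy))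
    · obtain ⟨h1, h2, h3, h4⟩ := G.before_place_inl_inr w hxy
      obtain ⟨⟨p, x⟩, hx⟩ := x
      obtain ⟨⟨p', y⟩, hy⟩ := y
      obtain rfl : p = p' := h1
      have c1 := (G.hu p).corner (G.θ.isSkew p) hx
      have c2 := (G.hv p).corner (G.φ.isSkew p) hy
      dsimp only at *
      refine (le (y := G.last p) ?_).trans_lt ((G.dir_eq_horiz.1 (by rw [hw, h2])).trans_le
        (le (x := G.first p) ?_))
      · rcases c1.2.eq_or_lt with h5 | h5
        · right; obtain rfl : x = G.u p := Prod.ext h3 h5; rfl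
        · left; exact .inl ⟨rfl, Or.inl ⟨h3, h5⟩⟩
      · rcases c2.2.eq_or_lt with h5 | h5
        · right; obtain rfl : y = G.v p := Prod.ext h4 h5.symm; rfl
        · left; exact .inr ⟨rfl, Or.inl ⟨h4.symm, h5⟩⟩
    · obtain ⟨h1, h2, h3, h4⟩ := G.before_place_inr_inl w hxy
      obtain ⟨⟨p', x⟩, hx⟩ := x
      obtain ⟨⟨p, y⟩, hy⟩ := y
      obtain rfl : p = p' := h1
      have c1 := (G.hu p).corner (G.θ.isSkew p) hy
      have c2 := (G.hv p).corner (G.φ.isSkew p) hx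
      dsimp only at *
      refine (le (y := G.first p) ?_).trans_lt ((G.dir_eq_vert.1 (by rw [hw, h2])).trans_le
        (le (x := G.last p) ?_))
      · rcases c2.1.eq_or_lt with h5 | h5
        · right; obtain rfl : x = G.v p := Prod.ext h5 h4; rfl
        · left; exact .inr ⟨rfl, Or.inr ⟨h4, h5⟩⟩
      · rcases c1.1.eq_or_lt with h5 | h5
        · right; obtain rfl : y = G.u p := Prod.ext h5.symm h3; rfl
        · left; exact .inl ⟨rfl, Or.inr ⟨h3.symm, h5⟩⟩
    · exact h _ _ (.inr ((G.before_place_inr_inr w _ _).1 hxy))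

theorem diag_place_lt {x : G.θ.Box} {y : G.φ.Box} (h : x.1.1 = y.1.1) :
    diag (G.place w (.inl x)).1.2 < diag (G.place w (.inr y)).1.2 := by
  obtain ⟨⟨p, x⟩, hx⟩ := x
  obtain ⟨⟨p', y⟩, hy⟩ := y
  obtain rfl : p = p' := h
  have h1 := (G.hu p).2 x hx
  have h2 := (G.hv p).2 y hy
  simp only [place, diag_add, diag_sub, diag_step]
  omega

/-- The datum of the combined module, whose boxes are those of both shapes and whose standard
labellings are those that are standard on either shape. Such a labelling is a standard tableau of
the shape glued in the directions read off from it, so that the seminormal formulas have no poles. -/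
noncomputable abbrev datum : SeminormalDatum r (k + l) q where
  Box := G.Box
  comp := G.comp
  val := G.val
  Before := G.Before
  q_ne_zero := PlacedShape.q_ne_zero C
  val_ne_zero x := by rw [← G.val_place fun _ => .horiz]; exact PlacedShape.val_ne_zero _ _
  val_symm_ne {T} hT {i j} hc hne h1 h2 := by
    rw [← G.val_place (G.dir T), ← G.val_place (G.dir T)]
    exact (G.glue (G.dir T)).val_symm_ne ((G.isStd_glue_iff _).2 ⟨hT, rfl⟩)
      (((G.comp_place _ _).trans hc).trans (G.comp_place _ _).symm) hne h1 h2
  coeff_mul_eq_zero {T} hT {i h} hs := by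
    rw [← G.cB_place (G.dir T), ← G.cB_place (G.dir T)]
    exact (G.glue (G.dir T)).cB_mul_cB ((G.isStd_glue_iff _).2 ⟨hT, rfl⟩)
      fun h => hs ((G.isStd_glue_iff _).1 h).1

/-- A box of `θ` may be moved past a box of `φ`: on a glued shape the former lies on a diagonal
further to the southwest, which excludes the contents where the coefficient vanishes. -/
theorem swapCoeff_ne_zero (x : G.θ.Box) (y : G.φ.Box) :
    swapCoeff q G.comp G.val (.inl x) (.inr y) ≠ 0 := by
  let w : Fin r → Dir := fun _ => .horiz
  have hq := PlacedShape.q_ne_zero C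
  unfold swapCoeff
  split_ifs with hc
  swap
  · exact one_ne_zero
  have hc' : x.1.1 = y.1.1 := hc
  have hd := G.diag_place_lt w hc'
  have hcomp : (G.glue w).comp (G.place w (.inl x)) = (G.glue w).comp (G.place w (.inr y)) := hc
  refine div_ne_zero (fun h => ?_) (sub_ne_zero.2 fun h => ?_)
  · have h1 : G.val (.inl x) = C.qpow (G.φ.content y.1.1 y.1.2 + 1) := by
      rw [ContentDomain.qpow, mul_add, mul_one, Complex.exp_add, C.exp_logq2]
      change _ = G.val (.inr y) * q ^ 2
      field_simp at h
      linear_combination -h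
    have hx : (G.place w (.inl x)).1.2 ∈ (G.glue w).shape y.1.1 := by
      rw [← hc']; exact (G.place w (.inl x)).2
    have hy := (G.place w (.inr y)).2
    have hP := (G.glue w).isContent y.1.1
    have hcx : (G.glue w).content y.1.1 (G.place w (.inl x)).1.2 = G.θ.content x.1.1 x.1.2 := by
      rw [← G.content_place_inl w x, ← hc']; rfl
    have hmx := hP.mem _ hx
    have hmy := C.add_int _ (hP.mem _ hy) 1
    have h2 := C.injOn hmx hmy (by
      rw [hcx, Int.cast_one]
      exact h1.trans (congrArg (fun c => C.qpow (c + 1)) (G.content_place_inr w y).symm))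
    rw [Int.cast_one] at h2
    have := (hP.adj_iff _ hy _ hx).1 h2
    omega
  · rw [← G.val_place w, ← G.val_place w] at h
    have := (G.glue w).diag_eq_of_val_eq hcomp.symm h
    omega

/-- The first box of `φ^{(p)}` may not be moved past the last box of `θ^{(p)}`: the action turns a
horizontal junction into a vertical one, but not conversely. -/
theorem swapCoeff_first_last (p : Fin r) :
    swapCoeff q G.comp G.val (G.first p) (G.last p) = 0 := by
  have hq := PlacedShape.q_ne_zero C
  have h1 : G.val (G.first p) = q ^ 2 * G.val (G.last p) := by
    change C.qpow (G.φ.content p (G.v p)) = q ^ 2 * C.qpow (G.θ.content p (G.u p))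
    rw [← G.junction, ContentDomain.qpow, mul_add, mul_one, Complex.exp_add, C.exp_logq2, mul_comm]
    rfl
  have h2 : G.comp (G.first p) = G.comp (G.last p) := rfl
  rw [swapCoeff, if_pos h2, h1]
  have : q * G.val (G.last p) - q⁻¹ * (q ^ 2 * G.val (G.last p)) = 0 := by field_simp; ring
  rw [this, zero_div]

end GluePair

end AffineYokonumaHecke

/-! ### The filtration by gluing directions -/

namespace AffineYokonumaHecke

section Factors

variable {A : Type} [Ring A] {ι : Type} [Fintype ι] (N : ι → Type) [∀ i, AddCommGroup (N i)]
  [∀ i, Module A (N i)]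

theorem HasFactors.congr {M M' : Type} [AddCommGroup M] [Module A M] [AddCommGroup M']
    [Module A M'] (f : M ≃ₗ[A] M') (h : HasFactors A M' N) : HasFactors A M N := by
  obtain ⟨e, F, h0, h1, hF, hN⟩ := h
  refine ⟨e, fun i => (F i).comap f.toLinearMap, ?_, ?_,
    fun i j hij => Submodule.comap_mono (hF hij), fun i => ⟨?_⟩⟩
  · change (F 0).comap f.toLinearMap = ⊥
    rw [h0]
    exact LinearMap.ker_eq_bot.2 f.injective
  · change (F (Fin.last _)).comap f.toLinearMap = ⊤
    rw [h1, Submodule.comap_top]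
  · refine (Submodule.Quotient.equiv _ _ (f.ofSubmodule' (F i.succ)) ?_).trans (hN i).some
    ext x
    constructor
    · rintro ⟨y, hy, rfl⟩
      exact hy
    · intro hx
      exact ⟨(f.ofSubmodule' (F i.succ)).symm x, by
        change f (((f.ofSubmodule' (F i.succ)).symm x).1) ∈ F i.castSucc
        have h2 := congrArg Subtype.val ((f.ofSubmodule' (F i.succ)).apply_symm_apply x)
        rw [show f (((f.ofSubmodule' (F i.succ)).symm x).1) = x.1 from h2]
        exact hx, (f.ofSubmodule' (F i.succ)).apply_symm_apply x⟩

theorem HasFactors.of_maps {M : Type} [AddCommGroup M] [Module A M]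
    (e : Fin (Fintype.card ι) ≃ ι) (F : ℕ → Submodule A M) (h0 : F 0 = ⊥)
    (h1 : F (Fintype.card ι) = ⊤) (hF : Monotone F)
    (hN : ∀ i : Fin (Fintype.card ι), ∃ f : F (i + 1) →ₗ[A] N (e i),
      Function.Surjective f ∧ ∀ x, f x = 0 ↔ (x : M) ∈ F i) : HasFactors A M N := by
  refine ⟨e, fun i => F i, h0, h1, fun i j hij => hF hij, fun i => ?_⟩
  obtain ⟨f, hf, hker⟩ := hN i
  refine ⟨(Submodule.quotEquivOfEq _ _ ?_).trans (f.quotKerEquivOfSurjective hf)⟩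
  ext x
  exact (hker x).symm

end Factors

/-- The direction tuples can be enumerated in such a way that turning components from horizontal to
vertical lowers the position. -/
theorem Dir.exists_enumeration (r : ℕ) :
    ∃ e : Fin (Fintype.card (Fin r → Dir)) ≃ (Fin r → Dir),
      ∀ w w', (∀ p, w p = w' p ∨ w p = .vert) → e.symm w ≤ e.symm w' := by
  classical
  let f : (Fin r → Dir) → Finset (Fin r) := fun w => Finset.univ.filter fun p => w p = .horiz
  have hf : Function.Injective f := by
    intro w w' h
    funext p
    have h1 : p ∈ f w ↔ p ∈ f w' := by rw [h]
    simp only [f, Finset.mem_filter, Finset.mem_univ, true_and] at h1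
    cases hw : w p <;> cases hw' : w' p <;> simp_all
  let _ : PartialOrder (Fin r → Dir) := PartialOrder.lift f hf
  let _ : Fintype (LinearExtension (Fin r → Dir)) := inferInstanceAs (Fintype (Fin r → Dir))
  let e := Fintype.orderIsoFinOfCardEq (LinearExtension (Fin r → Dir))
    (k := Fintype.card (Fin r → Dir)) rfl
  refine ⟨e.toEquiv, fun w w' h => ?_⟩
  refine e.symm.monotone (toLinearExtension.monotone (?_ : f w ⊆ f w'))
  intro p hp
  simp only [f, Finset.mem_filter, Finset.mem_univ, true_and] at hp ⊢
  rcases h p with h | h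
  · rw [← h, hp]
  · rw [h] at hp; cases hp

theorem SeminormalDatum.Mod.repr_vec {r n : ℕ} {q : ℂ} {D : SeminormalDatum r n q}
    [NeZero r] {ζ : ℂ} {hζ : IsPrimitiveRoot ζ r} (T : D.Box ≃ Fin n) :
    (basis D hζ).repr (vec D hζ T) = D.w T := rfl

theorem SeminormalDatum.Mod.mem_of_supported {r n : ℕ} {q : ℂ} {D : SeminormalDatum r n q}
    [NeZero r] {ζ : ℂ} {hζ : IsPrimitiveRoot ζ r} (W : Submodule ℂ (D.Mod hζ)) {s : Set D.Std}
    (h : ∀ T ∈ s, vec D hζ T.1 ∈ W) {x : D.Mod hζ}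
    (hx : (basis D hζ).repr x ∈ Finsupp.supported ℂ ℂ s) : x ∈ W := by
  rw [← (basis D hζ).linearCombination_repr x, Finsupp.linearCombination_apply]
  refine W.sum_mem fun T hT => W.smul_mem _ ?_
  rw [basis_apply]
  exact h T (hx hT)

namespace GluePair

open SeminormalDatum.Mod (vec basis repr_vec mem_of_supported)

variable {q : ℂ} {C : ContentDomain q} {r k l : ℕ} (G : GluePair C r k l)

theorem dir_act (T : G.Box ≃ Fin (k + l)) (i : ℕ) (h : i + 1 < k + l) :
    G.datum.cB (T.symm ⟨i, Nat.lt_of_succ_lt h⟩) (T.symm ⟨i + 1, h⟩) = 0 ∨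
      ∀ p, G.dir (G.datum.act i h T) p = G.dir T p ∨ G.dir (G.datum.act i h T) p = .vert := by
  by_contra hcon
  push Not at hcon
  obtain ⟨h0, p, h1, h2⟩ := hcon
  have h3 : G.dir (G.datum.act i h T) p = .horiz := by
    cases hd : G.dir (G.datum.act i h T) p
    · exact (h2 hd).elim
    · rfl
  rw [h3] at h1
  have h4 : G.dir T p = .vert := by
    cases hd : G.dir T p
    · rfl
    · exact (h1 hd.symm).elim
  have h5 := G.dir_eq_horiz.1 h3
  have h6 := G.dir_eq_vert.1 h4
  have h7 : (sw i h (T (G.last p)) : ℕ) < sw i h (T (G.first p)) := h5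
  rw [Fin.lt_def] at h6
  have c1 := PlacedShape.sw_cases i h (T (G.last p))
  have c2 := PlacedShape.sw_cases i h (T (G.first p))
  have e1 : T (G.first p) = ⟨i, Nat.lt_of_succ_lt h⟩ := Fin.ext (by simp only; omega)
  have e2 : T (G.last p) = ⟨i + 1, h⟩ := Fin.ext (by simp only; omega)
  apply h0
  rw [← e1, ← e2]
  change swapCoeff q G.comp G.val (T.symm (T (G.first p))) (T.symm (T (G.last p))) = 0
  rw [Equiv.symm_apply_apply, Equiv.symm_apply_apply]
  exact G.swapCoeff_first_last p

instance : Finite G.datum.Box := inferInstanceAs (Finite (G.θ.Box ⊕ G.φ.Box))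

/-- A tableau of a glued shape, as a labelling of the boxes of the two shapes. -/
noncomputable def unglue (w : Fin r → Dir) (T : (G.glue w).Std) : G.datum.Std :=
  ⟨(G.placeEquiv w).trans T.1, ((G.isStd_glue_iff w (T := (G.placeEquiv w).trans T.1)).1 (by
    rw [← Equiv.trans_assoc, Equiv.symm_trans_self, Equiv.refl_trans]; exact T.2)).1⟩

theorem dir_unglue (w : Fin r → Dir) (T : (G.glue w).Std) : G.dir (G.unglue w T).1 = w :=
  ((G.isStd_glue_iff w (T := (G.placeEquiv w).trans T.1)).1 (by
    rw [← Equiv.trans_assoc, Equiv.symm_trans_self, Equiv.refl_trans]; exact T.2)).2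

theorem unglue_injective (w : Fin r → Dir) : Function.Injective (G.unglue w) := by
  intro T T' h
  have h1 : (G.placeEquiv w).trans T.1 = (G.placeEquiv w).trans T'.1 := congrArg Subtype.val h
  apply Subtype.ext
  ext x
  have := DFunLike.congr_fun h1 ((G.placeEquiv w).symm x)
  simpa using congrArg Fin.val this

section Layers

variable (e : Fin (Fintype.card (Fin r → Dir)) ≃ (Fin r → Dir))

/-- The standard labellings whose directions come before position `j` in the enumeration `e`. -/
def layerSet (j : ℕ) : Set G.datum.Std := {T | (e.symm (G.dir T.1) : ℕ) < j}

variable [NeZero r] {ζ : ℂ} (hζ : IsPrimitiveRoot ζ r)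

instance : Module.Finite ℂ (G.datum.Mod hζ) := .of_basis (basis G.datum hζ)

/-- The span of the `w_T`, `T` in the `j`-th layer set. -/
noncomputable def layerSpan (j : ℕ) : Submodule ℂ (G.datum.Mod hζ) :=
  (Finsupp.supported ℂ ℂ (G.layerSet e j)).comap (basis G.datum hζ).repr.toLinearMap

theorem vec_mem_layerSpan {j : ℕ} {T : G.Box ≃ Fin (k + l)}
    (hT : G.IsStd T → (e.symm (G.dir T) : ℕ) < j) : vec G.datum hζ T ∈ G.layerSpan e hζ j := by
  change G.datum.w T ∈ Finsupp.supported ℂ ℂ (G.layerSet e j)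
  by_cases h : G.datum.IsStd T
  · rw [G.datum.w_of_std h]
    exact Finsupp.single_mem_supported ℂ _ (hT h)
  · rw [G.datum.w_of_not h]
    exact zero_mem _

theorem mem_stabilizer_layerSpan {j : ℕ} {a : Yhat r (k + l) q}
    (h : ∀ T ∈ G.layerSet e j, a • vec G.datum hζ T.1 ∈ G.layerSpan e hζ j) :
    a ∈ stabilizer (Yhat r (k + l) q) (G.layerSpan e hζ j) := by
  rw [mem_stabilizer]
  intro x hx
  have h1 : x ∈ (G.layerSpan e hζ j).comap (Algebra.lsmul ℂ ℂ (G.datum.Mod hζ) a) :=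
    mem_of_supported _ (s := G.layerSet e j) (fun T hT => Submodule.mem_comap.2 (h T hT))
      (Submodule.mem_comap.1 hx)
  exact Submodule.mem_comap.1 h1

variable (he : ∀ w w', (∀ p, w p = w' p ∨ w p = .vert) → e.symm w ≤ e.symm w')

include he in
theorem layerSpan_smul_mem {j : ℕ} (y : Yhat r (k + l) q) {x : G.datum.Mod hζ}
    (hx : x ∈ G.layerSpan e hζ j) : y • x ∈ G.layerSpan e hζ j := by
  refine Yhat.smul_mem_of_gens (G.layerSpan e hζ j) (fun a => ?_) (fun i h => ?_) (fun h => ?_) y hx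
  · refine G.mem_stabilizer_layerSpan e hζ fun T hT => ?_
    rw [SeminormalDatum.Mod.t_smul_vec]
    exact Submodule.smul_mem _ _ (G.vec_mem_layerSpan e hζ fun _ => hT)
  · refine G.mem_stabilizer_layerSpan e hζ fun T hT => ?_
    rw [SeminormalDatum.Mod.g_smul_vec _ _ T.2]
    refine Submodule.add_mem _ (Submodule.smul_mem _ _ (G.vec_mem_layerSpan e hζ fun _ => hT)) ?_
    rcases G.dir_act T.1 i h with h0 | h0
    · rw [h0, zero_smul]
      exact zero_mem _
    · exact Submodule.smul_mem _ _
        (G.vec_mem_layerSpan e hζ fun _ => lt_of_le_of_lt (he _ _ h0) hT)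
  · refine G.mem_stabilizer_layerSpan e hζ fun T hT => ?_
    rw [show (Yhat.gens r (k + l) q).X h = (Yhat.gens r (k + l) q).XX 0 h from rfl,
      SeminormalDatum.Mod.XX_smul_vec]
    exact Submodule.smul_mem _ _ (G.vec_mem_layerSpan e hζ fun _ => hT)

/-- The span of the `w_T`, `T` in the `j`-th layer set, as a submodule. -/
noncomputable def layer (j : ℕ) : Submodule (Yhat r (k + l) q) (G.datum.Mod hζ) :=
  { G.layerSpan e hζ j with
    smul_mem' := fun y _ hx => G.layerSpan_smul_mem e hζ he y hx }

/-- The projection to the calibrated module of a glued shape, forgetting the labellings with other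
directions. -/
noncomputable def proj (w : Fin r → Dir) : G.datum.Mod hζ →ₗ[ℂ] CalMod hζ (G.glue w) :=
  (CalMod.basis hζ (G.glue w)).repr.symm.toLinearMap ∘ₗ
    Finsupp.lcomapDomain (G.unglue w) (G.unglue_injective w) ∘ₗ
      (basis G.datum hζ).repr.toLinearMap

theorem repr_proj (w : Fin r → Dir) (x : G.datum.Mod hζ) (T : (G.glue w).Std) :
    (CalMod.basis hζ (G.glue w)).repr (G.proj hζ w x) T =
      (basis G.datum hζ).repr x (G.unglue w T) := rfl

theorem proj_vec (w : Fin r → Dir) (T : G.Box ≃ Fin (k + l)) :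
    G.proj hζ w (vec G.datum hζ T) =
      CalMod.vec hζ (G.glue w) ((G.placeEquiv w).symm.trans T) := by
  classical
  apply (CalMod.basis hζ (G.glue w)).repr.injective
  ext T'
  rw [repr_proj, repr_vec]
  change _ = (G.glue w).w ((G.placeEquiv w).symm.trans T) T'
  have key : (G.unglue w T').1 = T ↔ T'.1 = (G.placeEquiv w).symm.trans T := by
    constructor
    · rintro rfl
      change T'.1 = (G.placeEquiv w).symm.trans ((G.placeEquiv w).trans T'.1)
      rw [← Equiv.trans_assoc, Equiv.symm_trans_self, Equiv.refl_trans]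
    · intro h
      change (G.placeEquiv w).trans T'.1 = T
      rw [h, ← Equiv.trans_assoc, Equiv.self_trans_symm, Equiv.refl_trans]
  by_cases h : (G.glue w).IsStd ((G.placeEquiv w).symm.trans T)
  · rw [(G.glue w).w_of_std h, G.datum.w_of_std ((G.isStd_glue_iff w).1 h).1,
      Finsupp.single_apply, Finsupp.single_apply]
    refine if_congr ?_ rfl rfl
    rw [Subtype.ext_iff, Subtype.ext_iff, eq_comm, key, eq_comm]
  · rw [(G.glue w).w_of_not h]
    by_cases h' : G.datum.IsStd T
    · rw [G.datum.w_of_std h', Finsupp.single_apply, if_neg]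
      · rfl
      · intro h2
        apply h
        rw [← key.1 (congrArg Subtype.val h2).symm]
        exact T'.2
    · rw [G.datum.w_of_not h']
      rfl

theorem proj_vec_of_dir_ne {w : Fin r → Dir} {T : G.Box ≃ Fin (k + l)} (h : G.dir T ≠ w) :
    G.proj hζ w (vec G.datum hζ T) = 0 := by
  rw [proj_vec]
  exact (G.glue w).w_of_not fun h' => h ((G.isStd_glue_iff w).1 h').2

include he in
/-- The projection commutes with `g_i` on the labellings whose directions come no later. -/
theorem proj_g_smul (w : Fin r → Dir) {T : G.datum.Std} (hT : e.symm (G.dir T.1) ≤ e.symm w)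
    (i : ℕ) (h : i + 1 < k + l) :
    G.proj hζ w ((Yhat.gens r (k + l) q).g i h • vec G.datum hζ T.1) =
      (Yhat.gens r (k + l) q).g i h • G.proj hζ w (vec G.datum hζ T.1) := by
  rw [SeminormalDatum.Mod.g_smul_vec _ _ T.2, map_add, map_smul, map_smul]
  by_cases hw : G.dir T.1 = w
  · rw [proj_vec, proj_vec, CalMod.g_smul_vec _ _ _ ((G.isStd_glue_iff w).2 ⟨T.2, hw⟩)]
    change _ = (G.glue w).cA (G.place w (T.1.symm _)) (G.place w (T.1.symm _)) • _ +
      (G.glue w).cB (G.place w (T.1.symm _)) (G.place w (T.1.symm _)) • _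
    rw [cA_place, cB_place]
    rfl
  · rw [G.proj_vec_of_dir_ne hζ hw, smul_zero, smul_zero, zero_add]
    rcases G.dir_act T.1 i h with h0 | h0
    · rw [h0, zero_smul]
    · rw [G.proj_vec_of_dir_ne hζ, smul_zero]
      rintro h1
      have h2 := he _ _ h0
      rw [h1] at h2
      exact hw (e.symm.injective (le_antisymm hT h2))

/-- The projection of a layer to the calibrated module of the shape glued in the last directions
that occur. -/
noncomputable def layerProj (j : Fin (Fintype.card (Fin r → Dir))) :
    G.layer e hζ he (j + 1) →ₗ[Yhat r (k + l) q] CalMod hζ (G.glue (e j)) where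
  toFun x := G.proj hζ (e j) x
  map_add' x y := map_add (G.proj hζ (e j)) _ _
  map_smul' y x := by
    have key : ∀ a : Yhat r (k + l) q, (∀ T : G.datum.Std, e.symm (G.dir T.1) ≤ e.symm (e j) →
        G.proj hζ (e j) (a • vec G.datum hζ T.1) = a • G.proj hζ (e j) (vec G.datum hζ T.1)) →
        ∀ x : G.layer e hζ he (j + 1),
          G.proj hζ (e j) (a • (x : G.datum.Mod hζ)) = a • G.proj hζ (e j) x := by
      intro a ha x
      refine mem_of_supported (LinearMap.eqLocus (G.proj hζ (e j) ∘ₗ Algebra.lsmul ℂ ℂ _ a)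
        (Algebra.lsmul ℂ ℂ _ a ∘ₗ G.proj hζ (e j))) (s := G.layerSet e (j + 1)) ?_ x.2
      intro T hT
      refine ha T ?_
      rw [Equiv.symm_apply_apply]
      exact Nat.lt_succ_iff.1 hT
    have h := (Yhat.gens r (k + l) q).intertwine
      (G.proj hζ (e j) ∘ₗ (G.layer e hζ he (j + 1)).subtype.restrictScalars ℂ)
      (fun i x => key _ (fun T _ => by
        rw [SeminormalDatum.Mod.t_smul_vec, map_smul, proj_vec, CalMod.t_smul_vec]
        congr 2
        exact congrArg Fin.val (G.comp_place (e j) _).symm) x)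
      (fun i h x => key _ (fun T hT => G.proj_g_smul e hζ he _ hT i h) x)
      (fun h x => key _ (fun T _ => by
        rw [show (Yhat.gens r (k + l) q).X h = (Yhat.gens r (k + l) q).XX 0 h from rfl,
          SeminormalDatum.Mod.XX_smul_vec, map_smul, proj_vec,
          CalMod.XX_smul_vec _ _ _ ⟨0, h⟩]
        congr 1
        exact (G.val_place (e j) _).symm) x) y x
    rw [Yhat.lift_gens] at h
    exact h

theorem layerProj_surjective (j : Fin (Fintype.card (Fin r → Dir))) :
    Function.Surjective (G.layerProj e hζ he j) := by
  have key : (LinearMap.range ((G.layerProj e hζ he j).restrictScalars ℂ)) = ⊤ := by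
    rw [eq_top_iff, ← (CalMod.basis hζ (G.glue (e j))).span_eq, Submodule.span_le]
    rintro _ ⟨T, rfl⟩
    refine ⟨⟨vec G.datum hζ (G.unglue (e j) T).1, G.vec_mem_layerSpan e hζ fun _ => ?_⟩, ?_⟩
    · rw [dir_unglue, Equiv.symm_apply_apply]
      exact Nat.lt_succ_self _
    · change G.proj hζ (e j) _ = _
      rw [proj_vec, CalMod.basis_apply]
      congr 1
      change (G.placeEquiv (e j)).symm.trans ((G.placeEquiv (e j)).trans T.1) = _
      rw [← Equiv.trans_assoc, Equiv.symm_trans_self, Equiv.refl_trans]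
  exact (LinearMap.range_eq_top (f := (G.layerProj e hζ he j).restrictScalars ℂ)).1 key

theorem layerProj_eq_zero (j : Fin (Fintype.card (Fin r → Dir))) (x : G.layer e hζ he (j + 1)) :
    G.layerProj e hζ he j x = 0 ↔ (x : G.datum.Mod hζ) ∈ G.layer e hζ he j := by
  have h1 : G.layerProj e hζ he j x = 0 ↔ ∀ T : (G.glue (e j)).Std,
      (basis G.datum hζ).repr (x : G.datum.Mod hζ) (G.unglue (e j) T) = 0 := by
    rw [← (CalMod.basis hζ (G.glue (e j))).repr.map_eq_zero_iff, Finsupp.ext_iff]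
    rfl
  have h2 : ∀ m, (x : G.datum.Mod hζ) ∈ G.layer e hζ he m ↔ ∀ T : G.datum.Std,
      (basis G.datum hζ).repr (x : G.datum.Mod hζ) T ≠ 0 → (e.symm (G.dir T.1) : ℕ) < m :=
    fun m => forall_congr' fun T => by rw [Finset.mem_coe, Finsupp.mem_support_iff]; rfl
  rw [h1, h2]
  constructor
  · intro h T hT
    refine lt_of_le_of_ne (Nat.lt_succ_iff.1 ((h2 _).1 x.2 T hT)) fun h3 => hT ?_
    have hd : G.dir T.1 = e j := by rw [← Fin.ext h3, Equiv.apply_symm_apply]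
    have := h ⟨(G.placeEquiv (e j)).symm.trans T.1, (G.isStd_glue_iff _).2 ⟨T.2, hd⟩⟩
    rwa [show G.unglue (e j) ⟨(G.placeEquiv (e j)).symm.trans T.1, _⟩ = T from
      Subtype.ext (by
        change (G.placeEquiv (e j)).trans ((G.placeEquiv (e j)).symm.trans T.1) = _
        rw [← Equiv.trans_assoc, Equiv.self_trans_symm, Equiv.refl_trans])] at this
  · intro h T
    by_contra hne
    have := h _ hne
    rw [dir_unglue, Equiv.symm_apply_apply] at this
    exact lt_irrefl _ this

end Layers

theorem hasFactors_datum [NeZero r] {ζ : ℂ} (hζ : IsPrimitiveRoot ζ r) :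
    HasFactors (Yhat r (k + l) q) (G.datum.Mod hζ) (fun w => CalMod hζ (G.glue w)) := by
  obtain ⟨e, he⟩ := Dir.exists_enumeration r
  have mem : ∀ (x : G.datum.Mod hζ) m, x ∈ G.layer e hζ he m ↔
      (((basis G.datum hζ).repr x).support : Set G.datum.Std) ⊆ G.layerSet e m := fun _ _ => Iff.rfl
  refine HasFactors.of_maps _ e (G.layer e hζ he) ?_ ?_ ?_
    fun j => ⟨G.layerProj e hζ he j, G.layerProj_surjective e hζ he j,
      G.layerProj_eq_zero e hζ he j⟩
  · rw [eq_bot_iff]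
    intro x hx
    have h0 : (basis G.datum hζ).repr x = 0 := by
      ext T
      by_contra hne
      exact Nat.not_lt_zero _ ((mem x 0).1 hx (Finsupp.mem_support_iff.2 hne))
    exact (basis G.datum hζ).repr.map_eq_zero_iff.1 h0
  · rw [eq_top_iff]
    exact fun x _ => (mem x _).2 fun T _ => (e.symm (G.dir T.1)).2
  · exact fun i j hij x hx => (mem x j).2 (((mem x i).1 hx).trans fun T hT => lt_of_lt_of_le hT hij)

end GluePair

end AffineYokonumaHecke

/-! ### Shuffles of tableaux -/

namespace AffineYokonumaHecke

theorem idem_mem {A : Type*} [Ring A] [Algebra ℂ A] (S : Subalgebra ℂ A) (r : ℕ) {a b : A}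
    (ha : a ∈ S) (hb : b ∈ S) : idem r a b ∈ S :=
  S.smul_mem (S.sum_mem fun _ _ => S.mul_mem (S.pow_mem ha _) (S.pow_mem hb _)) _

section Swap

variable {n : ℕ}

theorem sw_left (i : ℕ) (h : i + 1 < n) : sw i h ⟨i, Nat.lt_of_succ_lt h⟩ = ⟨i + 1, h⟩ :=
  Equiv.swap_apply_left _ _

theorem sw_right (i : ℕ) (h : i + 1 < n) : sw i h ⟨i + 1, h⟩ = ⟨i, Nat.lt_of_succ_lt h⟩ :=
  Equiv.swap_apply_right _ _

theorem sw_of_ne (i : ℕ) (h : i + 1 < n) {j : Fin n} (h1 : (j : ℕ) ≠ i) (h2 : (j : ℕ) ≠ i + 1) :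
    sw i h j = j := by
  apply Equiv.swap_apply_of_ne_of_ne <;> rw [Ne, Fin.ext_iff] <;> assumption

theorem SeminormalDatum.act_comm {r : ℕ} {q : ℂ} (D : SeminormalDatum r n q) (i j : ℕ)
    (h : i + 1 < n) (h' : j + 1 < n) (hij : i + 2 ≤ j ∨ j + 2 ≤ i) (T : D.Box ≃ Fin n) :
    D.act i h (D.act j h' T) = D.act j h' (D.act i h T) := by
  ext x
  simp only [SeminormalDatum.act, Equiv.trans_apply, PlacedShape.sw_val]
  split_ifs <;> omega

theorem SeminormalDatum.act_braid {r : ℕ} {q : ℂ} (D : SeminormalDatum r n q) (i : ℕ)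
    (h' : i + 1 < n) (h : i + 1 + 1 < n) (T : D.Box ≃ Fin n) :
    D.act i h' (D.act (i + 1) h (D.act i h' T)) =
      D.act (i + 1) h (D.act i h' (D.act (i + 1) h T)) := by
  ext x
  simp only [SeminormalDatum.act, Equiv.trans_apply]
  have h1 := PlacedShape.sw_cases i h' (T x)
  have h2 := PlacedShape.sw_cases (i + 1) h (sw i h' (T x))
  have h3 := PlacedShape.sw_cases i h' (sw (i + 1) h (sw i h' (T x)))
  have h4 := PlacedShape.sw_cases (i + 1) h (T x)
  have h5 := PlacedShape.sw_cases i h' (sw (i + 1) h (T x))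
  have h6 := PlacedShape.sw_cases (i + 1) h (sw i h' (sw (i + 1) h (T x)))
  omega

end Swap

namespace GluePair

variable {q : ℂ} {C : ContentDomain q} {r k l : ℕ} (G : GluePair C r k l)

/-- The labelling that uses the first `k` labels on `θ` and the last `l` labels on `φ`. -/
def initial (T₁ : G.θ.Box ≃ Fin k) (T₂ : G.φ.Box ≃ Fin l) : G.Box ≃ Fin (k + l) :=
  (Equiv.sumCongr T₁ T₂).trans finSumFinEquiv

theorem initial_inl (T₁ : G.θ.Box ≃ Fin k) (T₂ : G.φ.Box ≃ Fin l) (x : G.θ.Box) :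
    G.initial T₁ T₂ (.inl x) = Fin.castAdd l (T₁ x) := rfl

theorem initial_inr (T₁ : G.θ.Box ≃ Fin k) (T₂ : G.φ.Box ≃ Fin l) (x : G.φ.Box) :
    G.initial T₁ T₂ (.inr x) = Fin.natAdd k (T₂ x) := rfl

theorem initial_symm_castAdd (T₁ : G.θ.Box ≃ Fin k) (T₂ : G.φ.Box ≃ Fin l) (i : Fin k) :
    (G.initial T₁ T₂).symm (Fin.castAdd l i) = .inl (T₁.symm i) := by
  rw [Equiv.symm_apply_eq, initial_inl, Equiv.apply_symm_apply]

theorem initial_symm_natAdd (T₁ : G.θ.Box ≃ Fin k) (T₂ : G.φ.Box ≃ Fin l) (i : Fin l) :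
    (G.initial T₁ T₂).symm (Fin.natAdd k i) = .inr (T₂.symm i) := by
  rw [Equiv.symm_apply_eq, initial_inr, Equiv.apply_symm_apply]

theorem initial_injective {T₁ T₁' : G.θ.Box ≃ Fin k} {T₂ T₂' : G.φ.Box ≃ Fin l}
    (h : G.initial T₁ T₂ = G.initial T₁' T₂') : T₁ = T₁' ∧ T₂ = T₂' := by
  constructor
  · ext x
    have := congrArg Fin.val (DFunLike.congr_fun h (.inl x))
    simpa only [initial_inl, Fin.val_castAdd] using this
  · ext x
    have := congrArg Fin.val (DFunLike.congr_fun h (.inr x))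
    simpa only [initial_inr, Fin.val_natAdd, Nat.add_left_cancel_iff] using this

theorem isStd_initial {T₁ : G.θ.Box ≃ Fin k} {T₂ : G.φ.Box ≃ Fin l} :
    G.IsStd (G.initial T₁ T₂) ↔ G.θ.IsStd T₁ ∧ G.φ.IsStd T₂ := by
  constructor
  · intro h
    refine ⟨fun x y hxy => ?_, fun x y hxy => ?_⟩
    · simpa only [initial_inl, Fin.lt_def, Fin.val_castAdd] using h _ _ (.inl hxy)
    · simpa only [initial_inr, Fin.lt_def, Fin.val_natAdd, Nat.add_lt_add_iff_left]
        using h _ _ (.inr hxy)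
  · rintro ⟨h1, h2⟩ _ _ (⟨h⟩ | ⟨h⟩)
    · simpa only [initial_inl, Fin.lt_def, Fin.val_castAdd] using h1 _ _ h
    · simpa only [initial_inr, Fin.lt_def, Fin.val_natAdd, Nat.add_lt_add_iff_left]
        using h2 _ _ h

theorem act_initial_left (T₁ : G.θ.Box ≃ Fin k) (T₂ : G.φ.Box ≃ Fin l) (i : ℕ) (h : i + 1 < k) :
    G.datum.act i (by omega) (G.initial T₁ T₂) = G.initial (G.θ.act i h T₁) T₂ := by
  ext x
  rcases x with x | x
  · change (sw i _ (Fin.castAdd l (T₁ x)) : ℕ) = (Fin.castAdd l (sw i h (T₁ x)) : ℕ)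
    simp only [PlacedShape.sw_val, Fin.val_castAdd]
  · change (sw i _ (Fin.natAdd k (T₂ x)) : ℕ) = (Fin.natAdd k (T₂ x) : ℕ)
    simp only [PlacedShape.sw_val, Fin.val_natAdd]
    split_ifs <;> omega

theorem act_initial_right (T₁ : G.θ.Box ≃ Fin k) (T₂ : G.φ.Box ≃ Fin l) (i : ℕ) (h : i + 1 < l) :
    G.datum.act (k + i) (by omega) (G.initial T₁ T₂) = G.initial T₁ (G.φ.act i h T₂) := by
  ext x
  rcases x with x | x
  · change (sw (k + i) _ (Fin.castAdd l (T₁ x)) : ℕ) = (Fin.castAdd l (T₁ x) : ℕ)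
    simp only [PlacedShape.sw_val, Fin.val_castAdd]
    have := (T₁ x).2
    split_ifs <;> omega
  · change (sw (k + i) _ (Fin.natAdd k (T₂ x)) : ℕ) = (Fin.natAdd k (sw i h (T₂ x)) : ℕ)
    simp only [PlacedShape.sw_val, Fin.val_natAdd]
    split_ifs <;> omega

/-- Whether the label `j` is used on `θ`. -/
def side (T : G.Box ≃ Fin (k + l)) (j : Fin (k + l)) : Bool := (T.symm j).isLeft

theorem side_act (i : ℕ) (h : i + 1 < k + l) (T : G.Box ≃ Fin (k + l)) (j : Fin (k + l)) :
    G.side (G.datum.act i h T) j = G.side T (sw i h j) :=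
  congrArg Sum.isLeft (G.datum.act_symm i h T j)

theorem side_initial (T₁ : G.θ.Box ≃ Fin k) (T₂ : G.φ.Box ≃ Fin l) (j : Fin (k + l)) :
    G.side (G.initial T₁ T₂) j = true ↔ (j : ℕ) < k := by
  unfold side
  refine Fin.addCases (fun i => ?_) (fun i => ?_) j
  · rw [initial_symm_castAdd]; simp
  · rw [initial_symm_natAdd]; simp

/-- The labels `i` and `i + 1` are used on `φ` and `θ` respectively. -/
def IsDescent (T : G.Box ≃ Fin (k + l)) (i : ℕ) (h : i + 1 < k + l) : Prop :=
  G.side T ⟨i, Nat.lt_of_succ_lt h⟩ = false ∧ G.side T ⟨i + 1, h⟩ = true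

theorem not_isDescent_initial (T₁ : G.θ.Box ≃ Fin k) (T₂ : G.φ.Box ≃ Fin l) (i : ℕ)
    (h : i + 1 < k + l) : ¬ G.IsDescent (G.initial T₁ T₂) i h := by
  rintro ⟨h1, h2⟩
  rw [side_initial] at h2
  rw [← Bool.not_eq_true, side_initial] at h1
  simp only at h1 h2
  omega

/-- The sum of the labels on `θ`, which measures how far a labelling is from an initial one. -/
def weight (T : G.Box ≃ Fin (k + l)) : ℕ := ∑ j, if G.side T j then (j : ℕ) else 0

theorem weight_act_lt {T : G.Box ≃ Fin (k + l)} {i : ℕ} {h : i + 1 < k + l}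
    (hd : G.IsDescent T i h) : G.weight (G.datum.act i h T) < G.weight T := by
  have e : G.weight (G.datum.act i h T) = ∑ j, if G.side T j then (sw i h j : ℕ) else 0 := by
    unfold weight
    rw [← Equiv.sum_comp (sw i h)]
    refine Finset.sum_congr rfl fun j _ => ?_
    rw [side_act, show sw i h (sw i h j) = j by simp [sw]]
  rw [e]
  refine Finset.sum_lt_sum (fun j _ => ?_) ⟨⟨i + 1, h⟩, Finset.mem_univ _, ?_⟩
  · split_ifs with hj
    · have hne : (j : ℕ) ≠ i := by
        rintro rfl
        exact Bool.false_ne_true (hd.1.symm.trans hj)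
      rw [PlacedShape.sw_val]
      split_ifs <;> omega
    · exact le_rfl
  · rw [if_pos hd.2, if_pos hd.2, sw_right]
    exact Nat.lt_succ_self _

theorem isDescent_act {T : G.Box ≃ Fin (k + l)} {i : ℕ} {h : i + 1 < k + l}
    (h1 : G.side T ⟨i, Nat.lt_of_succ_lt h⟩ = true) (h2 : G.side T ⟨i + 1, h⟩ = false) :
    G.IsDescent (G.datum.act i h T) i h := by
  refine ⟨?_, ?_⟩
  · rw [side_act, sw_left, h2]
  · rw [side_act, sw_right, h1]

theorem isStd_act {T : G.Box ≃ Fin (k + l)} {i : ℕ} {h : i + 1 < k + l}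
    (hs : G.side T ⟨i, Nat.lt_of_succ_lt h⟩ ≠ G.side T ⟨i + 1, h⟩) (hT : G.datum.IsStd T) :
    G.datum.IsStd (G.datum.act i h T) := by
  intro x y hxy
  have h0 : x.isLeft = y.isLeft := by rcases hxy with ⟨-⟩ | ⟨-⟩ <;> rfl
  have h1 := hT x y hxy
  by_contra hn
  apply hs
  have h2 : ¬ (sw i h (T x) : ℕ) < sw i h (T y) := hn
  rw [Fin.lt_def] at h1
  have c1 := PlacedShape.sw_cases i h (T x)
  have c2 := PlacedShape.sw_cases i h (T y)
  have e1 : T x = ⟨i, Nat.lt_of_succ_lt h⟩ := Fin.ext (by simp only; omega)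
  have e2 : T y = ⟨i + 1, h⟩ := Fin.ext (by simp only; omega)
  rw [← e1, ← e2, side, side, Equiv.symm_apply_apply, Equiv.symm_apply_apply, h0]

theorem isStd_act_iff {T : G.Box ≃ Fin (k + l)} {i : ℕ} {h : i + 1 < k + l}
    (hs : G.side T ⟨i, Nat.lt_of_succ_lt h⟩ ≠ G.side T ⟨i + 1, h⟩) :
    G.datum.IsStd (G.datum.act i h T) ↔ G.datum.IsStd T := by
  refine ⟨fun hT => ?_, G.isStd_act hs⟩
  have := G.isStd_act (T := G.datum.act i h T) (i := i) (h := h) (by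
    rw [side_act, side_act, sw_left, sw_right]; exact hs.symm) hT
  rwa [G.datum.act_act] at this

/-- A labelling without descents is initial. -/
theorem exists_eq_initial {T : G.Box ≃ Fin (k + l)} (hT : ∀ i h, ¬ G.IsDescent T i h) :
    ∃ T₁ T₂, T = G.initial T₁ T₂ := by
  have down : ∀ (m a : ℕ) (h : a + m < k + l), G.side T ⟨a + m, h⟩ = true →
      G.side T ⟨a, by omega⟩ = true := by
    intro m
    induction m with
    | zero => exact fun a h h1 => h1
    | succ m ih =>
      intro a h h1
      refine ih a (by omega) ?_
      by_contra hcon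
      exact hT (a + m) h ⟨Bool.eq_false_iff.2 hcon, h1⟩
  have hlt : ∀ x, (T (.inl x) : ℕ) < k := by
    intro x
    by_contra hcon
    -- otherwise the labels `0, …, k` are all used on the `k` boxes of `θ`
    have hall : ∀ a : Fin (k + 1), ∃ y : G.θ.Box, (T (.inl y) : ℕ) = a := by
      intro a
      have h1 := down ((T (.inl x) : ℕ) - a) a (by have := (T (.inl x)).2; omega) (by
        rw [show (⟨(a : ℕ) + ((T (.inl x) : ℕ) - a), _⟩ : Fin (k + l)) = T (.inl x) from
          Fin.ext (by simp only; omega), side, Equiv.symm_apply_apply]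
        rfl)
      obtain ⟨y, hy⟩ := Sum.isLeft_iff.1 h1
      exact ⟨y, by rw [← hy, Equiv.apply_symm_apply]⟩
    choose f hf using hall
    have hinj : Function.Injective f := fun a b hab => Fin.ext (by rw [← hf a, hab, hf b])
    have := Nat.card_le_card_of_injective f hinj
    rw [Nat.card_fin, G.θ.card_box] at this
    omega
  have hb1 : Function.Bijective fun x : G.θ.Box => (⟨T (.inl x), hlt x⟩ : Fin k) := by
    refine (Nat.bijective_iff_injective_and_card _).2 ⟨fun x y hxy => ?_, ?_⟩
    · exact Sum.inl_injective (T.injective (Fin.ext (Fin.mk.inj hxy)))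
    · rw [G.θ.card_box, Nat.card_fin]
  have hge : ∀ y, k ≤ (T (.inr y) : ℕ) := by
    intro y
    by_contra hcon
    obtain ⟨x, hx⟩ := hb1.2 ⟨T (.inr y), not_le.1 hcon⟩
    exact Sum.inl_ne_inr (T.injective (Fin.ext (Fin.mk.inj hx)))
  have hb2 : Function.Bijective fun y : G.φ.Box =>
      (⟨T (.inr y) - k, by have := (T (.inr y)).2; have := hge y; omega⟩ : Fin l) := by
    refine (Nat.bijective_iff_injective_and_card _).2 ⟨fun x y hxy => ?_, ?_⟩
    · have h1 := Fin.mk.inj hxy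
      have h2 := hge x
      have h3 := hge y
      exact Sum.inr_injective (T.injective (Fin.ext (by omega)))
    · rw [G.φ.card_box, Nat.card_fin]
  refine ⟨Equiv.ofBijective _ hb1, Equiv.ofBijective _ hb2, ?_⟩
  ext x
  rcases x with x | y
  · rw [initial_inl]; rfl
  · rw [initial_inr]
    change (T (.inr y) : ℕ) = k + (T (.inr y) - k)
    have := hge y
    omega

/-- Induction along the creation of descents. -/
theorem descent_induction {p : (G.Box ≃ Fin (k + l)) → Prop}
    (h0 : ∀ T₁ T₂, p (G.initial T₁ T₂))
    (h1 : ∀ T i h, G.IsDescent T i h → (∀ T', G.weight T' < G.weight T → p T') → p T)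
    (T : G.Box ≃ Fin (k + l)) : p T := by
  induction hm : G.weight T using Nat.strong_induction_on generalizing T with
  | _ m ih =>
    subst hm
    by_cases hd : ∃ i h, G.IsDescent T i h
    · obtain ⟨i, h, hd⟩ := hd
      exact h1 T i h hd fun T' hT' => ih _ hT' T' rfl
    · push Not at hd
      obtain ⟨T₁, T₂, rfl⟩ := G.exists_eq_initial hd
      exact h0 T₁ T₂

theorem IsDescent.side_ne {G : GluePair C r k l} {T : G.Box ≃ Fin (k + l)} {i : ℕ}
    {h : i + 1 < k + l} (hd : G.IsDescent T i h) :
    G.side T ⟨i, Nat.lt_of_succ_lt h⟩ ≠ G.side T ⟨i + 1, h⟩ := by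
  rw [hd.1, hd.2]
  exact Bool.false_ne_true

end GluePair

end AffineYokonumaHecke

/-! ### Shuffle vectors in an equivariant target -/

namespace AffineYokonumaHecke

namespace GluePair

variable {q : ℂ} {C : ContentDomain q} {r k l : ℕ} (G : GluePair C r k l) [NeZero r] {ζ : ℂ}
  (hζ : IsPrimitiveRoot ζ r) {I : Type} [AddCommGroup I] [Module ℂ I] [Module (Yhat r (k + l) q) I]

/-- A bilinear map to a `Ŷ_{r,k+l}`-module that is equivariant for `Ŷ_{r,k}` and `Ŷ_{r,l}`. -/
structure IsEquivariant (β : CalMod hζ G.θ →ₗ[ℂ] CalMod hζ G.φ →ₗ[ℂ] I) : Prop where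
  left : ∀ x m n, β (x • m) n = (Yhat.gens r (k + l) q).left.lift x • β m n
  right : ∀ x m n, β m (x • n) = (Yhat.gens r (k + l) q).right.lift x • β m n

variable (β : CalMod hζ G.θ →ₗ[ℂ] CalMod hζ G.φ →ₗ[ℂ] I)

open Classical in
/-- The vector `g_{i₁} ⋯ g_{iₘ} β(w_{T₁}, w_{T₂})`, where `T = s_{i₁} ⋯ s_{iₘ} T₀` for the initial
labelling `T₀` made of `T₁` and `T₂`, and every step creates a descent. -/
noncomputable def shuffleVec (T : G.Box ≃ Fin (k + l)) : I :=
  if h : ∃ T₁ T₂, T = G.initial T₁ T₂ then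
    β (CalMod.vec hζ G.θ h.choose) (CalMod.vec hζ G.φ h.choose_spec.choose)
  else if h : ∃ i, ∃ hi : i + 1 < k + l, G.IsDescent T i hi then
    (Yhat.gens r (k + l) q).g h.choose h.choose_spec.choose •
      shuffleVec (G.datum.act h.choose h.choose_spec.choose T)
  else 0
termination_by G.weight T
decreasing_by exact G.weight_act_lt h.choose_spec.choose_spec

theorem shuffleVec_initial (T₁ : G.θ.Box ≃ Fin k) (T₂ : G.φ.Box ≃ Fin l) :
    G.shuffleVec hζ β (G.initial T₁ T₂) = β (CalMod.vec hζ G.θ T₁) (CalMod.vec hζ G.φ T₂) := by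
  have h : ∃ T₁' T₂', G.initial T₁ T₂ = G.initial T₁' T₂' := ⟨T₁, T₂, rfl⟩
  rw [shuffleVec, dif_pos h]
  obtain ⟨h1, h2⟩ := G.initial_injective h.choose_spec.choose_spec
  exact congrArg₂ (fun a b => β (CalMod.vec hζ G.θ a) (CalMod.vec hζ G.φ b)) h1.symm h2.symm

/-- Two different descents are not adjacent, so that the generators belonging to them commute: the
vector of a labelling does not depend on the choice of descents. -/
theorem shuffleVec_of_isDescent (T : G.Box ≃ Fin (k + l)) {i : ℕ} {h : i + 1 < k + l}
    (hd : G.IsDescent T i h) :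
    G.shuffleVec hζ β T =
      (Yhat.gens r (k + l) q).g i h • G.shuffleVec hζ β (G.datum.act i h T) := by
  induction hm : G.weight T using Nat.strong_induction_on generalizing T i with
  | _ m ih =>
    subst hm
    have h1 : ¬ ∃ T₁ T₂, T = G.initial T₁ T₂ := by
      rintro ⟨T₁, T₂, rfl⟩
      exact G.not_isDescent_initial _ _ i h hd
    have h2 : ∃ i, ∃ hi : i + 1 < k + l, G.IsDescent T i hi := ⟨i, h, hd⟩
    obtain ⟨j, hj, hdj, e⟩ : ∃ j, ∃ hj : j + 1 < k + l, G.IsDescent T j hj ∧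
        G.shuffleVec hζ β T =
          (Yhat.gens r (k + l) q).g j hj • G.shuffleVec hζ β (G.datum.act j hj T) := by
      refine ⟨h2.choose, h2.choose_spec.choose, h2.choose_spec.choose_spec, ?_⟩
      rw [shuffleVec, dif_neg h1, dif_pos h2]
    rcases eq_or_ne i j with rfl | hij
    · exact e
    have hfar : i + 2 ≤ j ∨ j + 2 ≤ i := by
      by_contra hcon
      obtain rfl | rfl : j = i + 1 ∨ i = j + 1 := by omega
      · exact Bool.false_ne_true (hdj.1.symm.trans hd.2)
      · exact Bool.false_ne_true (hd.1.symm.trans hdj.2)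
    have di : G.IsDescent (G.datum.act j hj T) i h := by
      constructor
      · rw [side_act, sw_of_ne _ _ (by simp only; omega) (by simp only; omega)]; exact hd.1
      · rw [side_act, sw_of_ne _ _ (by simp only; omega) (by simp only; omega)]; exact hd.2
    have dj : G.IsDescent (G.datum.act i h T) j hj := by
      constructor
      · rw [side_act, sw_of_ne _ _ (by simp only; omega) (by simp only; omega)]; exact hdj.1
      · rw [side_act, sw_of_ne _ _ (by simp only; omega) (by simp only; omega)]; exact hdj.2
    rw [e, ih _ (G.weight_act_lt hdj) _ di rfl, ih _ (G.weight_act_lt hd) _ dj rfl,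
      G.datum.act_comm i j h hj hfar, smul_smul, smul_smul,
      ((Yhat.gens r (k + l) q).gg i j h hj hfar).eq]

theorem shuffleVec_act {T : G.Box ≃ Fin (k + l)} {i : ℕ} {h : i + 1 < k + l}
    (h1 : G.side T ⟨i, Nat.lt_of_succ_lt h⟩ = true) (h2 : G.side T ⟨i + 1, h⟩ = false) :
    G.shuffleVec hζ β (G.datum.act i h T) =
      (Yhat.gens r (k + l) q).g i h • G.shuffleVec hζ β T := by
  rw [G.shuffleVec_of_isDescent hζ β _ (G.isDescent_act h1 h2), G.datum.act_act]

theorem shuffleVec_of_not_isStd (T : G.Box ≃ Fin (k + l)) (hT : ¬ G.datum.IsStd T) :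
    G.shuffleVec hζ β T = 0 := by
  induction T using G.descent_induction with
  | h0 T₁ T₂ =>
    rw [shuffleVec_initial]
    by_cases h1 : G.θ.IsStd T₁
    · rw [show CalMod.vec hζ G.φ T₂ = 0 from
        G.φ.w_of_not fun h2 => hT (G.isStd_initial.2 ⟨h1, h2⟩), map_zero]
    · rw [show CalMod.vec hζ G.θ T₁ = 0 from G.θ.w_of_not h1, map_zero, LinearMap.zero_apply]
  | h1 T i h hd ih =>
    rw [G.shuffleVec_of_isDescent hζ β T hd, ih _ (G.weight_act_lt hd), smul_zero]
    rwa [G.isStd_act_iff hd.side_ne]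

/-- The span of the shuffle vectors. -/
noncomputable def shuffleSpan : Submodule ℂ I :=
  Submodule.span ℂ (Set.range (G.shuffleVec hζ β))

variable {β}

theorem shuffleVec_mem (T : G.Box ≃ Fin (k + l)) : G.shuffleVec hζ β T ∈ G.shuffleSpan hζ β :=
  Submodule.subset_span ⟨T, rfl⟩

variable [IsScalarTower ℂ (Yhat r (k + l) q) I] (hβ : G.IsEquivariant hζ β)

include hβ

theorem t_smul_shuffleVec (T : G.Box ≃ Fin (k + l)) (j : Fin (k + l)) :
    (Yhat.gens r (k + l) q).t j • G.shuffleVec hζ β T =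
      ζ ^ (G.datum.comp (T.symm j) : ℕ) • G.shuffleVec hζ β T := by
  induction T using G.descent_induction generalizing j with
  | h0 T₁ T₂ =>
    rw [shuffleVec_initial]
    refine Fin.addCases (fun i => ?_) (fun i => ?_) j
    · have h1 := hβ.left ((Yhat.gens r k q).t i) (CalMod.vec hζ G.θ T₁) (CalMod.vec hζ G.φ T₂)
      rw [Family.lift_t, CalMod.t_smul_vec, map_smul, LinearMap.smul_apply] at h1
      rw [initial_symm_castAdd]
      exact h1.symm
    · have h1 := hβ.right ((Yhat.gens r l q).t i) (CalMod.vec hζ G.θ T₁) (CalMod.vec hζ G.φ T₂)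
      rw [Family.lift_t, CalMod.t_smul_vec, map_smul] at h1
      rw [initial_symm_natAdd]
      exact h1.symm
  | h1 T i h hd ih =>
    have h1 := (Yhat.gens r (k + l) q).g_t i h (sw i h j)
    rw [show sw i h (sw i h j) = j by simp [sw]] at h1
    rw [G.shuffleVec_of_isDescent hζ β T hd, smul_smul, ← h1, mul_smul,
      ih _ (G.weight_act_lt hd), G.datum.act_symm, show sw i h (sw i h j) = j by simp [sw],
      smul_comm]

/-- If the labels `i` and `i + 1` are used on the same shape, `g_i` acts by the seminormal formula:
it can be moved past the generators that created the descents of `T`. -/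
theorem g_smul_shuffleVec (T : G.Box ≃ Fin (k + l)) (hT : G.datum.IsStd T) (i : ℕ)
    (h : i + 1 < k + l) (hs : G.side T ⟨i, Nat.lt_of_succ_lt h⟩ = G.side T ⟨i + 1, h⟩) :
    (Yhat.gens r (k + l) q).g i h • G.shuffleVec hζ β T =
      G.datum.cA (T.symm ⟨i, Nat.lt_of_succ_lt h⟩) (T.symm ⟨i + 1, h⟩) • G.shuffleVec hζ β T +
      G.datum.cB (T.symm ⟨i, Nat.lt_of_succ_lt h⟩) (T.symm ⟨i + 1, h⟩) •
        G.shuffleVec hζ β (G.datum.act i h T) := by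
  induction T using G.descent_induction generalizing i with
  | h0 T₁ T₂ =>
    obtain ⟨std1, std2⟩ := G.isStd_initial.1 hT
    have hiff : i < k ↔ i + 1 < k := by
      have e1 := G.side_initial T₁ T₂ ⟨i, Nat.lt_of_succ_lt h⟩
      have e2 := G.side_initial T₁ T₂ ⟨i + 1, h⟩
      rw [hs] at e1
      exact e1.symm.trans e2
    rcases lt_or_ge i k with hi | hi
    · have hi' := hiff.1 hi
      have h1 := hβ.left ((Yhat.gens r k q).g i hi') (CalMod.vec hζ G.θ T₁) (CalMod.vec hζ G.φ T₂)
      rw [Family.lift_g, CalMod.g_smul_vec _ _ _ std1, map_add, map_smul, map_smul,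
        LinearMap.add_apply, LinearMap.smul_apply, LinearMap.smul_apply,
        ← shuffleVec_initial, ← shuffleVec_initial, ← act_initial_left] at h1
      rw [show (G.initial T₁ T₂).symm ⟨i, Nat.lt_of_succ_lt h⟩ = _ from
          G.initial_symm_castAdd T₁ T₂ ⟨i, hi⟩,
        show (G.initial T₁ T₂).symm ⟨i + 1, h⟩ = _ from
          G.initial_symm_castAdd T₁ T₂ ⟨i + 1, hi'⟩]
      exact h1.symm
    · obtain ⟨a, rfl⟩ := Nat.exists_eq_add_of_le hi
      have ha : a + 1 < l := by omega
      have h1 := hβ.right ((Yhat.gens r l q).g a ha) (CalMod.vec hζ G.θ T₁) (CalMod.vec hζ G.φ T₂)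
      rw [Family.lift_g, CalMod.g_smul_vec _ _ _ std2, map_add, map_smul, map_smul,
        ← shuffleVec_initial, ← shuffleVec_initial, ← act_initial_right] at h1
      rw [show (G.initial T₁ T₂).symm ⟨k + a, Nat.lt_of_succ_lt h⟩ = _ from
          G.initial_symm_natAdd T₁ T₂ ⟨a, by omega⟩,
        show (G.initial T₁ T₂).symm ⟨k + a + 1, h⟩ = _ from
          G.initial_symm_natAdd T₁ T₂ ⟨a + 1, ha⟩]
      exact h1.symm
  | h1 T j hj hd ih =>
    have std1 := G.isStd_act hd.side_ne hT
    have hij : i ≠ j := by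
      rintro rfl
      exact hd.side_ne hs
    by_cases hfar : i + 2 ≤ j ∨ j + 2 ≤ i
    · have e1 : sw j hj ⟨i, Nat.lt_of_succ_lt h⟩ = ⟨i, Nat.lt_of_succ_lt h⟩ :=
        sw_of_ne _ _ (by simp only; omega) (by simp only; omega)
      have e2 : sw j hj ⟨i + 1, h⟩ = ⟨i + 1, h⟩ :=
        sw_of_ne _ _ (by simp only; omega) (by simp only; omega)
      have e3 : sw i h ⟨j, Nat.lt_of_succ_lt hj⟩ = ⟨j, Nat.lt_of_succ_lt hj⟩ :=
        sw_of_ne _ _ (by simp only; omega) (by simp only; omega)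
      have e4 : sw i h ⟨j + 1, hj⟩ = ⟨j + 1, hj⟩ :=
        sw_of_ne _ _ (by simp only; omega) (by simp only; omega)
      have hd' : G.IsDescent (G.datum.act i h T) j hj := by
        constructor
        · rw [side_act, e3]; exact hd.1
        · rw [side_act, e4]; exact hd.2
      have key := ih _ (G.weight_act_lt hd) std1 i h (by rw [side_act, side_act, e1, e2, hs])
      rw [G.datum.act_symm, G.datum.act_symm, e1, e2] at key
      rw [G.shuffleVec_of_isDescent hζ β _ hd', G.shuffleVec_of_isDescent hζ β T hd, smul_smul,
        ((Yhat.gens r (k + l) q).gg i j h hj hfar).eq, mul_smul, key, smul_add,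
        G.datum.act_comm i j h hj hfar, smul_comm, smul_comm (Family.g _ j hj)]
    · obtain rfl | rfl : j = i + 1 ∨ i = j + 1 := by omega
      · -- the sides of the labels `i`, `i + 1`, `i + 2` are `φ`, `φ`, `θ`
        have s0 := hs.trans hd.1
        have s1 := hd.1
        have s2 := hd.2
        have f1 : sw (i + 1) hj ⟨i, Nat.lt_of_succ_lt h⟩ = ⟨i, Nat.lt_of_succ_lt h⟩ :=
          sw_of_ne _ _ (by simp only; omega) (by simp only; omega)
        have f2 : sw i h ⟨i + 1 + 1, hj⟩ = ⟨i + 1 + 1, hj⟩ :=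
          sw_of_ne _ _ (by simp only; omega) (by simp only; omega)
        have hd1 : G.IsDescent (G.datum.act (i + 1) hj T) i h := by
          constructor
          · rw [side_act, f1, s0]
          · rw [side_act, sw_left, s2]
        have w1 := G.weight_act_lt hd
        have w2 := G.weight_act_lt hd1
        have std2 := G.isStd_act hd1.side_ne std1
        have key := ih _ (w2.trans w1) std2 (i + 1) hj (by
          simp only [side_act, sw_right, f1, f2, s0, s1])
        simp only [G.datum.act_symm, sw_right, f1, f2] at key
        have u1 : G.shuffleVec hζ β (G.datum.act i h T) =
            (Yhat.gens r (k + l) q).g (i + 1) hj • (Yhat.gens r (k + l) q).g i h •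
              G.shuffleVec hζ β
                (G.datum.act (i + 1) hj (G.datum.act i h (G.datum.act (i + 1) hj T))) := by
          rw [← G.shuffleVec_act hζ β (h := h), ← G.shuffleVec_act hζ β (h := hj),
            ← G.datum.act_braid i h hj, G.datum.act_act, G.datum.act_act]
          all_goals simp only [side_act, sw_left, sw_right, f1, f2, s0, s1, s2]
        rw [u1, G.shuffleVec_of_isDescent hζ β T hd, G.shuffleVec_of_isDescent hζ β _ hd1,
          smul_smul, smul_smul, (Yhat.gens r (k + l) q).braid i hj, mul_smul, key]
        simp only [mul_smul, smul_add]
        generalize G.datum.cA _ _ = a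
        generalize G.datum.cB _ _ = b
        simp only [smul_comm (Family.g _ _ _) a, smul_comm (Family.g _ _ _) b]
      · -- the sides of the labels `j`, `j + 1`, `j + 2` are `φ`, `θ`, `θ`
        have s0 := hd.1
        have s1 := hd.2
        have s2 := hs.symm.trans hd.2
        have f1 : sw (j + 1) h ⟨j, Nat.lt_of_succ_lt hj⟩ = ⟨j, Nat.lt_of_succ_lt hj⟩ :=
          sw_of_ne _ _ (by simp only; omega) (by simp only; omega)
        have f2 : sw j hj ⟨j + 1 + 1, h⟩ = ⟨j + 1 + 1, h⟩ :=
          sw_of_ne _ _ (by simp only; omega) (by simp only; omega)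
        have hd1 : G.IsDescent (G.datum.act j hj T) (j + 1) h := by
          constructor
          · rw [side_act, sw_right, s0]
          · rw [side_act, f2, s2]
        have w1 := G.weight_act_lt hd
        have w2 := G.weight_act_lt hd1
        have std2 := G.isStd_act hd1.side_ne std1
        have key := ih _ (w2.trans w1) std2 j hj (by
          simp only [side_act, sw_left, f1, f2, s1, s2])
        simp only [G.datum.act_symm, sw_left, f1, f2] at key
        have u1 : G.shuffleVec hζ β (G.datum.act (j + 1) h T) =
            (Yhat.gens r (k + l) q).g j hj • (Yhat.gens r (k + l) q).g (j + 1) h •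
              G.shuffleVec hζ β
                (G.datum.act j hj (G.datum.act (j + 1) h (G.datum.act j hj T))) := by
          rw [← G.shuffleVec_act hζ β (h := h), ← G.shuffleVec_act hζ β (h := hj),
            G.datum.act_braid j hj h, G.datum.act_act, G.datum.act_act]
          all_goals simp only [side_act, sw_left, sw_right, f1, f2, s0, s1, s2]
        rw [u1, G.shuffleVec_of_isDescent hζ β T hd, G.shuffleVec_of_isDescent hζ β _ hd1,
          smul_smul, smul_smul, ← (Yhat.gens r (k + l) q).braid j h, mul_smul, key]
        simp only [mul_smul, smul_add]
        generalize G.datum.cA _ _ = a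
        generalize G.datum.cB _ _ = b
        simp only [smul_comm (Family.g _ _ _) a, smul_comm (Family.g _ _ _) b]

omit hβ in
theorem mem_stabilizer_shuffleSpan {a : Yhat r (k + l) q}
    (h : ∀ T, a • G.shuffleVec hζ β T ∈ G.shuffleSpan hζ β) :
    a ∈ stabilizer (Yhat r (k + l) q) (G.shuffleSpan hζ β) := by
  rw [mem_stabilizer]
  have hle : G.shuffleSpan hζ β ≤
      (G.shuffleSpan hζ β).comap (Algebra.lsmul ℂ ℂ I a) := by
    refine Submodule.span_le.2 ?_
    rintro _ ⟨T, rfl⟩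
    exact h T
  exact fun x hx => hle hx

theorem t_mem_stabilizer (j : Fin (k + l)) :
    (Yhat.gens r (k + l) q).t j ∈ stabilizer (Yhat r (k + l) q) (G.shuffleSpan hζ β) :=
  G.mem_stabilizer_shuffleSpan hζ fun T => by
    rw [G.t_smul_shuffleVec hζ hβ]
    exact Submodule.smul_mem _ _ (G.shuffleVec_mem hζ T)

/-- At a descent, `g_i` acts through its quadratic relation. -/
theorem g_smul_of_isDescent {T : G.Box ≃ Fin (k + l)} {i : ℕ} {h : i + 1 < k + l}
    (hd : G.IsDescent T i h) :
    ∃ c : ℂ, (Yhat.gens r (k + l) q).g i h • G.shuffleVec hζ β T =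
      G.shuffleVec hζ β (G.datum.act i h T) + c • G.shuffleVec hζ β T := by
  -- the idempotent of the quadratic relation acts on the eigenvector by a scalar
  have ht : ∀ j, (Yhat.gens r (k + l) q).t j ∈
      stabilizer (Yhat r (k + l) q) (Submodule.span ℂ {G.shuffleVec hζ β T}) := by
    intro j
    rw [mem_stabilizer]
    intro x hx
    obtain ⟨a, rfl⟩ := Submodule.mem_span_singleton.1 hx
    rw [smul_comm, G.t_smul_shuffleVec hζ hβ]
    exact Submodule.smul_mem _ _
      (Submodule.smul_mem _ _ (Submodule.mem_span_singleton_self _))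
  obtain ⟨c, hc⟩ := Submodule.mem_span_singleton.1 (mem_stabilizer.1
    (idem_mem _ r (ht ⟨i, Nat.lt_of_succ_lt h⟩) (ht ⟨i + 1, h⟩)) _
    (Submodule.mem_span_singleton_self _))
  refine ⟨(q - q⁻¹) * c, ?_⟩
  conv_lhs => rw [G.shuffleVec_of_isDescent hζ β T hd]
  rw [smul_smul, (Yhat.gens r (k + l) q).quad, add_smul, one_smul, smul_assoc, mul_smul,
    ← G.shuffleVec_of_isDescent hζ β T hd, ← hc, smul_smul]

theorem g_mem_stabilizer (i : ℕ) (h : i + 1 < k + l) :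
    (Yhat.gens r (k + l) q).g i h ∈ stabilizer (Yhat r (k + l) q) (G.shuffleSpan hζ β) := by
  refine G.mem_stabilizer_shuffleSpan hζ fun T => ?_
  by_cases hs : G.side T ⟨i, Nat.lt_of_succ_lt h⟩ = G.side T ⟨i + 1, h⟩
  · by_cases hT : G.datum.IsStd T
    · rw [G.g_smul_shuffleVec hζ hβ T hT i h hs]
      exact Submodule.add_mem _ (Submodule.smul_mem _ _ (G.shuffleVec_mem hζ _))
        (Submodule.smul_mem _ _ (G.shuffleVec_mem hζ _))
    · rw [G.shuffleVec_of_not_isStd hζ β T hT, smul_zero]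
      exact zero_mem _
  · cases h1 : G.side T ⟨i, Nat.lt_of_succ_lt h⟩
    · have hd : G.IsDescent T i h := ⟨h1, by
        rw [h1] at hs
        exact Bool.eq_true_of_not_eq_false (Ne.symm hs)⟩
      obtain ⟨c, hc⟩ := G.g_smul_of_isDescent hζ hβ hd
      rw [hc]
      exact Submodule.add_mem _ (G.shuffleVec_mem hζ _)
        (Submodule.smul_mem _ _ (G.shuffleVec_mem hζ _))
    · rw [← G.shuffleVec_act hζ β h1 (by
        rw [h1] at hs
        exact Bool.eq_false_of_not_eq_true (Ne.symm hs))]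
      exact G.shuffleVec_mem hζ _

/-- The span of the shuffle vectors is stable under all `X_j`. The induction on the descents needs
the statement for every `j`, although `X₁` suffices to generate. -/
theorem XX_smul_mem (T : G.Box ≃ Fin (k + l)) (j : ℕ) (hj : j < k + l) :
    (Yhat.gens r (k + l) q).XX j hj • G.shuffleVec hζ β T ∈ G.shuffleSpan hζ β := by
  induction T using G.descent_induction generalizing j with
  | h0 T₁ T₂ =>
    rcases lt_or_ge j k with h | h
    · have h1 := hβ.left ((Yhat.gens r k q).XX j h) (CalMod.vec hζ G.θ T₁) (CalMod.vec hζ G.φ T₂)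
      rw [Family.lift_XX, Family.left_XX, CalMod.XX_smul_vec hζ G.θ T₁ ⟨j, h⟩, map_smul,
        LinearMap.smul_apply, ← shuffleVec_initial] at h1
      rw [← h1]
      exact Submodule.smul_mem _ _ (G.shuffleVec_mem hζ _)
    · obtain ⟨a, rfl⟩ := Nat.exists_eq_add_of_le h
      have ha : a < l := by omega
      have h1 := hβ.right ((Yhat.gens r l q).XX a ha) (CalMod.vec hζ G.θ T₁) (CalMod.vec hζ G.φ T₂)
      rw [Family.lift_XX, Family.right_XX, CalMod.XX_smul_vec hζ G.φ T₂ ⟨a, ha⟩, map_smul,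
        ← shuffleVec_initial] at h1
      rw [← h1]
      exact Submodule.smul_mem _ _ (G.shuffleVec_mem hζ _)
  | h1 T i h hd ih =>
    have ih' := ih _ (G.weight_act_lt hd)
    have hg := mem_stabilizer.1 (G.g_mem_stabilizer hζ hβ i h)
    have e := G.shuffleVec_of_isDescent hζ β T hd
    have hX : (Yhat.gens r (k + l) q).XX (i + 1) h =
      (Yhat.gens r (k + l) q).g i h * (Yhat.gens r (k + l) q).XX i (Nat.lt_of_succ_lt h) *
        (Yhat.gens r (k + l) q).g i h := rfl
    by_cases h1 : j = i + 1
    · subst h1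
      -- `X_{i+1} g_i y = g_i X_i g_i² y`, where `g_i² y` is reduced by the quadratic relation
      obtain ⟨c, hc⟩ := G.g_smul_of_isDescent hζ hβ hd
      have h3 : (Yhat.gens r (k + l) q).XX (i + 1) h • G.shuffleVec hζ β T =
          (Yhat.gens r (k + l) q).g i h • (Yhat.gens r (k + l) q).XX i (Nat.lt_of_succ_lt h) •
            G.shuffleVec hζ β (G.datum.act i h T) +
          c • (Yhat.gens r (k + l) q).XX (i + 1) h • G.shuffleVec hζ β (G.datum.act i h T) := by
        rw [hX, mul_smul, hc, smul_add, mul_smul, smul_comm _ c, e]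
        simp only [mul_smul]
      rw [h3]
      exact Submodule.add_mem _ (hg _ (ih' _ _)) (Submodule.smul_mem _ _ (ih' _ _))
    by_cases h2 : j = i
    · subst h2
      have hginv : (Yhat.gens r (k + l) q).ginv j h ∈
          stabilizer (Yhat r (k + l) q) (G.shuffleSpan hζ β) :=
        Subalgebra.sub_mem _ (G.g_mem_stabilizer hζ hβ j h)
          (Subalgebra.smul_mem _ (idem_mem _ r (G.t_mem_stabilizer hζ hβ _)
            (G.t_mem_stabilizer hζ hβ _)) _)
      have h3 := mem_stabilizer.1 hginv _ (ih' (j + 1) h)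
      rw [hX, smul_smul, ← mul_assoc, ← mul_assoc, Family.ginv_g, one_mul, mul_smul, ← e] at h3
      exact h3
    · have hcomm : Commute ((Yhat.gens r (k + l) q).g i h) ((Yhat.gens r (k + l) q).XX j hj) := by
        rcases lt_or_ge j i with h3 | h3
        · exact Family.g_XX_gt _ j hj i h h3
        · exact Family.g_XX_lt _ j hj i h (by omega)
      rw [e, smul_smul, ← hcomm.eq, mul_smul]
      exact hg _ (ih' _ _)

omit hβ in
instance : FiniteDimensional ℂ (G.shuffleSpan hζ β) :=
  FiniteDimensional.span_of_finite ℂ (Set.finite_range _)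

/-- The span of the shuffle vectors is a submodule, so that it is everything if the values of `β`
generate the module. -/
theorem shuffleSpan_eq_top
    (hgen : Submodule.span (Yhat r (k + l) q) {x | ∃ m n, x = β m n} = ⊤) :
    G.shuffleSpan hζ β = ⊤ := by
  let W : Submodule (Yhat r (k + l) q) I :=
    { G.shuffleSpan hζ β with
      smul_mem' := fun y x hx => Yhat.smul_mem_of_gens _ (G.t_mem_stabilizer hζ hβ)
        (G.g_mem_stabilizer hζ hβ) (fun h => G.mem_stabilizer_shuffleSpan hζ fun T =>
          G.XX_smul_mem hζ hβ T 0 h) y hx }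
  have hβ_mem : ∀ m n, β m n ∈ G.shuffleSpan hζ β := by
    intro m n
    rw [← (CalMod.basis hζ G.θ).linearCombination_repr m,
      ← (CalMod.basis hζ G.φ).linearCombination_repr n, Finsupp.linearCombination_apply,
      Finsupp.linearCombination_apply, Finsupp.sum, Finsupp.sum, map_sum]
    refine Submodule.sum_mem _ fun T₂ _ => ?_
    rw [map_smul, map_sum, LinearMap.sum_apply]
    refine Submodule.smul_mem _ _ (Submodule.sum_mem _ fun T₁ _ => ?_)
    rw [map_smul, LinearMap.smul_apply, CalMod.basis_apply, CalMod.basis_apply,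
      ← shuffleVec_initial]
    exact Submodule.smul_mem _ _ (G.shuffleVec_mem hζ _)
  have hW : (⊤ : Submodule (Yhat r (k + l) q) I) ≤ W := by
    rw [← hgen, Submodule.span_le]
    rintro _ ⟨m, n, rfl⟩
    exact hβ_mem m n
  exact eq_top_iff.2 fun x _ => hW (Submodule.mem_top (x := x))

end GluePair

end AffineYokonumaHecke

namespace AffineYokonumaHecke

open scoped TensorProduct

theorem parabolic_tmul {r k l : ℕ} {q : ℂ} (x : Yhat r k q) (y : Yhat r l q) :
    parabolic r k l q (x ⊗ₜ[ℂ] y) =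
      (Yhat.gens r (k + l) q).left.lift x * (Yhat.gens r (k + l) q).right.lift y :=
  Algebra.TensorProduct.lift_tmul _ _ _ _ _

namespace GluePair

variable {q : ℂ} {C : ContentDomain q} {r k l : ℕ} (G : GluePair C r k l) [NeZero r] {ζ : ℂ}
  (hζ : IsPrimitiveRoot ζ r)

/-! ### The combined module as a target of the outer tensor product -/

/-- The bilinear map `(w_{T₁}, w_{T₂}) ↦ w_T` into the combined module, where `T` is the initial
labelling made of `T₁` and `T₂`. -/
noncomputable def initialMap : CalMod hζ G.θ →ₗ[ℂ] CalMod hζ G.φ →ₗ[ℂ] G.datum.Mod hζ :=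
  (CalMod.basis hζ G.θ).constr ℂ fun T₁ => (CalMod.basis hζ G.φ).constr ℂ fun T₂ =>
    SeminormalDatum.Mod.vec G.datum hζ (G.initial T₁.1 T₂.1)

theorem initialMap_vec (T₁ : G.θ.Box ≃ Fin k) (T₂ : G.φ.Box ≃ Fin l) :
    G.initialMap hζ (CalMod.vec hζ G.θ T₁) (CalMod.vec hζ G.φ T₂) =
      SeminormalDatum.Mod.vec G.datum hζ (G.initial T₁ T₂) := by
  by_cases h1 : G.θ.IsStd T₁
  · by_cases h2 : G.φ.IsStd T₂
    · rw [← CalMod.basis_apply hζ G.θ ⟨T₁, h1⟩, ← CalMod.basis_apply hζ G.φ ⟨T₂, h2⟩, initialMap,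
        Module.Basis.constr_basis, Module.Basis.constr_basis]
    · rw [show CalMod.vec hζ G.φ T₂ = 0 from G.φ.w_of_not h2, map_zero,
        SeminormalDatum.Mod.vec_of_not (D := G.datum) (T := G.initial T₁ T₂) hζ
          fun h => h2 (G.isStd_initial.1 h).2]
  · rw [show CalMod.vec hζ G.θ T₁ = 0 from G.θ.w_of_not h1, map_zero, LinearMap.zero_apply,
      SeminormalDatum.Mod.vec_of_not (D := G.datum) (T := G.initial T₁ T₂) hζ
          fun h => h1 (G.isStd_initial.1 h).1]

variable {G} in
theorem bilin_ext {V : Type*} [AddCommGroup V] [Module ℂ V]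
    {f g : CalMod hζ G.θ →ₗ[ℂ] CalMod hζ G.φ →ₗ[ℂ] V}
    (h : ∀ T₁ T₂, G.θ.IsStd T₁ → G.φ.IsStd T₂ →
      f (CalMod.vec hζ G.θ T₁) (CalMod.vec hζ G.φ T₂) =
        g (CalMod.vec hζ G.θ T₁) (CalMod.vec hζ G.φ T₂)) : f = g := by
  refine (CalMod.basis hζ G.θ).ext fun T₁ => (CalMod.basis hζ G.φ).ext fun T₂ => ?_
  rw [CalMod.basis_apply, CalMod.basis_apply]
  exact h _ _ T₁.2 T₂.2

theorem initialMap_isEquivariant : G.IsEquivariant hζ (G.initialMap hζ) where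
  left x m n := by
    have key : ∀ (a : Yhat r k q) (b : Yhat r (k + l) q),
        (∀ T₁ T₂, G.θ.IsStd T₁ → G.φ.IsStd T₂ →
          G.initialMap hζ (a • CalMod.vec hζ G.θ T₁) (CalMod.vec hζ G.φ T₂) =
            b • G.initialMap hζ (CalMod.vec hζ G.θ T₁) (CalMod.vec hζ G.φ T₂)) →
        ∀ m, G.initialMap hζ (a • m) n = b • G.initialMap hζ m n := fun a b h m =>
      LinearMap.congr_fun₂ (bilin_ext hζ (f := (G.initialMap hζ).comp (Algebra.lsmul ℂ ℂ _ a))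
        (g := (G.initialMap hζ).compr₂ (Algebra.lsmul ℂ ℂ _ b)) h) m n
    refine (Yhat.gens r (k + l) q).left.intertwine ((G.initialMap hζ).flip n) ?_ ?_ ?_ x m
    · intro j
      refine key _ _ fun T₁ T₂ h1 h2 => ?_
      rw [CalMod.t_smul_vec, map_smul, LinearMap.smul_apply, initialMap_vec]
      refine .trans ?_ (SeminormalDatum.Mod.t_smul_vec G.datum hζ _ (Fin.castAdd l j)).symm
      rw [initial_symm_castAdd]
      rfl
    · intro i h
      refine key _ _ fun T₁ T₂ h1 h2 => ?_
      rw [CalMod.g_smul_vec _ _ _ h1, map_add, map_smul, map_smul, LinearMap.add_apply,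
        LinearMap.smul_apply, LinearMap.smul_apply, initialMap_vec, initialMap_vec,
        ← act_initial_left]
      refine .trans ?_ (SeminormalDatum.Mod.g_smul_vec G.datum hζ
        (G.isStd_initial.2 ⟨h1, h2⟩) i (by omega)).symm
      rw [show (G.initial T₁ T₂).symm ⟨i, _⟩ = _ from
          G.initial_symm_castAdd T₁ T₂ ⟨i, Nat.lt_of_succ_lt h⟩,
        show (G.initial T₁ T₂).symm ⟨i + 1, _⟩ = _ from G.initial_symm_castAdd T₁ T₂ ⟨i + 1, h⟩]
      rfl
    · intro h
      refine key _ _ fun T₁ T₂ h1 h2 => ?_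
      rw [show (Yhat.gens r k q).X h = (Yhat.gens r k q).XX 0 h from rfl,
        CalMod.XX_smul_vec hζ G.θ T₁ ⟨0, h⟩, map_smul, LinearMap.smul_apply, initialMap_vec]
      refine .trans ?_ (SeminormalDatum.Mod.XX_smul_vec G.datum hζ _ 0 (by omega)).symm
      rw [show (G.initial T₁ T₂).symm ⟨0, _⟩ = _ from G.initial_symm_castAdd T₁ T₂ ⟨0, h⟩]
      rfl
  right x m n := by
    have key : ∀ (a : Yhat r l q) (b : Yhat r (k + l) q),
        (∀ T₁ T₂, G.θ.IsStd T₁ → G.φ.IsStd T₂ →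
          G.initialMap hζ (CalMod.vec hζ G.θ T₁) (a • CalMod.vec hζ G.φ T₂) =
            b • G.initialMap hζ (CalMod.vec hζ G.θ T₁) (CalMod.vec hζ G.φ T₂)) →
        ∀ n, G.initialMap hζ m (a • n) = b • G.initialMap hζ m n := fun a b h n =>
      LinearMap.congr_fun₂ (bilin_ext hζ (f := (G.initialMap hζ).compl₂ (Algebra.lsmul ℂ ℂ _ a))
        (g := (G.initialMap hζ).compr₂ (Algebra.lsmul ℂ ℂ _ b)) h) m n
    refine (Yhat.gens r (k + l) q).right.intertwine (G.initialMap hζ m) ?_ ?_ ?_ x n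
    · intro j
      refine key _ _ fun T₁ T₂ h1 h2 => ?_
      rw [CalMod.t_smul_vec, map_smul, initialMap_vec]
      refine .trans ?_ (SeminormalDatum.Mod.t_smul_vec G.datum hζ _ (Fin.natAdd k j)).symm
      rw [initial_symm_natAdd]
      rfl
    · intro i h
      refine key _ _ fun T₁ T₂ h1 h2 => ?_
      rw [CalMod.g_smul_vec _ _ _ h2, map_add, map_smul, map_smul, initialMap_vec, initialMap_vec,
        ← act_initial_right]
      refine .trans ?_ (SeminormalDatum.Mod.g_smul_vec G.datum hζ
        (G.isStd_initial.2 ⟨h1, h2⟩) (k + i) (by omega)).symm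
      rw [show (G.initial T₁ T₂).symm ⟨k + i, _⟩ = _ from
          G.initial_symm_natAdd T₁ T₂ ⟨i, Nat.lt_of_succ_lt h⟩,
        show (G.initial T₁ T₂).symm ⟨k + i + 1, _⟩ = _ from
          G.initial_symm_natAdd T₁ T₂ ⟨i + 1, h⟩]
      rfl
    · intro h
      refine key _ _ fun T₁ T₂ h1 h2 => ?_
      rw [show (Yhat.gens r l q).X h = (Yhat.gens r l q).XX 0 h from rfl,
        CalMod.XX_smul_vec hζ G.φ T₂ ⟨0, h⟩, map_smul, initialMap_vec]
      refine .trans ?_ (SeminormalDatum.Mod.XX_smul_vec G.datum hζ _ k (by omega)).symm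
      rw [show (G.initial T₁ T₂).symm ⟨k, _⟩ = _ from G.initial_symm_natAdd T₁ T₂ ⟨0, h⟩]
      rfl

/-- The vectors of the initial labellings generate the combined module: at a descent, the swap
coefficient from `θ` to `φ` does not vanish. -/
theorem vec_mem_of_initial (N : Submodule (Yhat r (k + l) q) (G.datum.Mod hζ))
    (hN : ∀ T₁ T₂, SeminormalDatum.Mod.vec G.datum hζ (G.initial T₁ T₂) ∈ N)
    (T : G.Box ≃ Fin (k + l)) : SeminormalDatum.Mod.vec G.datum hζ T ∈ N := by
  induction T using G.descent_induction with
  | h0 T₁ T₂ => exact hN T₁ T₂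
  | h1 T i h hd ih =>
    by_cases hT : G.datum.IsStd T
    · have ih := ih _ (G.weight_act_lt hd)
      have key := SeminormalDatum.Mod.g_smul_vec G.datum hζ (G.isStd_act hd.side_ne hT) i h
      rw [G.datum.act_act, G.datum.act_symm, G.datum.act_symm, sw_left, sw_right] at key
      obtain ⟨x, hx⟩ := Sum.isLeft_iff.1 hd.2
      obtain ⟨y, hy⟩ := Sum.isRight_iff.1 (Sum.isLeft_eq_false.1 hd.1)
      rw [hx, hy] at key
      have hne : G.datum.cB (.inl x) (.inr y) ≠ 0 := G.swapCoeff_ne_zero x y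
      have h1 : G.datum.cB (.inl x) (.inr y) • SeminormalDatum.Mod.vec G.datum hζ T ∈ N := by
        rw [← sub_eq_iff_eq_add'.2 key]
        exact N.sub_mem (N.smul_mem _ ih) (N.smul_of_tower_mem _ ih)
      have h2 := N.smul_of_tower_mem (G.datum.cB (.inl x) (.inr y))⁻¹ h1
      rwa [smul_smul, inv_mul_cancel₀ hne, one_smul] at h2
    · rw [SeminormalDatum.Mod.vec_of_not _ _ hT]
      exact zero_mem N

/-! ### The induced module -/

/-- The module induced from the outer tensor product. -/
abbrev Ind : Type :=
  Induced (parabolic r k l q) (outerRep (CalMod hζ G.θ) (CalMod hζ G.φ))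

instance : IsScalarTower ℂ (Yhat r (k + l) q) (G.Ind hζ) where
  smul_assoc c a x := by
    obtain ⟨y, rfl⟩ := Submodule.Quotient.mk_surjective _ x
    exact congrArg Submodule.Quotient.mk (smul_assoc c a y)

/-- The bilinear map `(m, n) ↦ 1 ⊗ (m ⊗ n)` into the induced module. -/
noncomputable def indMap : CalMod hζ G.θ →ₗ[ℂ] CalMod hζ G.φ →ₗ[ℂ] G.Ind hζ :=
  (TensorProduct.mk ℂ (CalMod hζ G.θ) (CalMod hζ G.φ)).compr₂
    (((Submodule.mkQ _).restrictScalars ℂ).comp (TensorProduct.mk ℂ (Yhat r (k + l) q) _ 1))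

theorem indMap_apply (m : CalMod hζ G.θ) (n : CalMod hζ G.φ) :
    G.indMap hζ m n = Submodule.Quotient.mk ((1 : Yhat r (k + l) q) ⊗ₜ[ℂ] (m ⊗ₜ[ℂ] n)) := rfl

theorem smul_indMap (a : Yhat r (k + l) q) (m : CalMod hζ G.θ) (n : CalMod hζ G.φ) :
    a • G.indMap hζ m n = Submodule.Quotient.mk (a ⊗ₜ[ℂ] (m ⊗ₜ[ℂ] n)) := by
  rw [indMap_apply, ← Submodule.Quotient.mk_smul, TensorProduct.smul_tmul', smul_eq_mul, mul_one]

theorem indMap_smul_smul (x : Yhat r k q) (y : Yhat r l q) (m : CalMod hζ G.θ)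
    (n : CalMod hζ G.φ) :
    G.indMap hζ (x • m) (y • n) = parabolic r k l q (x ⊗ₜ[ℂ] y) • G.indMap hζ m n := by
  rw [smul_indMap, indMap_apply, eq_comm, Submodule.Quotient.eq]
  exact Submodule.subset_span ⟨1, x ⊗ₜ[ℂ] y, m ⊗ₜ[ℂ] n, by rw [one_mul]; rfl⟩

theorem indMap_isEquivariant : G.IsEquivariant hζ (G.indMap hζ) where
  left x m n := by
    have h := G.indMap_smul_smul hζ x 1 m n
    rwa [one_smul, parabolic_tmul, map_one, mul_one] at h
  right x m n := by
    have h := G.indMap_smul_smul hζ 1 x m n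
    rwa [one_smul, parabolic_tmul, map_one, one_mul] at h

theorem span_indMap : Submodule.span (Yhat r (k + l) q) {x | ∃ m n, x = G.indMap hζ m n} = ⊤ := by
  rw [eq_top_iff]
  rintro x -
  obtain ⟨x, rfl⟩ := Submodule.Quotient.mk_surjective _ x
  induction x with
  | zero => exact zero_mem _
  | add x y hx hy => exact add_mem hx hy
  | tmul a z =>
    induction z with
    | zero => rw [TensorProduct.tmul_zero]; exact zero_mem _
    | add x y hx hy => rw [TensorProduct.tmul_add]; exact add_mem hx hy
    | tmul m n =>
      rw [← smul_indMap]
      exact Submodule.smul_mem _ _ (Submodule.subset_span ⟨m, n, rfl⟩)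

variable {V : Type} [AddCommGroup V] [Module ℂ V] [Module (Yhat r (k + l) q) V]
  {β : CalMod hζ G.θ →ₗ[ℂ] CalMod hζ G.φ →ₗ[ℂ] V}

theorem IsEquivariant.parabolic_smul (hβ : G.IsEquivariant hζ β) (b : Yhat r k q ⊗[ℂ] Yhat r l q)
    (z : CalMod hζ G.θ ⊗[ℂ] CalMod hζ G.φ) :
    TensorProduct.lift β (outerRep (CalMod hζ G.θ) (CalMod hζ G.φ) b z) =
      parabolic r k l q b • TensorProduct.lift β z := by
  induction b with
  | zero => simp
  | add x y hx hy => simp only [map_add, LinearMap.add_apply, add_smul, hx, hy]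
  | tmul x y =>
    induction z with
    | zero => simp
    | add z z' hz hz' => simp only [map_add, smul_add, hz, hz']
    | tmul m n =>
      rw [parabolic_tmul, mul_smul, TensorProduct.lift.tmul,
        ← hβ.right, ← hβ.left]
      rfl

variable [IsScalarTower ℂ (Yhat r (k + l) q) V]

/-- The linear map `a ⊗ z ↦ a β(z)`. -/
noncomputable def extendScalars (β : CalMod hζ G.θ →ₗ[ℂ] CalMod hζ G.φ →ₗ[ℂ] V) :
    Yhat r (k + l) q ⊗[ℂ] (CalMod hζ G.θ ⊗[ℂ] CalMod hζ G.φ) →ₗ[Yhat r (k + l) q] V :=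
  TensorProduct.AlgebraTensorModule.lift
    (LinearMap.toSpanSingleton (Yhat r (k + l) q)
      (CalMod hζ G.θ ⊗[ℂ] CalMod hζ G.φ →ₗ[ℂ] V) (TensorProduct.lift β))

theorem extendScalars_tmul (β : CalMod hζ G.θ →ₗ[ℂ] CalMod hζ G.φ →ₗ[ℂ] V)
    (a : Yhat r (k + l) q) (z : CalMod hζ G.θ ⊗[ℂ] CalMod hζ G.φ) :
    G.extendScalars hζ β (a ⊗ₜ[ℂ] z) = a • TensorProduct.lift β z := rfl

theorem inducedRel_le_ker (hβ : G.IsEquivariant hζ β) :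
    inducedRel (parabolic r k l q) (outerRep (CalMod hζ G.θ) (CalMod hζ G.φ)) ≤
      LinearMap.ker (G.extendScalars hζ β) := by
  rw [inducedRel, Submodule.span_le]
  rintro _ ⟨a, b, z, rfl⟩
  refine LinearMap.mem_ker.2 ?_
  rw [map_sub, extendScalars_tmul, extendScalars_tmul, hβ.parabolic_smul, mul_smul, sub_self]

/-- Frobenius reciprocity: an equivariant bilinear map extends to the induced module. -/
noncomputable def indLift (hβ : G.IsEquivariant hζ β) :
    G.Ind hζ →ₗ[Yhat r (k + l) q] V :=
  Submodule.liftQ _ (G.extendScalars hζ β) (G.inducedRel_le_ker hζ hβ)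

theorem indLift_indMap (hβ : G.IsEquivariant hζ β) (m : CalMod hζ G.θ) (n : CalMod hζ G.φ) :
    G.indLift hζ hβ (G.indMap hζ m n) = β m n := by
  rw [indMap_apply, indLift, Submodule.liftQ_apply, extendScalars_tmul, one_smul,
    TensorProduct.lift.tmul]

/-- The induced module is the combined module. It is spanned by the shuffle vectors of the standard
labellings, so that its dimension is at most that of the combined module, onto which it maps. -/
theorem indLift_bijective :
    Function.Bijective (G.indLift hζ (G.initialMap_isEquivariant hζ)) := by
  set Φ := G.indLift hζ (G.initialMap_isEquivariant hζ) with hΦ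
  have hsurj : Function.Surjective Φ := by
    have hle : ⊤ ≤ (LinearMap.range Φ).restrictScalars ℂ := by
      rw [← (SeminormalDatum.Mod.basis G.datum hζ).span_eq, Submodule.span_le]
      rintro _ ⟨T, rfl⟩
      rw [SeminormalDatum.Mod.basis_apply]
      refine G.vec_mem_of_initial hζ (LinearMap.range Φ) (fun T₁ T₂ => ?_) T.1
      rw [← initialMap_vec, ← G.indLift_indMap hζ (G.initialMap_isEquivariant hζ)]
      exact ⟨_, rfl⟩
    exact fun x => hle (Submodule.mem_top (x := x))
  let L : G.datum.Mod hζ →ₗ[ℂ] G.Ind hζ :=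
    (SeminormalDatum.Mod.basis G.datum hζ).constr ℂ fun T => G.shuffleVec hζ (G.indMap hζ) T.1
  have hL : Function.Surjective L := by
    rw [← LinearMap.range_eq_top, eq_top_iff,
      ← G.shuffleSpan_eq_top hζ (G.indMap_isEquivariant hζ) (G.span_indMap hζ), shuffleSpan,
      Submodule.span_le]
    rintro _ ⟨T, rfl⟩
    by_cases hT : G.datum.IsStd T
    · exact ⟨_, (SeminormalDatum.Mod.basis G.datum hζ).constr_basis ℂ _ ⟨T, hT⟩⟩
    · rw [G.shuffleVec_of_not_isStd hζ _ T hT]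
      exact zero_mem _
  have hinj : Function.Injective ((Φ.restrictScalars ℂ).comp L) :=
    LinearMap.injective_iff_surjective.2 (hsurj.comp hL)
  refine ⟨fun x y hxy => ?_, hsurj⟩
  obtain ⟨x, rfl⟩ := hL x
  obtain ⟨y, rfl⟩ := hL y
  exact congrArg L (hinj hxy)

end GluePair

end AffineYokonumaHecke

open AffineYokonumaHecke in
theorem theorem4p3 {r k l : ℕ} [NeZero r] {q : ℂ} (hq0 : q ≠ 0) (hq : ∀ m : ℕ, 0 < m → q ^ m ≠ 1)
    {ζ : ℂ} (hζ : IsPrimitiveRoot ζ r) (C : ContentDomain q)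
    (θ : PlacedShape C r k) (φ : PlacedShape C r l)
    (u v : Fin r → ℤ × ℤ)
    (hu : ∀ p, IsLastBox (θ.shape p) (u p)) (hv : ∀ p, IsFirstBox (φ.shape p) (v p))
    (hjunction : ∀ p, θ.content p (u p) + 1 = φ.content p (v p))
    (hglue : ∀ (d : Dir) (p : Fin r),
      IsContent C (glueShape (θ.shape p) (φ.shape p) (u p) (v p) d)
        (glueContent (θ.shape p) (θ.content p) (φ.content p) (u p) (v p) d)) :
    (∀ w : Fin r → Dir,
      IsCalibrated r (k + l) q ζ (CalMod hζ (θ.glue φ hu hv w fun p => hglue (w p) p))) ∧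
    HasFactors (Yhat r (k + l) q)
      (Induced (parabolic r k l q) (outerRep (CalMod hζ θ) (CalMod hζ φ)))
      (fun w : Fin r → Dir => CalMod hζ (θ.glue φ hu hv w fun p => hglue (w p) p)) := by
  let G : GluePair C r k l := ⟨θ, φ, u, v, hu, hv, hjunction, hglue⟩
  exact ⟨fun w => CalMod.isCalibrated hζ _, HasFactors.congr _
    (LinearEquiv.ofBijective _ (G.indLift_bijective hζ)) (G.hasFactors_datum hζ)⟩
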